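/- **Model.** Fix $d,R_t,R_r,d_0,\lambda,\lambda_p>0$ and integers $N_t,N_r\ge 1$ with $\frac{\lambda}{d_0N_t}\le\pi$. For $N\in\{N_t,N_r\}$ and an angle $\phi\in[0,\pi]$ put $G_N(\phi)=\cos^2\!\big(\frac{\pi N d_0}{2\lambda}\phi\big)$ if $\phi\le\frac{\lambda}{d_0N}$ and $G_N(\phi)=0$ otherwise. For a transmitter $y\in\mathbb R^2$ with receiver $x$, $|x-y|=d$, let $$S_t(y)=\{z:|z-y|\le R_t\sqrt{G_{N_t}(\angle(z-y,x-y))}\},\qquad S_r(x)=\{z:|z-x|\le R_r\sqrt{G_{N_r}(\angle(z-x,y-x))}\};$$ the exclusion region of the pair is $S_t(y)\cup S_r(x)$. The potential transmitters $(y_i)$ form a homogeneous Poisson process on $\mathbb R^2$ of intensity $\lambda_p$; they carry i.i.d. orientations $\theta_i$, uniform on $[0,2\pi]$ and independent of the points, and $x_i=y_i+d(\cos\theta_i,\sin\theta_i)$. In the Type I G-HCP a pair is retained (active) iff no other potential transmitter lies in its exclusion region. In the Type II G-HCP there are in addition i.i.d. time marks $t_i$, uniform on $[0,1]$ and independent of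 the points and the orientations, and a pair is retained iff no other potential transmitter with a smaller time mark lies in its exclusion region. Let $\Phi$ be the process of active transmitters, $\lambda_b$ its intensity, and $\mathbb E^!_{(o,0)}$ the reduced Palm expectation given that the pair with transmitter $o=(0,0)$ and orientation $0$ (so with receiver $x_o=(d,0)$) is active. The number of hidden nodes is $N_h=\#\{y\in\Phi\setminus\{o\}: x_o\in S_t(y)\}$. **Kernels.** For $(r,\beta,\theta)$ consider the pair with transmitter $y=(r\cos\beta,r\sin\beta)$ and receiver $x=y+d(\cos\theta,\sin\theta)$. Let $V=V(r,\beta,\theta)$ be the area of the union of its exclusion region and that of $(o,x_o)$, and $V_o$ the area of the exclusion region of $(o,x_o)$. Let $\lfloor\phi\rceil\in[0,\pi]$ be the angle equal to $\phi$ up to sign and multiples of $2\pi$, and - $S_1=\{r^2\le R_t^2G_{N_t}(\lfloor\theta-\beta-\pi\rceil)\}$, i.e. $o\in S_t(y)$; - $S_2=\{q\le R_r^2G_{N_r}(\arccos\frac{r\cos(\theta-\beta)+d}{\sqrt q})\}$ with $q=r^2+2rd\cos(\beta-\theta)+d^2$, i.e. $o\in S_r(x)$; - $S_3=\{r^2\le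 R_t^2G_{N_t}(\lfloor\beta\rceil)\}$, i.e. $y\in S_t(o)$; - $S_4=\{r_y^2\le R_r^2G_{N_r}(\arccos\frac{d-r\cos\beta}{r_y})\}$, i.e. $y\in S_r(x_o)$, where $r_y=\sqrt{r^2+d^2-2rd\cos\beta}$. The Type I kernel is $k=0$ on $S_1\cup S_2\cup S_3\cup S_4$ and $k=e^{-\lambda_pV}$ elsewhere. The Type II kernel is $k=0$ on $(S_1\cup S_2)\cap(S_3\cup S_4)$, $k=2p(V)$ off $S_1\cup S_2\cup S_3\cup S_4$, and $k=p(V)$ otherwise, where $$p(V)=\frac{V_oe^{-\lambda_pV}-Ve^{-\lambda_pV_o}+V-V_o}{\lambda_p^2(V-V_o)VV_o}.$$ **Theorem.** In both types $\mathbb E^!_{(o,0)}[N_h]$ is finite and $$\mathbb E^!_{(o,0)}[N_h]=\frac{\lambda_p^2}{\pi\lambda_b}\int_0^{\pi}\int_0^{R_t\sqrt{1-(d\sin\beta/R_t)^2}+d\cos\beta}\int_{-f(r_y)}^{f(r_y)}k\Big(r,\beta,\theta-\arccos\frac{d-r\cos\beta}{r_y}\Big)\,r\,d\theta\,dr\,d\beta,$$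 with the kernel $k$ of the type in question, $f(s)=\frac{2\lambda}{\pi N_td_0}\arccos\frac{s}{R_t}$, and $\lambda_b=\lambda_pe^{-\lambda_pV_o}$ for Type I, $\lambda_b=\frac1{V_o}(1-e^{-\lambda_pV_o})$ for Type II. (If $d\le R_t$, all the roots and arccosines are defined in the ordinary way; if $d>R_t$, the square root of a negative number and the arccosine of a number above $1$ are read as $0$.) -/

import Mathlib

open MeasureTheory ProbabilityTheory Set
open scoped ENNReal

noncomputable section

namespace GHCP

/-! The plane is identified with `ℂ` (Euclidean norm, real inner product, Lebesgue measure). -/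

/-- System parameters: link distance `d`, RTS and CTS ranges `Rt`, `Rr`, antenna spacing `d0`,
wavelength `wl`, numbers of antennas `Nt`, `Nr`, intensity `lp` of the potential transmitters. -/
structure Params where
  d : ℝ
  Rt : ℝ
  Rr : ℝ
  d0 : ℝ
  wl : ℝ
  Nt : ℕ
  Nr : ℕ
  lp : ℝ

/-! ### Antenna gains and exclusion regions -/

/-- Simplified directional gain of an array of `N` antennas at the angle `φ` off boresight. -/
def gain (d0 wl : ℝ) (N : ℕ) (φ : ℝ) : ℝ :=
  if |φ| ≤ wl / (d0 * N) then Real.cos (Real.pi * N * d0 / (2 * wl) * φ) ^ 2 else 0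

/-- Transmitter gain. -/
def gainT (p : Params) (φ : ℝ) : ℝ := gain p.d0 p.wl p.Nt φ

/-- Receiver gain. -/
def gainR (p : Params) (φ : ℝ) : ℝ := gain p.d0 p.wl p.Nr φ

/-- RTS exclusion region of the transmitter at `y` whose receiver is at `x`. -/
def regionT (p : Params) (y x : ℂ) : Set ℂ :=
  {z | ‖z - y‖ ≤ p.Rt * √(gainT p (InnerProductGeometry.angle (z - y) (x - y)))}

/-- CTS exclusion region of the receiver at `x` whose transmitter is at `y`. -/
def regionR (p : Params) (y x : ℂ) : Set ℂ :=
  {z | ‖z - x‖ ≤ p.Rr * √(gainR p (InnerProductGeometry.angle (z - x) (y - x)))}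

/-- Exclusion region of a transceiver pair. -/
def region (p : Params) (y x : ℂ) : Set ℂ := regionT p y x ∪ regionR p y x

/-- The unit vector with direction `θ`. -/
def dir (θ : ℝ) : ℂ := Complex.exp (θ * Complex.I)

/-- The receiver of the transmitter at `y` with orientation `θ`. -/
def receiver (p : Params) (y : ℂ) (θ : ℝ) : ℂ := y + p.d * dir θ

/-! ### The marked Poisson process of potential transmitters -/

variable {Ω : Type*} [MeasurableSpace Ω]

/-- The points `y 0, y 1, …` form a homogeneous Poisson point process of intensity `lp`:
counts in sets of finite area are Poisson, counts in disjoint sets are independent. -/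
structure IsPPP (μ : Measure Ω) (lp : ℝ) (y : ℕ → Ω → ℂ) : Prop where
  measurable : ∀ i, Measurable (y i)
  law : ∀ B : Set ℂ, MeasurableSet B → volume B ≠ ∞ → ∀ n : ℕ,
    μ {ω | {i | y i ω ∈ B}.encard = n} =
      ENNReal.ofReal (Real.exp (-(lp * volume.real B)) * (lp * volume.real B) ^ n / n.factorial)
  indep : ∀ (m : ℕ) (B : Fin m → Set ℂ), (∀ j, MeasurableSet (B j)) → (∀ j, volume (B j) ≠ ∞) →
    Pairwise (fun j j' => Disjoint (B j) (B j')) →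
    iIndepFun (fun j ω => {i | y i ω ∈ B j}.encard) μ

/-- The points form a homogeneous Poisson process and carry i.i.d. orientations, uniform on
`[0, 2π]` and independent of the points. -/
structure IsMarkedPPP (μ : Measure Ω) (lp : ℝ) (y : ℕ → Ω → ℂ) (θ : ℕ → Ω → ℝ) : Prop where
  ppp : IsPPP μ lp y
  measurable : ∀ i, Measurable (θ i)
  uniform : ∀ i, pdf.IsUniform (θ i) (Icc 0 (2 * Real.pi)) μ volume
  iindep : iIndepFun θ μ
  indep : IndepFun (fun ω i => y i ω) (fun ω i => θ i ω) μ

/-- The time marks `t i` are i.i.d. uniform on `[0, 1]` and independent of the points and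
their orientations. -/
structure IsTimeMarks (μ : Measure Ω) (y : ℕ → Ω → ℂ) (θ t : ℕ → Ω → ℝ) : Prop where
  measurable : ∀ i, Measurable (t i)
  uniform : ∀ i, pdf.IsUniform (t i) (Icc 0 1) μ volume
  iindep : iIndepFun t μ
  indep : IndepFun (fun ω i => (y i ω, θ i ω)) (fun ω i => t i ω) μ

/-! ### Thinning -/

/-- Indices of the pairs retained by Type I thinning: no other potential transmitter lies in the
exclusion region of the pair. -/
def activeI (p : Params) (y : ℕ → Ω → ℂ) (θ : ℕ → Ω → ℝ) (ω : Ω) : Set ℕ :=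
  {i | {j | j ≠ i ∧ y j ω ∈ region p (y i ω) (receiver p (y i ω) (θ i ω))}.encard = 0}

/-- Indices of the pairs retained by Type II thinning: no other potential transmitter with a
smaller time mark lies in the exclusion region of the pair. -/
def activeII (p : Params) (y : ℕ → Ω → ℂ) (θ t : ℕ → Ω → ℝ) (ω : Ω) : Set ℕ :=
  {i | {j | j ≠ i ∧ y j ω ∈ region p (y i ω) (receiver p (y i ω) (θ i ω)) ∧
    t j ω < t i ω}.encard = 0}

/-! ### Intensity and Palm expectation of a stationary and isotropic retained process -/

/-- The unit square. -/
def unitSquare : Set ℂ := {z | z.re ∈ Ico (0 : ℝ) 1 ∧ z.im ∈ Ico (0 : ℝ) 1}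

/-- Intensity of the process of the retained transmitters `y i`, `i ∈ A`: the expected number of
them per unit area. -/
def intensity (μ : Measure Ω) (y : ℕ → Ω → ℂ) (A : Ω → Set ℕ) : ℝ≥0∞ :=
  ∫⁻ ω, ((A ω ∩ {i | y i ω ∈ unitSquare}).encard : ℝ≥0∞) ∂μ

/-- The other retained pairs (transmitter, orientation) as they are seen from the pair `i`: the
rigid motion that moves the pair `i` to the pair with transmitter `0` and orientation `0` is
applied to all the pairs with indices in `A ω \ {i}`. -/
def seenFrom (y : ℕ → Ω → ℂ) (θ : ℕ → Ω → ℝ) (A : Ω → Set ℕ) (i : ℕ) (ω : Ω) : Set (ℂ × ℝ) :=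
  (fun j => (dir (-θ i ω) * (y j ω - y i ω), θ j ω - θ i ω)) '' (A ω \ {i})

open Classical in
/-- Reduced Palm expectation, given that the typical pair is `(0, 0)` (transmitter at the origin,
orientation `0`), of a functional `F` of the configuration of the other retained pairs:
`F` is averaged over the retained pairs with transmitter in a set of unit area, each of them
being moved to `(0, 0)`. Only functionals that depend on the orientations modulo `2π` are
meant. -/
def palmExpectation (μ : Measure Ω) (y : ℕ → Ω → ℂ) (θ : ℕ → Ω → ℝ) (A : Ω → Set ℕ)
    (F : Set (ℂ × ℝ) → ℝ≥0∞) : ℝ≥0∞ :=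
  (∫⁻ ω, ∑' i, (if i ∈ A ω ∧ y i ω ∈ unitSquare then F (seenFrom y θ A i ω) else 0) ∂μ) /
    intensity μ y A

/-- Number of hidden nodes of the typical receiver, located at `(d, 0)`: the pairs of the
configuration `c` whose RTS exclusion region contains it. -/
def hiddenNodes (p : Params) (c : Set (ℂ × ℝ)) : ℝ≥0∞ :=
  ({q ∈ c | (p.d : ℂ) ∈ regionT p q.1 (receiver p q.1 q.2)}.encard : ℝ≥0∞)

/-! ### The kernels -/

/-- Area of the exclusion region of the typical pair. -/
def areaO (p : Params) : ℝ := volume.real (region p 0 (receiver p 0 0))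

/-- Area of the union of the exclusion regions of the typical pair and of the pair
`(r, β, θ)`, whose transmitter has polar coordinates `(r, β)` and whose orientation is `θ`. -/
def areaUnion (p : Params) (r β θ : ℝ) : ℝ :=
  volume.real (region p 0 (receiver p 0 0) ∪
    region p (r * dir β) (receiver p (r * dir β) θ))

/-- The angle in `[0, π]` that equals `φ` up to sign and multiples of `2π`. -/
def foldAngle (φ : ℝ) : ℝ := Real.arccos (Real.cos φ)

/-- The origin is in the RTS exclusion region of the pair `(r, β, θ)`. -/
def S1 (p : Params) : Set (ℝ × ℝ × ℝ) :=
  {(r, β, θ) | r ^ 2 ≤ p.Rt ^ 2 * gainT p (foldAngle (θ - β - Real.pi))}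

/-- The origin is in the CTS exclusion region of the pair `(r, β, θ)`. -/
def S2 (p : Params) : Set (ℝ × ℝ × ℝ) :=
  {(r, β, θ) | r ^ 2 + 2 * r * p.d * Real.cos (β - θ) + p.d ^ 2 ≤
    p.Rr ^ 2 * gainR p (Real.arccos ((r * Real.cos (θ - β) + p.d) /
      √(r ^ 2 + 2 * r * p.d * Real.cos (β - θ) + p.d ^ 2)))}

/-- The transmitter of `(r, β, θ)` is in the RTS exclusion region of the typical pair. -/
def S3 (p : Params) : Set (ℝ × ℝ × ℝ) :=
  {(r, β, _θ) | r ^ 2 ≤ p.Rt ^ 2 * gainT p (foldAngle β)}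

/-- The transmitter of `(r, β, θ)` is in the CTS exclusion region of the typical pair. -/
def S4 (p : Params) : Set (ℝ × ℝ × ℝ) :=
  {(r, β, _θ) | r ^ 2 - 2 * r * p.d * Real.cos β + p.d ^ 2 ≤
    p.Rr ^ 2 * gainR p (Real.arccos ((p.d - r * Real.cos β) /
      √(r ^ 2 - 2 * r * p.d * Real.cos β + p.d ^ 2)))}

open Classical in
/-- Type I kernel. -/
def kernelI (p : Params) (r β θ : ℝ) : ℝ :=
  if (r, β, θ) ∈ (S1 p ∪ S2 p) ∪ (S3 p ∪ S4 p) then 0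
  else Real.exp (-(p.lp * areaUnion p r β θ))

/-- The function `V ↦ p(V)` of the Type II kernel. -/
def pFun (p : Params) (V : ℝ) : ℝ :=
  (areaO p * Real.exp (-(p.lp * V)) - V * Real.exp (-(p.lp * areaO p)) + V - areaO p) /
    (p.lp ^ 2 * (V - areaO p) * V * areaO p)

open Classical in
/-- Type II kernel. -/
def kernelII (p : Params) (r β θ : ℝ) : ℝ :=
  if (r, β, θ) ∈ (S1 p ∪ S2 p) ∩ (S3 p ∪ S4 p) then 0
  else if (r, β, θ) ∈ (S1 p)ᶜ ∩ (S2 p)ᶜ ∩ (S3 p)ᶜ ∩ (S4 p)ᶜ then 2 * pFun p (areaUnion p r β θ)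
  else pFun p (areaUnion p r β θ)

/-! ### The triple integral -/

/-- Distance of the transmitter with polar coordinates `(r, β)` from the typical receiver. -/
def distY (p : Params) (r β : ℝ) : ℝ := √(r ^ 2 + p.d ^ 2 - 2 * r * p.d * Real.cos β)

/-- Half-width of the angular window. -/
def halfWidth (p : Params) (s : ℝ) : ℝ :=
  2 * p.wl / (Real.pi * p.Nt * p.d0) * Real.arccos (s / p.Rt)

/-- The triple integral of a kernel `k` over the hidden-node domain. -/
def hiddenIntegral (p : Params) (k : ℝ → ℝ → ℝ → ℝ) : ℝ :=
  ∫ β in (0 : ℝ)..Real.pi,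
    ∫ r in (0 : ℝ)..(p.Rt * √(1 - (p.d * Real.sin β / p.Rt) ^ 2) + p.d * Real.cos β),
      ∫ θ in (-halfWidth p (distY p r β))..(halfWidth p (distY p r β)),
        k r β (θ - Real.arccos ((p.d - r * Real.cos β) / distY p r β)) * r

end GHCP

end

/-! The Palm expectation is a quotient. The denominator is `intensity`. The numerator is the
expected number of ordered couples of distinct retained pairs such that the first transmitter lies
in the unit square and the first receiver lies in the RTS region of the second pair. Both are
moments of a marked Poisson process, and the Mecke formulas `IsPoissonOn.mecke` and
`IsPoissonOn.mecke_pairs` compute them: the distinguished points are integrated against the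
intensity measure `ν`, and the remaining points contribute the void probability `exp (-ν(blocking
set))`. All relevant points lie in a bounded window, so finite `ν` suffice. `IsPPP.isPoissonOn`
extracts this description from the law of the counts, and `IsPoissonOn.marked` adds orientations and
time marks.

For Type I the blocking set of two pairs is the union of their regions. This gives `exp (-λ_p V)`
when neither transmitter is in the region of the other pair, and `0` otherwise. For Type II with
marks `s < t`, the region of the later pair must be free of marks below `t` and that of the earlier
pair free of marks below `s`. The blocking mass is `λ_p (s (V - V_o) + t V_o)`, and integration over
`s < t` gives `p(V)`. Each order of the two marks counts iff the earlier transmitter is outside the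
region of the later pair, hence the factor 0, 1 or 2. The formula for `p` degenerates at `V = V_o`,
but then the two regions agree up to a null set, and comparing first moments shows that the position
is determined by the orientation. This is a null event (`ae_unionArea_ne`).

The resulting density is invariant under rigid motions, so the first pair can be moved to `(o, 0)`
(`lintegral_move_invariant`). What remains is `λ_p² / (2π)` times an integral over the second pair.
In polar coordinates, reflection in the real axis folds this integral onto `0 < β < π` with a factor
2, which yields `λ_p² / π`. If the orientation is measured from the direction of `x_o` seen from
`y`, the condition `x_o ∈ S_t(y)` reads `r_y ≤ R_t` and `|θ| ≤ f(r_y)`. The upper radial limit is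
where the ray leaves the disc of radius `R_t` about `x_o` for the last time. -/

namespace GHCP

variable {Ω E T : Type*} [MeasurableSpace Ω] [MeasurableSpace E] [MeasurableSpace T]

/-! ### Poisson samples -/

open scoped Classical in
/-- The points of the sequence `e` that lie in `W` form a Poisson process with the finite
intensity measure `ν`: on the event that there are `n` of them, the sum over their enumerations
has the law `exp (-ν univ) ν ^ n`. -/
structure IsPoissonOn (μ : Measure Ω) (e : ℕ → Ω → E) (W : Set E) (ν : Measure E) : Prop where
  measurable : ∀ k, Measurable (e k)
  measurableSet : MeasurableSet W
  finite : ∀ᵐ ω ∂μ, {k | e k ω ∈ W}.Finite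
  lintegral : ∀ (n : ℕ) (F : (Fin n → E) → ℝ≥0∞), Measurable F →
    ∫⁻ ω, ∑' f : Fin n ↪ ℕ,
      (if range f = {k | e k ω ∈ W} then F (fun a => e (f a) ω) else 0) ∂μ =
      ENNReal.ofReal (Real.exp (-ν.real univ)) * ∫⁻ z, F z ∂Measure.pi (fun _ => ν)

instance countableFinEmbedding (n : ℕ) : Countable (Fin n ↪ ℕ) :=
  DFunLike.coe_injective.countable

-- Precomposition with permutations acts simply transitively on the embeddings with a given range.
open scoped Classical in
theorem tsum_embedding_range_eq {n : ℕ} (f₀ : Fin n ↪ ℕ) (Φ : (Fin n ↪ ℕ) → ℝ≥0∞) :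
    ∑' f : Fin n ↪ ℕ, (if range f = range f₀ then Φ f else 0) =
      ∑ σ : Equiv.Perm (Fin n), Φ (σ.toEmbedding.trans f₀) := by
  have inj : Function.Injective
      (fun σ : Equiv.Perm (Fin n) => σ.toEmbedding.trans f₀) := by
    intro σ τ h
    ext1 a
    have := DFunLike.congr_fun h a
    exact f₀.injective this
  have hr : ∀ σ : Equiv.Perm (Fin n), range (σ.toEmbedding.trans f₀) = range f₀ := by
    intro σ
    rw [Function.Embedding.coe_trans, range_comp, Equiv.coe_toEmbedding, σ.range_eq_univ,
      image_univ]
  rw [← inj.tsum_eq, tsum_fintype]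
  · exact Finset.sum_congr rfl fun σ _ => if_pos (hr σ)
  · intro f hf
    have h : range f = range f₀ := by
      by_contra h
      simp [h] at hf
    refine ⟨(Equiv.ofInjective f f.injective).trans
      ((Equiv.setCongr h).trans (Equiv.ofInjective f₀ f₀.injective).symm), ?_⟩
    ext a
    simp only [Function.Embedding.trans_apply, Equiv.coe_toEmbedding, Equiv.trans_apply]
    rw [Equiv.apply_ofInjective_symm f₀.injective]
    simp

theorem exists_embedding_range_eq {I : Set ℕ} (hI : I.Finite) :
    ∃ f : Fin I.ncard ↪ ℕ, range f = I := by
  refine ⟨(hI.toFinset.orderEmbOfFin (ncard_eq_toFinset_card I hI).symm).toEmbedding, ?_⟩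
  simp

theorem ncard_range_embedding {n : ℕ} (f : Fin n ↪ ℕ) : (range f).ncard = n := by
  rw [← image_univ, ncard_image_of_injective _ f.injective, ncard_univ, Nat.card_fin]

theorem measurableSet_range_eq {e : ℕ → Ω → E} (he : ∀ k, Measurable (e k)) {W : Set E}
    (hW : MeasurableSet W) (J : Set ℕ) : MeasurableSet {ω | J = {k | e k ω ∈ W}} := by
  have : {ω | J = {k | e k ω ∈ W}} = ⋂ k, {ω | k ∈ J ↔ e k ω ∈ W} := by
    ext ω
    simp [Set.ext_iff]
  rw [this]
  refine MeasurableSet.iInter fun k => ?_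
  by_cases hk : k ∈ J
  · simp only [hk, true_iff]
    exact he k hW
  · simp only [hk, false_iff]
    exact (he k hW).compl

/-- A functional of the unordered configuration takes the same value along each of the `n!`
enumerations, so averaging over them produces `1 / n!`. This is the series expansion of the
expectation over the number of points, from which both Mecke formulas are read off. -/
theorem IsPoissonOn.lintegral_symmetric {μ : Measure Ω} {e : ℕ → Ω → E} {W : Set E}
    {ν : Measure E} (h : IsPoissonOn μ e W ν) (S : Ω → ℝ≥0∞)
    (Φ : ∀ n, (Fin n → E) → ℝ≥0∞) (hΦ : ∀ n, Measurable (Φ n))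
    (hS : ∀ ω n (f : Fin n ↪ ℕ), range f = {k | e k ω ∈ W} → S ω = Φ n (fun a => e (f a) ω)) :
    ∫⁻ ω, S ω ∂μ = ∑' n : ℕ, (n.factorial : ℝ≥0∞)⁻¹ *
      (ENNReal.ofReal (Real.exp (-ν.real univ)) * ∫⁻ z, Φ n z ∂Measure.pi (fun _ => ν)) := by
  classical
  have key : S =ᵐ[μ] fun ω => ∑' n : ℕ, (n.factorial : ℝ≥0∞)⁻¹ * ∑' f : Fin n ↪ ℕ,
      (if range f = {k | e k ω ∈ W} then Φ n (fun a => e (f a) ω) else 0) := by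
    filter_upwards [h.finite] with ω hω
    obtain ⟨f₀, hf₀⟩ := exists_embedding_range_eq hω
    -- Enumerations exist only when `n` is the actual number of points in `W`.
    rw [tsum_eq_single ({k | e k ω ∈ W}.ncard)]
    · have h1 := tsum_embedding_range_eq f₀ fun f => Φ _ (fun a => e (f a) ω)
      rw [hf₀] at h1
      rw [h1]
      have h2 : ∀ σ : Equiv.Perm (Fin {k | e k ω ∈ W}.ncard),
          Φ _ (fun a => e ((σ.toEmbedding.trans f₀) a) ω) = S ω := by
        intro σ
        refine (hS ω _ _ ?_).symm
        refine Eq.trans ?_ hf₀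
        rw [Function.Embedding.coe_trans, range_comp, Equiv.coe_toEmbedding, σ.range_eq_univ,
          image_univ]
      rw [Finset.sum_congr rfl fun σ _ => h2 σ]
      rw [Finset.sum_const, Finset.card_univ, Fintype.card_perm, Fintype.card_fin, nsmul_eq_mul,
        ← mul_assoc, ENNReal.inv_mul_cancel, one_mul]
      · simp [Nat.factorial_ne_zero]
      · simp
    · intro m hm
      have : ∀ f : Fin m ↪ ℕ, range f ≠ {k | e k ω ∈ W} := by
        intro f hf
        apply hm
        rw [← hf, ncard_range_embedding]
      simp [this]
  have hm : ∀ n, Measurable fun ω => ∑' f : Fin n ↪ ℕ,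
      (if range f = {k | e k ω ∈ W} then Φ n (fun a => e (f a) ω) else 0) := by
    intro n
    refine Measurable.tsum fun f => ?_
    refine Measurable.ite (measurableSet_range_eq h.measurable h.measurableSet _) ?_
      measurable_const
    exact (hΦ n).comp (measurable_pi_lambda _ fun a => h.measurable _)
  rw [lintegral_congr_ae key, lintegral_tsum fun n => ((hm n).const_mul _).aemeasurable]
  refine tsum_congr fun n => ?_
  rw [lintegral_const_mul _ (hm n), h.lintegral n _ (hΦ n)]

/-! ### Marking -/

/-- Whether `f` enumerates the points in `W` depends on the positions only, and the marks read along
a fixed injective `f` are i.i.d. and independent of the positions. Hence the marks can be integrated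
out for each `f` separately, before the law of the positions is used. -/
theorem IsPoissonOn.marked {μ : Measure Ω} [IsProbabilityMeasure μ] {e : ℕ → Ω → E} {W : Set E}
    {ν : Measure E} [IsFiniteMeasure ν] (h : IsPoissonOn μ e W ν) {t : ℕ → Ω → T}
    {κ : Measure T} [IsProbabilityMeasure κ]
    (ht : ∀ k, Measurable (t k)) (hlaw : ∀ k, μ.map (t k) = κ) (hiid : iIndepFun t μ)
    (hind : IndepFun (fun ω k => e k ω) (fun ω k => t k ω) μ) :
    IsPoissonOn μ (fun k ω => (e k ω, t k ω)) (W ×ˢ univ) (ν.prod κ) := by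
  classical
  refine ⟨fun k => (h.measurable k).prodMk (ht k), h.measurableSet.prod MeasurableSet.univ, ?_, ?_⟩
  · simpa using h.finite
  intro n F hF
  have hreal : (ν.prod κ).real univ = ν.real univ := by
    simp [measureReal_def, ← univ_prod_univ, Measure.prod_prod]
  rw [hreal]
  have he : Measurable fun ω k => e k ω := measurable_pi_lambda _ h.measurable
  set G : (Fin n → E) → ℝ≥0∞ := fun z => ∫⁻ τ, F (fun a => (z a, τ a)) ∂Measure.pi (fun _ => κ)
    with hG
  have hFm : Measurable fun q : (Fin n → E) × (Fin n → T) => F (fun a => (q.1 a, q.2 a)) := by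
    apply hF.comp
    fun_prop
  have hGm : Measurable G := hFm.lintegral_prod_right'
  have step : ∀ f : Fin n ↪ ℕ,
      ∫⁻ ω, (if range f = {k | e k ω ∈ W} then F (fun a => (e (f a) ω, t (f a) ω)) else 0) ∂μ =
      ∫⁻ ω, (if range f = {k | e k ω ∈ W} then G (fun a => e (f a) ω) else 0) ∂μ := by
    intro f
    have hcoord : Measurable fun (τ : ℕ → T) (a : Fin n) => τ (f a) := by fun_prop
    have hind' : IndepFun (fun ω k => e k ω) (fun ω (a : Fin n) => t (f a) ω) μ :=
      hind.comp measurable_id hcoord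
    have htf : Measurable fun ω (a : Fin n) => t (f a) ω :=
      measurable_pi_lambda _ fun a => ht _
    have hpi : μ.map (fun ω (a : Fin n) => t (f a) ω) = Measure.pi (fun _ => κ) := by
      rw [(iIndepFun_iff_map_fun_eq_pi_map fun a => (ht (f a)).aemeasurable).1
        (hiid.precomp f.injective)]
      simp [hlaw]
    have hmap := (indepFun_iff_map_prod_eq_prod_map_map he.aemeasurable htf.aemeasurable).1 hind'
    rw [hpi] at hmap
    have hset : MeasurableSet {u : ℕ → E | range f = {k | u k ∈ W}} :=
      measurableSet_range_eq (e := fun k (u : ℕ → E) => u k) (fun k => measurable_pi_apply k)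
        h.measurableSet _
    let K : (ℕ → E) × (Fin n → T) → ℝ≥0∞ := fun q =>
      if range f = {k | q.1 k ∈ W} then F (fun a => (q.1 (f a), q.2 a)) else 0
    have hK : Measurable K := by
      refine Measurable.ite (measurable_fst hset) ?_ measurable_const
      apply hF.comp
      fun_prop
    calc _ = ∫⁻ ω, K ((fun k => e k ω), fun a => t (f a) ω) ∂μ := rfl
      _ = ∫⁻ q, K q ∂(μ.map (fun ω => ((fun k => e k ω), fun a : Fin n => t (f a) ω))) := by
        rw [lintegral_map hK (he.prodMk htf)]
      _ = ∫⁻ u, ∫⁻ τ, K (u, τ) ∂Measure.pi (fun _ => κ) ∂(μ.map (fun ω k => e k ω)) := by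
        rw [hmap, lintegral_prod _ hK.aemeasurable]
      _ = ∫⁻ ω, ∫⁻ τ, K ((fun k => e k ω), τ) ∂Measure.pi (fun _ => κ) ∂μ := by
        rw [lintegral_map hK.lintegral_prod_right' he]
      _ = _ := by
        refine lintegral_congr fun ω => ?_
        simp only [K]
        split_ifs <;> simp [hG]
  have hm1 : ∀ f : Fin n ↪ ℕ, Measurable fun ω =>
      (if range f = {k | e k ω ∈ W} then F (fun a => (e (f a) ω, t (f a) ω)) else 0) := by
    intro f
    refine Measurable.ite (measurableSet_range_eq h.measurable h.measurableSet _) ?_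
      measurable_const
    exact hF.comp (measurable_pi_lambda _ fun a => (h.measurable _).prodMk (ht _))
  have hm2 : ∀ f : Fin n ↪ ℕ, Measurable fun ω =>
      (if range f = {k | e k ω ∈ W} then G (fun a => e (f a) ω) else 0) := by
    intro f
    refine Measurable.ite (measurableSet_range_eq h.measurable h.measurableSet _) ?_
      measurable_const
    exact hGm.comp (measurable_pi_lambda _ fun a => h.measurable _)
  have hL := h.lintegral n G hGm
  rw [lintegral_tsum fun f => (hm2 f).aemeasurable] at hL
  simp only [mem_prod, mem_univ, and_true]
  rw [lintegral_tsum fun f => (hm1 f).aemeasurable, tsum_congr step, hL]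
  congr 1
  have hmp := measurePreserving_arrowProdEquivProdArrow E T (Fin n) (fun _ => ν) (fun _ => κ)
  rw [hG, ← lintegral_prod _ hFm.aemeasurable, ← hmp.lintegral_comp hFm]
  rfl

/-! ### Mecke formulas -/

/-- A power of `ν` is exchangeable, so every choice of the distinguished coordinate contributes the
same integral. -/
theorem lintegral_pi_sum_removeNth {ν : Measure E} [IsFiniteMeasure ν] {n : ℕ}
    {G : E → (Fin n → E) → ℝ≥0∞} (hG : Measurable (Function.uncurry G)) :
    ∫⁻ z, ∑ a : Fin (n + 1), G (z a) (fun j => z (a.succAbove j)) ∂Measure.pi (fun _ => ν) =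
      (n + 1) * ∫⁻ x, ∫⁻ z, G x z ∂Measure.pi (fun _ => ν) ∂ν := by
  rw [lintegral_finsetSum]
  · have : ∀ a : Fin (n + 1), ∫⁻ z, G (z a) (fun j => z (a.succAbove j)) ∂Measure.pi (fun _ => ν) =
        ∫⁻ x, ∫⁻ z, G x z ∂Measure.pi (fun _ => ν) ∂ν := by
      intro a
      have hmp := measurePreserving_piFinSuccAbove (fun _ : Fin (n + 1) => ν) a
      have := hmp.lintegral_comp hG
      rw [lintegral_prod _ hG.aemeasurable] at this
      exact this
    simp [this]
  · intro a _
    have : Measurable fun z : Fin (n + 1) → E => (z a, fun j => z (a.succAbove j)) := by fun_prop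
    exact hG.comp this

theorem inv_factorial_succ_mul (n : ℕ) :
    ((n + 1).factorial : ℝ≥0∞)⁻¹ * (n + 1) = (n.factorial : ℝ≥0∞)⁻¹ := by
  have h : ((n + 1 : ℕ) : ℝ≥0∞)⁻¹ * (n + 1) = 1 := by
    rw [Nat.cast_add, Nat.cast_one]
    exact ENNReal.inv_mul_cancel (by simp) (by finiteness)
  rw [Nat.factorial_succ, Nat.cast_mul, ENNReal.mul_inv (Or.inr (by simp)) (Or.inl (by simp)),
    mul_right_comm, h, one_mul]

/-- The exponential series in `ν Bᶜ` cancels all of `exp (-ν univ)` except the void probability of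
`B`. -/
theorem tsum_exp_measure_compl {ν : Measure E} [IsFiniteMeasure ν] {B : Set E}
    (hB : MeasurableSet B) :
    ∑' n : ℕ, (n.factorial : ℝ≥0∞)⁻¹ * (ENNReal.ofReal (Real.exp (-ν.real univ)) * ν Bᶜ ^ n) =
      ENNReal.ofReal (Real.exp (-ν.real B)) := by
  have h1 : ∀ n : ℕ, (n.factorial : ℝ≥0∞)⁻¹ *
      (ENNReal.ofReal (Real.exp (-ν.real univ)) * ν Bᶜ ^ n) =
      ENNReal.ofReal (Real.exp (-ν.real univ) * (ν.real Bᶜ ^ n / n.factorial)) := by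
    intro n
    rw [← ofReal_measureReal, ← ENNReal.ofReal_pow measureReal_nonneg,
      ← ENNReal.ofReal_natCast, ← ENNReal.ofReal_inv_of_pos (by positivity),
      ← ENNReal.ofReal_mul (by positivity), ← ENNReal.ofReal_mul (by positivity)]
    congr 1
    field_simp
  have hs : HasSum (fun n : ℕ => ν.real Bᶜ ^ n / n.factorial) (Real.exp (ν.real Bᶜ)) := by
    rw [Real.exp_eq_exp_ℝ]
    exact NormedSpace.expSeries_div_hasSum_exp (ν.real Bᶜ)
  rw [tsum_congr h1, ← ENNReal.ofReal_tsum_of_nonneg (fun n => by positivity)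
    (hs.summable.mul_left _), tsum_mul_left, hs.tsum_eq, ← Real.exp_add, measureReal_compl hB]
  congr 2
  ring

theorem tsum_eq_sum_of_range_eq {n : ℕ} (f : Fin n ↪ ℕ) {I : Set ℕ} (hf : range f = I)
    (g : ℕ → ℝ≥0∞) (hg : ∀ i, i ∉ I → g i = 0) : ∑' i, g i = ∑ a, g (f a) := by
  rw [← f.injective.tsum_eq, tsum_fintype]
  intro i hi
  rw [hf]
  by_contra h
  exact hi (hg i h)

-- Mecke formula for the points that see no other point in their section of `B`. In a configuration
-- of `n + 1` points the choice of the distinguished one cancels a factor `n + 1` of the factorial,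
-- the other `n` points each contribute the mass of the complement of the section, and the series
-- sums to a void probability.
open scoped Classical in
theorem IsPoissonOn.mecke {μ : Measure Ω} {e : ℕ → Ω → E} {W : Set E}
    {ν : Measure E} [IsFiniteMeasure ν] (h : IsPoissonOn μ e W ν) {B : Set (E × E)}
    (hB : MeasurableSet B) {g : E → ℝ≥0∞} (hg : Measurable g) :
    ∫⁻ ω, ∑' i, (if e i ω ∈ W ∧ ∀ k, k ≠ i → e k ω ∈ W → (e i ω, e k ω) ∉ B
        then g (e i ω) else 0) ∂μ =
      ∫⁻ x, g x * ENNReal.ofReal (Real.exp (-ν.real {z | (x, z) ∈ B})) ∂ν := by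
  let G : ∀ n, E → (Fin n → E) → ℝ≥0∞ := fun n x z => if ∀ j, (x, z j) ∉ B then g x else 0
  have hGm : ∀ n, Measurable (Function.uncurry (G n)) := by
    intro n
    refine Measurable.ite ?_ (hg.comp measurable_fst) measurable_const
    rw [ofPred_forall]
    refine MeasurableSet.iInter fun j => ?_
    have : Measurable fun q : E × (Fin n → E) => (q.1, q.2 j) := by fun_prop
    exact (this hB).compl
  -- The empty configuration has no point to distinguish, so the series effectively starts at `n =
  -- 1` and is shifted by one.
  let Φ : ∀ n, (Fin n → E) → ℝ≥0∞ := fun n => match n with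
    | 0 => fun _ => 0
    | n + 1 => fun z => ∑ a : Fin (n + 1), G n (z a) (fun j => z (a.succAbove j))
  have hΦ : ∀ n, Measurable (Φ n) := by
    rintro (_ | n)
    · exact measurable_const
    · refine Finset.measurable_sum _ fun a _ => ?_
      have : Measurable fun z : Fin (n + 1) → E => (z a, fun j => z (a.succAbove j)) := by fun_prop
      exact (hGm n).comp this
  rw [h.lintegral_symmetric _ Φ hΦ]
  · rw [tsum_eq_zero_add' ENNReal.summable]
    simp only [Φ, lintegral_zero, mul_zero, zero_add]
    have h1 : ∀ n : ℕ, ((n + 1).factorial : ℝ≥0∞)⁻¹ *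
        (ENNReal.ofReal (Real.exp (-ν.real univ)) *
          ∫⁻ z, ∑ a : Fin (n + 1), G n (z a) (fun j => z (a.succAbove j))
            ∂Measure.pi (fun _ => ν)) =
        ∫⁻ x, g x * ((n.factorial : ℝ≥0∞)⁻¹ * (ENNReal.ofReal (Real.exp (-ν.real univ)) *
          ν {z | (x, z) ∈ B}ᶜ ^ n)) ∂ν := by
      intro n
      rw [lintegral_pi_sum_removeNth (hGm n)]
      have h2 : ∀ x, ∫⁻ z, G n x z ∂Measure.pi (fun _ => ν) = g x * ν {z | (x, z) ∈ B}ᶜ ^ n := by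
        intro x
        have : ∀ z : Fin n → E, G n x z =
            (univ.pi fun _ => {z | (x, z) ∈ B}ᶜ).indicator (fun _ => g x) z := by
          intro z
          simp [G, indicator_apply, mem_pi]
        have hms : MeasurableSet {z | (x, z) ∈ B}ᶜ := (measurable_prodMk_left hB).compl
        rw [lintegral_congr this, lintegral_indicator (MeasurableSet.univ_pi fun _ => hms),
          setLIntegral_const, Measure.pi_pi]
        simp
      have hmn : Measurable fun x => g x * ν {z | (x, z) ∈ B}ᶜ ^ n :=
        hg.mul ((measurable_measure_prodMk_left hB.compl).pow_const n)
      simp_rw [h2]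
      have h3 : ∀ x, g x * ((n.factorial : ℝ≥0∞)⁻¹ *
          (ENNReal.ofReal (Real.exp (-ν.real univ)) * ν {z | (x, z) ∈ B}ᶜ ^ n)) =
          ((n.factorial : ℝ≥0∞)⁻¹ * ENNReal.ofReal (Real.exp (-ν.real univ))) *
            (g x * ν {z | (x, z) ∈ B}ᶜ ^ n) := fun x => by ring
      simp_rw [h3]
      rw [lintegral_const_mul _ hmn, ← inv_factorial_succ_mul n]
      ring
    rw [tsum_congr h1, ← lintegral_tsum]
    · refine lintegral_congr fun x => ?_
      rw [ENNReal.tsum_mul_left]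
      congr 1
      exact tsum_exp_measure_compl (measurable_prodMk_left hB)
    · intro n
      exact (hg.mul ((((measurable_measure_prodMk_left hB.compl).pow_const n).const_mul _).const_mul
        _)).aemeasurable
  · intro ω n f hf
    rw [tsum_eq_sum_of_range_eq f hf _ fun i hi => if_neg fun h => hi h.1]
    have hfW : ∀ a, e (f a) ω ∈ W := fun a => by
      have : f a ∈ {k | e k ω ∈ W} := hf ▸ mem_range_self a
      exact this
    rcases n with _ | n
    · simp [Φ]
    · refine Finset.sum_congr rfl fun a _ => ?_
      simp only [G, hfW, true_and]
      congr 1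
      refine propext ⟨fun H j => H _ (fun h => (Fin.succAbove_ne a j) (f.injective h)) (hfW _), ?_⟩
      intro H k hk hkW
      have : k ∈ range f := hf ▸ hkW
      obtain ⟨b, rfl⟩ := this
      obtain ⟨j, rfl⟩ := Fin.exists_succAbove_eq (fun h : b = a => hk (by rw [h]))
      exact H j

-- The two-point version: removing the distinguished points one after the other cancels `(n + 2) (n
-- + 1)`. The set `B` constrains third points only; any condition between the two distinguished
-- points has to be encoded in `g`.
open scoped Classical in
theorem IsPoissonOn.mecke_pairs {μ : Measure Ω} {e : ℕ → Ω → E} {W : Set E}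
    {ν : Measure E} [IsFiniteMeasure ν] (h : IsPoissonOn μ e W ν) {B : Set (E × E × E)}
    (hB : MeasurableSet B) {g : E → E → ℝ≥0∞} (hg : Measurable (Function.uncurry g)) :
    ∫⁻ ω, ∑' i, ∑' j, (if i ≠ j ∧ e i ω ∈ W ∧ e j ω ∈ W ∧
        ∀ k, k ≠ i → k ≠ j → e k ω ∈ W → (e i ω, e j ω, e k ω) ∉ B
        then g (e i ω) (e j ω) else 0) ∂μ =
      ∫⁻ x, ∫⁻ x', g x x' * ENNReal.ofReal (Real.exp (-ν.real {z | (x, x', z) ∈ B})) ∂ν ∂ν := by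
  let H : ∀ n, E → E → (Fin n → E) → ℝ≥0∞ := fun n x x' z =>
    if ∀ j, (x, x', z j) ∉ B then g x x' else 0
  have hHm : ∀ n, Measurable fun q : E × E × (Fin n → E) => H n q.1 q.2.1 q.2.2 := by
    intro n
    refine Measurable.ite ?_ (hg.comp (measurable_fst.prodMk measurable_snd.fst)) measurable_const
    rw [ofPred_forall]
    refine MeasurableSet.iInter fun j => ?_
    have : Measurable fun q : E × E × (Fin n → E) => (q.1, q.2.1, q.2.2 j) := by fun_prop
    exact (this hB).compl
  let G : ∀ n, E → (Fin (n + 1) → E) → ℝ≥0∞ := fun n x z =>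
    ∑ b : Fin (n + 1), H n x (z b) (fun j => z (b.succAbove j))
  have hGm : ∀ n, Measurable (Function.uncurry (G n)) := by
    intro n
    refine Finset.measurable_sum _ fun b _ => ?_
    have : Measurable fun q : E × (Fin (n + 1) → E) =>
      (q.1, q.2 b, fun j => q.2 (b.succAbove j)) := by fun_prop
    exact (hHm n).comp this
  let Φ : ∀ n, (Fin n → E) → ℝ≥0∞ := fun n => match n with
    | 0 => fun _ => 0
    | 1 => fun _ => 0
    | n + 2 => fun z => ∑ a : Fin (n + 2), G n (z a) (fun j => z (a.succAbove j))
  have hΦ : ∀ n, Measurable (Φ n) := by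
    rintro (_ | _ | n)
    · exact measurable_const
    · exact measurable_const
    · refine Finset.measurable_sum _ fun a _ => ?_
      have : Measurable fun z : Fin (n + 2) → E => (z a, fun j => z (a.succAbove j)) := by fun_prop
      exact (hGm n).comp this
  rw [h.lintegral_symmetric _ Φ hΦ]
  · rw [tsum_eq_zero_add' ENNReal.summable, tsum_eq_zero_add' ENNReal.summable]
    simp only [Φ, zero_add, lintegral_zero, mul_zero]
    have hw : ∀ n : ℕ, Measurable fun q : E × E =>
        g q.1 q.2 * ((n.factorial : ℝ≥0∞)⁻¹ * (ENNReal.ofReal (Real.exp (-ν.real univ)) *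
          ν {z | (q.1, q.2, z) ∈ B}ᶜ ^ n)) := by
      intro n
      have h0 : MeasurableSet {q : (E × E) × E | (q.1.1, q.1.2, q.2) ∉ B} := by
        have : Measurable fun q : (E × E) × E => (q.1.1, q.1.2, q.2) := by fun_prop
        exact (this hB).compl
      have h1 : Measurable fun q : E × E => ν {z | (q.1, q.2, z) ∈ B}ᶜ :=
        measurable_measure_prodMk_left h0
      exact hg.mul (((h1.pow_const n).const_mul _).const_mul _)
    have h1 : ∀ n : ℕ, ((n + 1 + 1).factorial : ℝ≥0∞)⁻¹ *
        (ENNReal.ofReal (Real.exp (-ν.real univ)) *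
          ∫⁻ z, ∑ a : Fin (n + 2), G n (z a) (fun j => z (a.succAbove j))
            ∂Measure.pi (fun _ => ν)) =
        ∫⁻ x, ∫⁻ x', g x x' * ((n.factorial : ℝ≥0∞)⁻¹ *
          (ENNReal.ofReal (Real.exp (-ν.real univ)) * ν {z | (x, x', z) ∈ B}ᶜ ^ n)) ∂ν ∂ν := by
      intro n
      rw [lintegral_pi_sum_removeNth (hGm n)]
      have h2 : ∀ x x', ∫⁻ z, H n x x' z ∂Measure.pi (fun _ => ν) =
          g x x' * ν {z | (x, x', z) ∈ B}ᶜ ^ n := by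
        intro x x'
        have : ∀ z : Fin n → E, H n x x' z =
            (univ.pi fun _ => {z | (x, x', z) ∈ B}ᶜ).indicator (fun _ => g x x') z := by
          intro z
          simp [H, indicator_apply, mem_pi]
        have hms : MeasurableSet {z | (x, x', z) ∈ B}ᶜ :=
          (measurable_prodMk_left (measurable_prodMk_left hB)).compl
        rw [lintegral_congr this, lintegral_indicator (MeasurableSet.univ_pi fun _ => hms),
          setLIntegral_const, Measure.pi_pi]
        simp
      have h3 : ∀ x, ∫⁻ z, G n x z ∂Measure.pi (fun _ => ν) =
          (n + 1) * ∫⁻ x', g x x' * ν {z | (x, x', z) ∈ B}ᶜ ^ n ∂ν := by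
        intro x
        have hx : Measurable (Function.uncurry (H n x)) :=
          (hHm n).comp (measurable_const.prodMk measurable_id)
        rw [lintegral_pi_sum_removeNth hx]
        simp_rw [h2]
      simp_rw [h3]
      have h0 : MeasurableSet {q : (E × E) × E | (q.1.1, q.1.2, q.2) ∉ B} := by
        have : Measurable fun q : (E × E) × E => (q.1.1, q.1.2, q.2) := by fun_prop
        exact (this hB).compl
      have hv : Measurable fun q : E × E => g q.1 q.2 * ν {z | (q.1, q.2, z) ∈ B}ᶜ ^ n :=
        hg.mul ((measurable_measure_prodMk_left h0 : Measurable fun q : E × E =>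
          ν {z | (q.1, q.2, z) ∈ B}ᶜ).pow_const n)
      have h5 : ∀ x x', g x x' * ((n.factorial : ℝ≥0∞)⁻¹ *
          (ENNReal.ofReal (Real.exp (-ν.real univ)) * ν {z | (x, x', z) ∈ B}ᶜ ^ n)) =
          ((n.factorial : ℝ≥0∞)⁻¹ * ENNReal.ofReal (Real.exp (-ν.real univ))) *
            (g x x' * ν {z | (x, x', z) ∈ B}ᶜ ^ n) := fun x x' => by ring
      simp_rw [h5]
      have hv1 : ∀ x, Measurable fun x' => g x x' * ν {z | (x, x', z) ∈ B}ᶜ ^ n :=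
        fun x => hv.comp measurable_prodMk_left
      have hv2 : Measurable fun x => ∫⁻ x', g x x' * ν {z | (x, x', z) ∈ B}ᶜ ^ n ∂ν :=
        hv.lintegral_prod_right'
      rw [lintegral_congr fun x => lintegral_const_mul ((n.factorial : ℝ≥0∞)⁻¹ *
        ENNReal.ofReal (Real.exp (-ν.real univ))) (hv1 x)]
      rw [lintegral_const_mul _ hv2, lintegral_const_mul _ hv2, ← inv_factorial_succ_mul n,
        ← inv_factorial_succ_mul (n + 1)]
      push_cast
      ring
    rw [tsum_congr h1, ← lintegral_tsum]
    · refine lintegral_congr fun x => ?_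
      rw [← lintegral_tsum]
      · refine lintegral_congr fun x' => ?_
        rw [ENNReal.tsum_mul_left]
        congr 1
        exact tsum_exp_measure_compl (measurable_prodMk_left (measurable_prodMk_left hB))
      · exact fun n => ((hw n).comp measurable_prodMk_left).aemeasurable
    · exact fun n => (hw n).lintegral_prod_right'.aemeasurable
  · intro ω n f hf
    have hfW : ∀ a, e (f a) ω ∈ W := fun a => by
      have : f a ∈ {k | e k ω ∈ W} := hf ▸ mem_range_self a
      exact this
    rw [tsum_eq_sum_of_range_eq f hf]
    swap
    · intro i hi
      exact ENNReal.tsum_eq_zero.2 fun j => if_neg fun h => hi h.2.1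
    rw [Finset.sum_congr rfl fun a _ => tsum_eq_sum_of_range_eq f hf _
      fun j hj => if_neg fun h => hj h.2.2.1]
    rcases n with _ | _ | n
    · simp [Φ]
    · simp [Φ]
    · refine Finset.sum_congr rfl fun a _ => ?_
      rw [Fin.sum_univ_succAbove _ a, if_neg (by simp), zero_add]
      refine Finset.sum_congr rfl fun b _ => ?_
      have hne : f a ≠ f (a.succAbove b) := fun h => (Fin.succAbove_ne a b) (f.injective h).symm
      simp only [H, hfW, true_and, hne, ne_eq, not_false_eq_true]
      congr 1
      refine propext ⟨fun H j => H _ (fun h => (Fin.succAbove_ne _ _) (f.injective h))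
        (fun h => (Fin.succAbove_ne _ _) (Fin.succAbove_right_injective (f.injective h))) (hfW _),
        ?_⟩
      intro H k hk hk' hkW
      have : k ∈ range f := hf ▸ hkW
      obtain ⟨c, rfl⟩ := this
      obtain ⟨c, rfl⟩ := Fin.exists_succAbove_eq (fun h : c = a => hk (by rw [h]))
      obtain ⟨j, rfl⟩ := Fin.exists_succAbove_eq (fun h : c = b => hk' (by rw [h]))
      exact H j

end GHCP

namespace GHCP

variable {Ω : Type*} [MeasurableSpace Ω]

/-! ### Homogeneous Poisson processes are Poisson samples -/

open scoped Classical in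
theorem tsum_encard (S : Set ℕ) : ∑' k, (if k ∈ S then (1 : ℝ≥0∞) else 0) = (S.encard : ℝ≥0∞) := by
  rw [← ENNReal.tsum_set_one, ← tsum_subtype_eq_of_support_subset (s := S)]
  · exact tsum_congr fun k => if_pos k.2
  · intro k hk
    by_contra h
    simp [h] at hk

theorem measurable_encard {I : Ω → Set ℕ} (hI : ∀ k, MeasurableSet {ω | k ∈ I ω}) :
    Measurable fun ω => ((I ω).encard : ℝ≥0∞) := by
  classical
  simp_rw [← tsum_encard]
  exact Measurable.tsum fun k => Measurable.ite (hI k) measurable_const measurable_const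

theorem measurableSet_encard_eq {I : Ω → Set ℕ} (hI : ∀ k, MeasurableSet {ω | k ∈ I ω}) (n : ℕ) :
    MeasurableSet {ω | (I ω).encard = n} := by
  have : {ω | (I ω).encard = n} = {ω | ((I ω).encard : ℝ≥0∞) = n} := by
    ext ω
    rw [mem_ofPred_eq, mem_ofPred_eq, ← ENat.toENNReal_coe, ENat.toENNReal_inj]
  rw [this]
  exact measurable_encard hI (measurableSet_singleton _)

/-- Bijections from the fibres of `g` onto the sets `I τ` are glued; disjointness of the `I τ` makes
the result injective. -/
theorem exists_embedding_of_encard_eq {n : ℕ} {T : Type*} {I : T → Set ℕ}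
    (hI : Pairwise fun τ τ' => Disjoint (I τ) (I τ')) (g : Fin n → T)
    (h : ∀ τ, (I τ).encard = {a | g a = τ}.ncard) :
    ∃ f : Fin n ↪ ℕ, range f = (⋃ τ, I τ) ∧ ∀ a, f a ∈ I (g a) := by
  have h1 : ∀ τ, ∃ φ : {a | g a = τ} → ℕ, Function.Injective φ ∧ range φ = I τ := by
    intro τ
    have hfin : (I τ).Finite := finite_of_encard_eq_coe (h τ)
    obtain ⟨f, hf⟩ := exists_embedding_range_eq hfin
    have hc : (I τ).ncard = {a | g a = τ}.ncard := by
      rw [ncard_def, h τ, ENat.toNat_natCast]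
    have e : {a | g a = τ} ≃ Fin (I τ).ncard := by
      rw [hc]
      exact Finite.equivFin _
    refine ⟨f ∘ e, f.injective.comp e.injective, ?_⟩
    rw [range_comp, e.range_eq_univ, image_univ, hf]
  choose φ hφ hφr using h1
  have hmem : ∀ a, φ (g a) ⟨a, rfl⟩ ∈ I (g a) := fun a => hφr (g a) ▸ mem_range_self _
  refine ⟨⟨fun a => φ (g a) ⟨a, rfl⟩, ?_⟩, ?_, hmem⟩
  · intro a b hab
    have hab' : φ (g a) ⟨a, rfl⟩ = φ (g b) ⟨b, rfl⟩ := hab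
    have hg : g a = g b := by
      by_contra hne
      exact disjoint_left.1 (hI hne) (hmem a) (hab' ▸ hmem b)
    have key : ∀ τ (ha : g a = τ) (hb : g b = τ), φ τ ⟨a, ha⟩ = φ τ ⟨b, hb⟩ → a = b := by
      intro τ ha hb hh
      simpa using hφ τ hh
    refine key (g b) hg rfl ?_
    have hgen : ∀ τ (hτ : g a = τ), φ τ ⟨a, hτ⟩ = φ (g a) ⟨a, rfl⟩ := by
      rintro _ rfl
      rfl
    rw [hgen, hab']
  · ext k
    simp only [mem_range, mem_iUnion]
    constructor
    · rintro ⟨a, rfl⟩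
      exact ⟨_, hmem a⟩
    · rintro ⟨τ, hk⟩
      rw [← hφr τ] at hk
      obtain ⟨⟨a, ha⟩, rfl⟩ := hk
      have ha' : g a = τ := ha
      subst ha'
      exact ⟨a, rfl⟩

-- Once one enumeration follows the word `g` of cells, the others differ from it by a permutation
-- that fixes `g`. The stabilizer of `g` is the product of the symmetric groups of its fibres,
-- whence the product of factorials.
open scoped Classical in
theorem tsum_embedding_cells {n : ℕ} {T : Type*} [Fintype T] {I : T → Set ℕ}
    (hI : Pairwise fun τ τ' => Disjoint (I τ) (I τ')) (g : Fin n → T) :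
    ∑' f : Fin n ↪ ℕ,
      (if range f = (⋃ τ, I τ) then (if ∀ a, f a ∈ I (g a) then (1 : ℝ≥0∞) else 0) else 0) =
      if ∀ τ, (I τ).encard = ({a | g a = τ}.ncard : ℕ) then
        ∏ τ, ({a | g a = τ}.ncard.factorial : ℝ≥0∞) else 0 := by
  by_cases hex : ∃ f : Fin n ↪ ℕ, range f = (⋃ τ, I τ) ∧ ∀ a, f a ∈ I (g a)
  · obtain ⟨f₀, hf₀, hf₀I⟩ := hex
    have hunique : ∀ {a τ}, f₀ a ∈ I τ → g a = τ := by
      intro a τ h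
      by_contra hne
      exact disjoint_left.1 (hI hne) (hf₀I a) h
    have himg : ∀ τ, I τ = f₀ '' {a | g a = τ} := by
      intro τ
      ext k
      constructor
      · intro hk
        have : k ∈ range f₀ := hf₀ ▸ mem_iUnion_of_mem τ hk
        obtain ⟨a, rfl⟩ := this
        exact ⟨a, hunique hk, rfl⟩
      · rintro ⟨a, rfl, rfl⟩
        exact hf₀I a
    rw [if_pos, ← hf₀, tsum_embedding_range_eq f₀ fun f => if ∀ a, f a ∈ I (g a) then 1 else 0]
    · have h1 : ∀ σ : Equiv.Perm (Fin n),
          (∀ a, (σ.toEmbedding.trans f₀) a ∈ I (g a)) ↔ g ∘ σ = g := by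
        intro σ
        rw [funext_iff]
        refine forall_congr' fun a => ⟨fun h => hunique h, fun h => ?_⟩
        have h2 : g (σ a) = g a := h
        rw [← h2]
        exact hf₀I _
      simp_rw [h1]
      rw [Finset.sum_boole, ← Fintype.card_subtype, DomMulAct.stabilizer_card, Nat.cast_prod]
      refine Finset.prod_congr rfl fun τ _ => ?_
      rw [← Nat.card_coe_set_eq, ← Nat.card_eq_fintype_card]
      rfl
    · intro τ
      rw [himg τ, f₀.injective.encard_image, (toFinite _).cast_ncard_eq]
  · rw [if_neg fun h => hex (exists_embedding_of_encard_eq hI g h), ENNReal.tsum_eq_zero]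
    intro f
    by_cases h1 : range f = ⋃ τ, I τ
    · rw [if_pos h1, if_neg fun h2 => hex ⟨f, h1, h2⟩]
    · rw [if_neg h1]

variable {μ : Measure Ω} {lp : ℝ} {y : ℕ → Ω → ℂ}

/-- Joint law of the counts in the cells of a finite partition. -/
theorem IsPPP.counts_law (h : IsPPP μ lp y) {T : Type*} [Fintype T] {D : T → Set ℂ}
    (hD : ∀ τ, MeasurableSet (D τ)) (hDf : ∀ τ, volume (D τ) ≠ ∞)
    (hdisj : Pairwise fun τ τ' => Disjoint (D τ) (D τ')) (c : T → ℕ) :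
    μ {ω | ∀ τ, {k | y k ω ∈ D τ}.encard = c τ} =
      ∏ τ, ENNReal.ofReal (Real.exp (-(lp * volume.real (D τ))) *
        (lp * volume.real (D τ)) ^ c τ / (c τ).factorial) := by
  have e := Fintype.equivFin T
  have hi := h.indep (Fintype.card T) (fun j => D (e.symm j)) (fun j => hD _) (fun j => hDf _)
    (fun j j' hjj => hdisj fun h => hjj (e.symm.injective h))
  have hi' : iIndepFun (fun τ ω => {k | y k ω ∈ D τ}.encard) μ := by
    have := hi.precomp e.injective
    simpa using this
  have hset : {ω | ∀ τ, {k | y k ω ∈ D τ}.encard = c τ} =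
      ⋂ τ, {ω | {k | y k ω ∈ D τ}.encard = c τ} := by
    ext ω
    simp
  rw [hset, hi'.meas_iInter (s := fun τ => {ω | {k | y k ω ∈ D τ}.encard = c τ})
    fun τ => ⟨{(c τ : ℕ∞)}, trivial, rfl⟩]
  exact Finset.prod_congr rfl fun τ _ => h.law _ (hD τ) (hDf τ) _

variable [IsProbabilityMeasure μ]

/-- The Poisson probabilities of the finite counts already sum to 1, which leaves no mass for an
infinite count. -/
theorem IsPPP.ae_finite (h : IsPPP μ lp y) (hlp : 0 ≤ lp) {W : Set ℂ} (hW : MeasurableSet W)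
    (hWf : volume W ≠ ∞) : ∀ᵐ ω ∂μ, {k | y k ω ∈ W}.Finite := by
  have hm : ∀ n : ℕ, MeasurableSet {ω | {k | y k ω ∈ W}.encard = n} :=
    measurableSet_encard_eq fun k => h.measurable k hW
  have hU : {ω | {k | y k ω ∈ W}.Finite} = ⋃ n : ℕ, {ω | {k | y k ω ∈ W}.encard = n} := by
    ext ω
    simp only [mem_ofPred_eq, mem_iUnion]
    exact ⟨fun hf => ⟨_, hf.cast_ncard_eq.symm⟩, fun ⟨n, hn⟩ => finite_of_encard_eq_coe hn⟩
  have hmU : MeasurableSet {ω | {k | y k ω ∈ W}.Finite} := by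
    rw [hU]
    exact MeasurableSet.iUnion hm
  have hs : HasSum (fun n : ℕ => Real.exp (-(lp * volume.real W)) *
      ((lp * volume.real W) ^ n / n.factorial)) 1 := by
    have := (NormedSpace.expSeries_div_hasSum_exp (lp * volume.real W)).mul_left
      (Real.exp (-(lp * volume.real W)))
    rwa [← Real.exp_eq_exp_ℝ, ← Real.exp_add, neg_add_cancel, Real.exp_zero] at this
  have hnn : 0 ≤ lp * volume.real W := mul_nonneg hlp measureReal_nonneg
  rw [ae_iff]
  have : {ω | ¬{k | y k ω ∈ W}.Finite} = {ω | {k | y k ω ∈ W}.Finite}ᶜ := rfl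
  rw [this, prob_compl_eq_zero_iff hmU, hU, measure_iUnion _ hm]
  · rw [tsum_congr fun n => h.law W hW hWf n]
    simp_rw [mul_div_assoc]
    rw [← ENNReal.ofReal_tsum_of_nonneg (fun n => by positivity) hs.summable, hs.tsum_eq,
      ENNReal.ofReal_one]
  · intro m n hmn
    refine disjoint_left.2 fun ω h1 h2 => hmn ?_
    have := h1.symm.trans h2
    exact_mod_cast this

/-- The measure `M` collects the laws of all enumerations of configurations of exactly `n` points,
and the claim is `M = c • ν^n`. It is enough to test boxes. The sides of a box are cut into the
atoms of the finite algebra that they generate in `W`; for products of atoms the mass is given by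
the joint law of independent Poisson counts. -/
theorem IsPPP.isPoissonOn (h : IsPPP μ lp y) (hlp : 0 ≤ lp) {W : Set ℂ} (hW : MeasurableSet W)
    (hWf : volume W ≠ ∞) :
    IsPoissonOn μ y W (ENNReal.ofReal lp • volume.restrict W) := by
  classical
  refine ⟨h.measurable, hW, h.ae_finite hlp hW hWf, fun n F hF => ?_⟩
  have hyf : ∀ f : Fin n ↪ ℕ, Measurable fun ω a => y (f a) ω :=
    fun f => measurable_pi_lambda _ fun a => h.measurable _
  have hset : ∀ f : Fin n ↪ ℕ, MeasurableSet {ω | range f = {k | y k ω ∈ W}} :=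
    fun f => measurableSet_range_eq h.measurable hW _
  have : IsFiniteMeasure (volume.restrict W) := ⟨by simpa using hWf.lt_top⟩
  set ν : Measure ℂ := ENNReal.ofReal lp • volume.restrict W with hν
  have : IsFiniteMeasure ν := by rw [hν]; exact Measure.smul_finite _ ENNReal.ofReal_ne_top
  set M : Measure (Fin n → ℂ) := Measure.sum fun f : Fin n ↪ ℕ =>
    (μ.restrict {ω | range f = {k | y k ω ∈ W}}).map (fun ω a => y (f a) ω) with hM
  have hMl : ∀ G : (Fin n → ℂ) → ℝ≥0∞, Measurable G → ∫⁻ z, G z ∂M =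
      ∫⁻ ω, ∑' f : Fin n ↪ ℕ,
        (if range f = {k | y k ω ∈ W} then G (fun a => y (f a) ω) else 0) ∂μ := by
    intro G hG
    rw [lintegral_tsum, hM, lintegral_sum_measure]
    · refine tsum_congr fun f => ?_
      rw [lintegral_map hG (hyf f), ← lintegral_indicator (hset f)]
      rfl
    · exact fun f => (Measurable.ite (hset f) (hG.comp (hyf f)) measurable_const).aemeasurable
  set c : ℝ≥0∞ := ENNReal.ofReal (Real.exp (-ν.real univ)) with hc
  have hc0 : c ≠ 0 := by simp [hc, Real.exp_pos]
  have hct : c ≠ ∞ := by simp [hc]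
  have hνr : ∀ B, MeasurableSet B → B ⊆ W → ν B = ENNReal.ofReal (lp * volume.real B) := by
    intro B hB hBW
    have hBf : volume B ≠ ∞ := measure_ne_top_of_subset hBW hWf
    rw [hν, Measure.smul_apply, Measure.restrict_apply hB, inter_eq_left.2 hBW, smul_eq_mul,
      ENNReal.ofReal_mul hlp, ofReal_measureReal hBf]
  have hνu : ν.real univ = lp * volume.real W := by
    rw [hν, measureReal_def, Measure.smul_apply, Measure.restrict_apply_univ, smul_eq_mul,
      ENNReal.toReal_mul, ENNReal.toReal_ofReal hlp, measureReal_def]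
  -- the cells
  have hcell : ∀ {T : Type} [Fintype T] [DecidableEq T] (D : T → Set ℂ) (g : Fin n → T),
      (∀ τ, MeasurableSet (D τ)) → (⋃ τ, D τ) = W →
      (Pairwise fun τ τ' => Disjoint (D τ) (D τ')) →
      M (univ.pi fun a => D (g a)) = c * ∏ a, ν (D (g a)) := by
    intro T _ _ D g hD hDW hdisj
    have hsub : ∀ τ, D τ ⊆ W := fun τ => hDW ▸ subset_iUnion D τ
    have hDf : ∀ τ, volume (D τ) ≠ ∞ := fun τ => measure_ne_top_of_subset (hsub τ) hWf
    have hms : MeasurableSet (univ.pi fun a => D (g a)) := MeasurableSet.univ_pi fun a => hD _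
    set m : T → ℕ := fun τ => {a | g a = τ}.ncard with hm
    have hA : MeasurableSet {ω | ∀ τ, {k | y k ω ∈ D τ}.encard = m τ} := by
      rw [ofPred_forall]
      exact MeasurableSet.iInter fun τ =>
        measurableSet_encard_eq (fun k => h.measurable k (hD τ)) _
    have h1 : M (univ.pi fun a => D (g a)) =
        μ {ω | ∀ τ, {k | y k ω ∈ D τ}.encard = m τ} * ∏ τ, ((m τ).factorial : ℝ≥0∞) := by
      rw [← lintegral_indicator_one hms, hMl _ (measurable_one.indicator hms), mul_comm,
        ← lintegral_indicator_const hA]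
      refine lintegral_congr fun ω => ?_
      have h2 := tsum_embedding_cells (I := fun τ => {k | y k ω ∈ D τ})
        (fun τ τ' hne => disjoint_left.2 fun k hk hk' =>
          disjoint_left.1 (hdisj hne) hk hk') g
      have h3 : (⋃ τ, {k | y k ω ∈ D τ}) = {k | y k ω ∈ W} := by
        ext k
        simp [← hDW]
      rw [h3] at h2
      simp only [indicator_apply, mem_pi, mem_univ, forall_const, mem_ofPred_eq, Pi.one_apply]
      exact h2
    -- The `m τ` factorial orderings of the points in a cell cancel the denominator of the Poisson
    -- weight.
    have h4 : ∀ τ, ENNReal.ofReal (Real.exp (-(lp * volume.real (D τ))) *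
        (lp * volume.real (D τ)) ^ m τ / (m τ).factorial) * ((m τ).factorial : ℝ≥0∞) =
        ENNReal.ofReal (Real.exp (-(lp * volume.real (D τ)))) * ν (D τ) ^ m τ := by
      intro τ
      have : 0 ≤ lp * volume.real (D τ) := mul_nonneg hlp measureReal_nonneg
      rw [hνr _ (hD τ) (hsub τ), ← ENNReal.ofReal_pow this, ← ENNReal.ofReal_natCast,
        ← ENNReal.ofReal_mul (by positivity), ← ENNReal.ofReal_mul (by positivity)]
      congr 1
      field_simp
    rw [h1, h.counts_law hD hDf hdisj, ← Finset.prod_mul_distrib, Finset.prod_congr rfl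
      fun τ _ => h4 τ, Finset.prod_mul_distrib]
    congr 1
    · rw [← ENNReal.ofReal_prod_of_nonneg fun τ _ => (Real.exp_pos _).le, ← Real.exp_sum, hc, hνu,
        Finset.sum_neg_distrib, ← Finset.mul_sum, ← hDW, measureReal_iUnion_fintype hdisj hD]
    · rw [← Finset.prod_fiberwise' Finset.univ g fun τ => ν (D τ)]
      refine Finset.prod_congr rfl fun τ _ => ?_
      rw [Finset.prod_const]
      congr 1
      rw [hm]
      simp [ncard_eq_toFinset_card']
  have hpi : Measure.pi (fun _ : Fin n => ν) = c⁻¹ • M := by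
    refine Measure.pi_eq fun s hs => ?_
    rw [Measure.smul_apply, smul_eq_mul]
    -- The atoms, indexed by the set of sides that contain a given point; some may be empty.
    set D : Finset (Fin n) → Set ℂ := fun τ => {z | z ∈ W ∧ ∀ a, z ∈ s a ↔ a ∈ τ} with hDdef
    have hD : ∀ τ, MeasurableSet (D τ) := by
      intro τ
      have : D τ = W ∩ ⋂ a, {z | z ∈ s a ↔ a ∈ τ} := by
        ext z
        simp [hDdef]
      rw [this]
      refine hW.inter (MeasurableSet.iInter fun a => ?_)
      by_cases ha : a ∈ τ
      · simp only [ha, iff_true]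
        exact hs a
      · simp only [ha, iff_false]
        exact (hs a).compl
    have hdisj : Pairwise fun τ τ' => Disjoint (D τ) (D τ') := by
      intro τ τ' hne
      refine disjoint_left.2 fun z hz hz' => hne ?_
      ext a
      rw [← hz.2 a, hz'.2 a]
    have hDW : (⋃ τ, D τ) = W := by
      ext z
      simp only [mem_iUnion]
      exact ⟨fun ⟨τ, hz⟩ => hz.1, fun hz => ⟨Finset.univ.filter fun a => z ∈ s a, hz, by simp⟩⟩
    let t : Fin n → Finset (Finset (Fin n)) := fun a => Finset.univ.filter fun τ => a ∈ τ
    have hsa : ∀ a, s a ∩ W = ⋃ τ ∈ t a, D τ := by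
      intro a
      ext z
      simp only [mem_iUnion, t, Finset.mem_filter, Finset.mem_univ, true_and, exists_prop]
      constructor
      · rintro ⟨hz, hzW⟩
        obtain ⟨τ, hτ⟩ := mem_iUnion.1 (hDW ▸ hzW)
        exact ⟨τ, (hτ.2 a).1 hz, hτ⟩
      · rintro ⟨τ, ha, hτ⟩
        exact ⟨(hτ.2 a).2 ha, hτ.1⟩
    have hν1 : ∀ a, ν (s a) = ∑ τ ∈ t a, ν (D τ) := by
      intro a
      have : ν (s a) = ν (s a ∩ W) := by
        rw [hν, Measure.smul_apply, Measure.smul_apply, Measure.restrict_apply (hs a),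
          Measure.restrict_apply ((hs a).inter hW), inter_assoc, inter_self]
      rw [this, hsa a, measure_biUnion_finset (fun τ _ τ' _ hne => hdisj hne) fun τ _ => hD τ]
    have hM1 : M (univ.pi s) = M (univ.pi fun a => s a ∩ W) := by
      have hms1 : MeasurableSet (univ.pi s) := MeasurableSet.univ_pi hs
      have hms2 : MeasurableSet (univ.pi fun a => s a ∩ W) :=
        MeasurableSet.univ_pi fun a => (hs a).inter hW
      rw [← lintegral_indicator_one hms1, ← lintegral_indicator_one hms2,
        hMl _ (measurable_one.indicator hms1), hMl _ (measurable_one.indicator hms2)]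
      refine lintegral_congr fun ω => tsum_congr fun f => ?_
      by_cases hf : range f = {k | y k ω ∈ W}
      · have hfW : ∀ a, y (f a) ω ∈ W := fun a => by
          have : f a ∈ {k | y k ω ∈ W} := hf ▸ mem_range_self a
          exact this
        simp [hf, indicator_apply, hfW]
      · simp [hf]
    -- Distributivity: choosing one atom per coordinate splits the box into disjoint products of
    -- atoms.
    have hM2 : (univ.pi fun a => s a ∩ W) =
        ⋃ g ∈ Fintype.piFinset t, univ.pi fun a => D (g a) := by
      ext z
      simp only [mem_pi, mem_univ, forall_const, hsa, mem_iUnion, Fintype.mem_piFinset,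
        exists_prop]
      constructor
      · intro H
        choose g hg1 hg2 using H
        exact ⟨g, hg1, hg2⟩
      · rintro ⟨g, hg1, hg2⟩ a
        exact ⟨g a, hg1 a, hg2 a⟩
    rw [hM1, hM2, measure_biUnion_finset]
    · rw [Finset.sum_congr rfl fun g _ => hcell D g hD hDW hdisj, ← Finset.mul_sum, ← mul_assoc,
        ENNReal.inv_mul_cancel hc0 hct, one_mul, Finset.prod_congr rfl fun a _ => hν1 a,
        Finset.prod_univ_sum]
    · intro g _ g' _ hne
      obtain ⟨a, ha⟩ := Function.ne_iff.1 hne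
      exact disjoint_left.2 fun z hz hz' =>
        disjoint_left.1 (hdisj ha) (hz a (mem_univ a)) (hz' a (mem_univ a))
    · exact fun g _ => MeasurableSet.univ_pi fun a => hD _
  rw [← hMl F hF, hpi, lintegral_smul_measure, smul_eq_mul, ← mul_assoc,
    ENNReal.mul_inv_cancel hc0 hct, one_mul]

end GHCP

namespace GHCP

/-! ### Geometry of the exclusion regions -/

theorem dir_eq_circle (θ : ℝ) : dir θ = (Circle.exp θ : ℂ) := by
  rw [dir, Circle.coe_exp]

theorem norm_dir (θ : ℝ) : ‖dir θ‖ = 1 := by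
  rw [dir_eq_circle, Circle.norm_coe]

theorem dir_zero : dir 0 = 1 := by simp [dir]

theorem dir_add (α β : ℝ) : dir (α + β) = dir α * dir β := by
  simp [dir, add_mul, Complex.exp_add]

theorem dir_neg_mul (θ : ℝ) : dir (-θ) * dir θ = 1 := by
  rw [← dir_add, neg_add_cancel, dir_zero]

theorem dir_add_two_pi (θ : ℝ) : dir (θ + 2 * Real.pi) = dir θ := by
  rw [dir_add]
  simp [dir, Complex.exp_two_pi_mul_I]

theorem dir_eq_cos_sin (θ : ℝ) : dir θ = Real.cos θ + Real.sin θ * Complex.I := by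
  rw [dir, Complex.exp_mul_I, Complex.ofReal_cos, Complex.ofReal_sin]

theorem re_dir (θ : ℝ) : (dir θ).re = Real.cos θ := Complex.exp_ofReal_mul_I_re θ

theorem im_dir (θ : ℝ) : (dir θ).im = Real.sin θ := Complex.exp_ofReal_mul_I_im θ

theorem conj_dir (θ : ℝ) : (starRingEnd ℂ) (dir θ) = dir (-θ) := by
  apply Complex.ext <;> simp [re_dir, im_dir]

theorem continuous_dir : Continuous dir := by
  unfold dir
  fun_prop

theorem measurable_dir : Measurable dir := continuous_dir.measurable

theorem inner_dir (α β : ℝ) : inner ℝ (dir α) (dir β) = Real.cos (β - α) := by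
  rw [Complex.inner, Complex.mul_re, Complex.conj_re, Complex.conj_im, re_dir, re_dir, im_dir,
    im_dir, Real.cos_sub]
  ring

theorem angle_smul_dir {r s : ℝ} (hr : 0 < r) (hs : 0 < s) (α β : ℝ) :
    InnerProductGeometry.angle ((r : ℂ) * dir α) ((s : ℂ) * dir β) = foldAngle (β - α) := by
  rw [← Complex.real_smul, ← Complex.real_smul,
    InnerProductGeometry.angle_smul_left_of_pos _ _ hr,
    InnerProductGeometry.angle_smul_right_of_pos _ _ hs, InnerProductGeometry.angle, inner_dir,
    norm_dir, norm_dir, foldAngle]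
  simp

theorem foldAngle_of_abs_le {ψ : ℝ} (h : |ψ| ≤ Real.pi) : foldAngle ψ = |ψ| := by
  rw [foldAngle, ← Real.cos_abs, Real.arccos_cos (abs_nonneg _) h]

theorem gain_nonneg (d0 wl : ℝ) (N : ℕ) (φ : ℝ) : 0 ≤ gain d0 wl N φ := by
  unfold gain
  split_ifs <;> positivity

theorem gain_le_one (d0 wl : ℝ) (N : ℕ) (φ : ℝ) : gain d0 wl N φ ≤ 1 := by
  unfold gain
  split_ifs
  · exact Real.cos_sq_le_one _
  · exact zero_le_one

theorem measurable_gain (d0 wl : ℝ) (N : ℕ) : Measurable (gain d0 wl N) := by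
  unfold gain
  refine Measurable.ite ?_ (by fun_prop) measurable_const
  exact measurableSet_le (by fun_prop) measurable_const

theorem measurable_angle :
    Measurable fun q : ℂ × ℂ => InnerProductGeometry.angle q.1 q.2 := by
  unfold InnerProductGeometry.angle
  exact Real.measurable_arccos.comp (by fun_prop)

/-- Exclusion region of a pair, given by its transmitter and its orientation. -/
def pairRegion (p : Params) (a : ℂ × ℝ) : Set ℂ := region p a.1 (receiver p a.1 a.2)

/-- RTS exclusion region of a pair, given by its transmitter and its orientation. -/
def pairRegionT (p : Params) (a : ℂ × ℝ) : Set ℂ := regionT p a.1 (receiver p a.1 a.2)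

theorem measurable_receiver (p : Params) : Measurable fun a : ℂ × ℝ => receiver p a.1 a.2 := by
  unfold receiver
  exact measurable_fst.add ((measurable_dir.comp measurable_snd).const_mul _)

theorem measurableSet_mem_regionT (p : Params) :
    MeasurableSet {q : (ℂ × ℂ) × ℂ | q.2 ∈ regionT p q.1.1 q.1.2} := by
  have h1 : Measurable fun q : (ℂ × ℂ) × ℂ => q.2 - q.1.1 := by fun_prop
  have h2 : Measurable fun q : (ℂ × ℂ) × ℂ => q.1.2 - q.1.1 := by fun_prop
  have h3 : Measurable fun q : (ℂ × ℂ) × ℂ =>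
      p.Rt * √(gainT p (InnerProductGeometry.angle (q.2 - q.1.1) (q.1.2 - q.1.1))) :=
    (Real.continuous_sqrt.measurable.comp ((measurable_gain p.d0 p.wl p.Nt).comp
      (measurable_angle.comp (h1.prodMk h2)))).const_mul _
  exact measurableSet_le h1.norm h3

theorem measurableSet_mem_regionR (p : Params) :
    MeasurableSet {q : (ℂ × ℂ) × ℂ | q.2 ∈ regionR p q.1.1 q.1.2} := by
  have h1 : Measurable fun q : (ℂ × ℂ) × ℂ => q.2 - q.1.2 := by fun_prop
  have h2 : Measurable fun q : (ℂ × ℂ) × ℂ => q.1.1 - q.1.2 := by fun_prop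
  have h3 : Measurable fun q : (ℂ × ℂ) × ℂ =>
      p.Rr * √(gainR p (InnerProductGeometry.angle (q.2 - q.1.2) (q.1.1 - q.1.2))) :=
    (Real.continuous_sqrt.measurable.comp ((measurable_gain p.d0 p.wl p.Nr).comp
      (measurable_angle.comp (h1.prodMk h2)))).const_mul _
  exact measurableSet_le h1.norm h3

theorem measurableSet_mem_pairRegionT (p : Params) :
    MeasurableSet {q : (ℂ × ℝ) × ℂ | q.2 ∈ pairRegionT p q.1} := by
  have : Measurable fun q : (ℂ × ℝ) × ℂ => ((q.1.1, receiver p q.1.1 q.1.2), q.2) :=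
    (measurable_fst.fst.prodMk ((measurable_receiver p).comp measurable_fst)).prodMk measurable_snd
  exact this (measurableSet_mem_regionT p)

theorem measurableSet_mem_pairRegion (p : Params) :
    MeasurableSet {q : (ℂ × ℝ) × ℂ | q.2 ∈ pairRegion p q.1} := by
  have : Measurable fun q : (ℂ × ℝ) × ℂ => ((q.1.1, receiver p q.1.1 q.1.2), q.2) :=
    (measurable_fst.fst.prodMk ((measurable_receiver p).comp measurable_fst)).prodMk measurable_snd
  exact this ((measurableSet_mem_regionT p).union (measurableSet_mem_regionR p))

theorem measurableSet_pairRegion (p : Params) (a : ℂ × ℝ) : MeasurableSet (pairRegion p a) :=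
  measurable_prodMk_left (measurableSet_mem_pairRegion p)

theorem norm_sub_le_of_mem_pairRegionT {p : Params} (hRt : 0 < p.Rt) {a : ℂ × ℝ} {z : ℂ}
    (hz : z ∈ pairRegionT p a) : ‖z - a.1‖ ≤ p.Rt := by
  have h : ‖z - a.1‖ ≤ p.Rt * √(gainT p (InnerProductGeometry.angle (z - a.1)
    (receiver p a.1 a.2 - a.1))) := hz
  refine h.trans (mul_le_of_le_one_right hRt.le ?_)
  rw [Real.sqrt_le_one]
  exact gain_le_one _ _ _ _

theorem norm_receiver_sub {p : Params} (hd : 0 < p.d) (a : ℂ × ℝ) :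
    ‖receiver p a.1 a.2 - a.1‖ = p.d := by
  rw [receiver, add_sub_cancel_left, norm_mul, norm_dir, mul_one, Complex.norm_real,
    Real.norm_of_nonneg hd.le]

theorem norm_sub_le_of_mem_pairRegion {p : Params} (hd : 0 < p.d) (hRt : 0 < p.Rt)
    (hRr : 0 < p.Rr) {a : ℂ × ℝ} {z : ℂ} (hz : z ∈ pairRegion p a) :
    ‖z - a.1‖ ≤ p.Rt + p.Rr + p.d := by
  rcases hz with hz | hz
  · have := norm_sub_le_of_mem_pairRegionT hRt hz
    linarith
  · have h : ‖z - receiver p a.1 a.2‖ ≤ p.Rr * √(gainR p (InnerProductGeometry.angle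
      (z - receiver p a.1 a.2) (a.1 - receiver p a.1 a.2))) := hz
    have h1 : ‖z - receiver p a.1 a.2‖ ≤ p.Rr := by
      refine h.trans (mul_le_of_le_one_right hRr.le ?_)
      rw [Real.sqrt_le_one]
      exact gain_le_one _ _ _ _
    have h2 := norm_sub_le_norm_sub_add_norm_sub z (receiver p a.1 a.2) a.1
    rw [norm_receiver_sub hd] at h2
    linarith

theorem volume_pairRegion_ne_top {p : Params} (hd : 0 < p.d) (hRt : 0 < p.Rt)
    (hRr : 0 < p.Rr) (a : ℂ × ℝ) : volume (pairRegion p a) ≠ ∞ := by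
  refine measure_ne_top_of_subset (s := Metric.closedBall a.1 (p.Rt + p.Rr + p.d)) ?_
    (measure_closedBall_lt_top (μ := volume)).ne
  intro z hz
  rw [mem_closedBall_iff_norm]
  exact norm_sub_le_of_mem_pairRegion hd hRt hRr hz

/-! ### Rigid motions -/

/-- Only distances and unoriented angles enter the definition of the region. The isometry is kept
general so that it covers both rotations and complex conjugation. -/
theorem mem_regionT_isometry (p : Params) (L : ℂ ≃ₗᵢ[ℝ] ℂ) (b y x z : ℂ) :
    b + L z ∈ regionT p (b + L y) (b + L x) ↔ z ∈ regionT p y x := by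
  simp only [regionT, mem_ofPred_eq, add_sub_add_left_eq_sub, ← map_sub,
    LinearIsometryEquiv.norm_map]
  rw [← L.coe_toLinearIsometry, LinearIsometry.angle_map]

theorem mem_regionR_isometry (p : Params) (L : ℂ ≃ₗᵢ[ℝ] ℂ) (b y x z : ℂ) :
    b + L z ∈ regionR p (b + L y) (b + L x) ↔ z ∈ regionR p y x := by
  simp only [regionR, mem_ofPred_eq, add_sub_add_left_eq_sub, ← map_sub,
    LinearIsometryEquiv.norm_map]
  rw [← L.coe_toLinearIsometry, LinearIsometry.angle_map]

theorem measurePreserving_isometry (L : ℂ ≃ₗᵢ[ℝ] ℂ) (b : ℂ) :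
    MeasurePreserving (fun z => b + L z) (volume : Measure ℂ) volume :=
  (measurePreserving_add_left volume b).comp L.measurePreserving

theorem measurableEmbedding_isometry (L : ℂ ≃ₗᵢ[ℝ] ℂ) (b : ℂ) :
    MeasurableEmbedding (fun z => b + L z) :=
  (measurableEmbedding_addLeft b).comp L.toHomeomorph.measurableEmbedding

/-- The rigid motion that moves the pair `(0, 0)` to the pair `b`, acting on pairs. -/
noncomputable def move (b a : ℂ × ℝ) : ℂ × ℝ := (b.1 + dir b.2 * a.1, b.2 + a.2)

theorem receiver_move (p : Params) (b a : ℂ × ℝ) :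
    receiver p (move b a).1 (move b a).2 = b.1 + dir b.2 * receiver p a.1 a.2 := by
  simp only [receiver, move, dir_add]
  ring

theorem move_zero (b : ℂ × ℝ) : move b (0, 0) = b := by simp [move]

theorem rotation_dir (θ : ℝ) (z : ℂ) : rotation (Circle.exp θ) z = dir θ * z := by
  rw [rotation_apply, dir_eq_circle]

theorem mem_pairRegionT_move (p : Params) (b a : ℂ × ℝ) (z : ℂ) :
    b.1 + dir b.2 * z ∈ pairRegionT p (move b a) ↔ z ∈ pairRegionT p a := by
  have := mem_regionT_isometry p (rotation (Circle.exp b.2)) b.1 a.1 (receiver p a.1 a.2) z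
  simp only [rotation_dir] at this
  rw [pairRegionT, receiver_move]
  exact this

theorem mem_pairRegion_move (p : Params) (b a : ℂ × ℝ) (z : ℂ) :
    b.1 + dir b.2 * z ∈ pairRegion p (move b a) ↔ z ∈ pairRegion p a := by
  have h1 := mem_regionT_isometry p (rotation (Circle.exp b.2)) b.1 a.1 (receiver p a.1 a.2) z
  have h2 := mem_regionR_isometry p (rotation (Circle.exp b.2)) b.1 a.1 (receiver p a.1 a.2) z
  simp only [rotation_dir] at h1 h2
  rw [pairRegion, receiver_move]
  exact or_congr h1 h2

theorem preimage_pairRegion_move (p : Params) (b a : ℂ × ℝ) :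
    (fun z => b.1 + rotation (Circle.exp b.2) z) ⁻¹' pairRegion p (move b a) = pairRegion p a := by
  ext z
  simp only [rotation_dir, mem_preimage]
  exact mem_pairRegion_move p b a z

theorem measure_union_move (p : Params) (b a a' : ℂ × ℝ) :
    volume (pairRegion p (move b a) ∪ pairRegion p (move b a')) =
      volume (pairRegion p a ∪ pairRegion p a') := by
  rw [← preimage_pairRegion_move p b a, ← preimage_pairRegion_move p b a', ← preimage_union,
    (measurePreserving_isometry _ b.1).measure_preimage_emb (measurableEmbedding_isometry _ _)]

theorem measure_pairRegion (p : Params) (b : ℂ × ℝ) :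
    volume (pairRegion p b) = volume (pairRegion p (0, 0)) := by
  have := measure_union_move p b (0, 0) (0, 0)
  simpa [move_zero] using this

theorem measureReal_pairRegion (p : Params) (b : ℂ × ℝ) :
    volume.real (pairRegion p b) = areaO p := by
  rw [measureReal_def, measure_pairRegion]
  rfl

/-- The reflection in the real axis, acting on pairs. -/
noncomputable def reflect (a : ℂ × ℝ) : ℂ × ℝ := ((starRingEnd ℂ) a.1, -a.2)

theorem receiver_reflect (p : Params) (a : ℂ × ℝ) :
    receiver p (reflect a).1 (reflect a).2 = (starRingEnd ℂ) (receiver p a.1 a.2) := by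
  simp [receiver, reflect, conj_dir]

theorem mem_pairRegionT_reflect (p : Params) (a : ℂ × ℝ) (z : ℂ) :
    (starRingEnd ℂ) z ∈ pairRegionT p (reflect a) ↔ z ∈ pairRegionT p a := by
  have := mem_regionT_isometry p Complex.conjLIE 0 a.1 (receiver p a.1 a.2) z
  simp only [Complex.conjLIE_apply, zero_add] at this
  rw [pairRegionT, receiver_reflect]
  exact this

theorem mem_pairRegion_reflect (p : Params) (a : ℂ × ℝ) (z : ℂ) :
    (starRingEnd ℂ) z ∈ pairRegion p (reflect a) ↔ z ∈ pairRegion p a := by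
  have h1 := mem_regionT_isometry p Complex.conjLIE 0 a.1 (receiver p a.1 a.2) z
  have h2 := mem_regionR_isometry p Complex.conjLIE 0 a.1 (receiver p a.1 a.2) z
  simp only [Complex.conjLIE_apply, zero_add] at h1 h2
  rw [pairRegion, receiver_reflect]
  exact or_congr h1 h2

theorem reflect_zero : reflect (0, 0) = (0, 0) := by simp [reflect]

theorem measure_union_reflect (p : Params) (a a' : ℂ × ℝ) :
    volume (pairRegion p (reflect a) ∪ pairRegion p (reflect a')) =
      volume (pairRegion p a ∪ pairRegion p a') := by
  have h : ∀ a, (fun z => 0 + Complex.conjLIE z) ⁻¹' pairRegion p (reflect a) =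
      pairRegion p a := by
    intro a
    ext z
    simp only [Complex.conjLIE_apply, zero_add, mem_preimage]
    exact mem_pairRegion_reflect p a z
  rw [← h a, ← h a', ← preimage_union,
    (measurePreserving_isometry _ _).measure_preimage_emb (measurableEmbedding_isometry _ _)]

theorem pairRegion_add_two_pi (p : Params) (u : ℂ) (φ : ℝ) :
    pairRegion p (u, φ + 2 * Real.pi) = pairRegion p (u, φ) := by
  simp [pairRegion, receiver, dir_add_two_pi]

theorem pairRegionT_add_two_pi (p : Params) (u : ℂ) (φ : ℝ) :
    pairRegionT p (u, φ + 2 * Real.pi) = pairRegionT p (u, φ) := by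
  simp [pairRegionT, receiver, dir_add_two_pi]

/-! ### Areas -/

/-- The point at distance `Rt / 2` on boresight is interior to the RTS region, since the gain there
is 1 and is continuous nearby. The apex itself would not do: the angle is discontinuous at `0`. -/
theorem areaO_pos {p : Params} (hd : 0 < p.d) (hRt : 0 < p.Rt) (hRr : 0 < p.Rr) (hd0 : 0 < p.d0)
    (hwl : 0 < p.wl) (hNt : 0 < p.Nt) : 0 < areaO p := by
  have hfin : volume (pairRegion p (0, 0)) ≠ ∞ := volume_pairRegion_ne_top hd hRt hRr _
  refine ENNReal.toReal_pos (ne_of_gt ?_) hfin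
  have hz0 : ((p.Rt / 2 : ℝ) : ℂ) ≠ 0 := by
    rw [Complex.ofReal_ne_zero]
    positivity
  have hd' : (p.d : ℂ) ≠ 0 := by
    rw [Complex.ofReal_ne_zero]
    exact hd.ne'
  have hcont : ContinuousAt (fun z : ℂ => InnerProductGeometry.angle z (p.d : ℂ))
      ((p.Rt / 2 : ℝ) : ℂ) := by
    have h1 := InnerProductGeometry.continuousAt_angle (x := (((p.Rt / 2 : ℝ) : ℂ), (p.d : ℂ)))
      hz0 hd'
    exact ContinuousAt.comp' (f := fun z : ℂ => (z, (p.d : ℂ))) h1 (by fun_prop)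
  have hang : InnerProductGeometry.angle ((p.Rt / 2 : ℝ) : ℂ) (p.d : ℂ) = 0 := by
    have := angle_smul_dir (half_pos hRt) hd 0 0
    rw [dir_zero, mul_one, mul_one] at this
    rw [this, sub_zero, foldAngle_of_abs_le (by simpa using Real.pi_pos.le), abs_zero]
  have hN : (0 : ℝ) < p.Nt := by exact_mod_cast hNt
  have hev1 : ∀ᶠ z in nhds ((p.Rt / 2 : ℝ) : ℂ),
      InnerProductGeometry.angle z (p.d : ℂ) < p.wl / (p.d0 * p.Nt) := by
    refine hcont.eventually_lt_const (hang.trans_lt ?_)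
    positivity
  have hev2 : ∀ᶠ z in nhds ((p.Rt / 2 : ℝ) : ℂ), ‖z‖ < p.Rt * √(Real.cos (Real.pi * p.Nt * p.d0 /
      (2 * p.wl) * InnerProductGeometry.angle z (p.d : ℂ)) ^ 2) := by
    have hc : ContinuousAt (fun z : ℂ => p.Rt * √(Real.cos (Real.pi * p.Nt * p.d0 /
      (2 * p.wl) * InnerProductGeometry.angle z (p.d : ℂ)) ^ 2)) ((p.Rt / 2 : ℝ) : ℂ) := by
      fun_prop
    refine continuous_norm.continuousAt.eventually_lt hc ?_
    rw [hang, Complex.norm_real, Real.norm_of_nonneg (by positivity)]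
    simp [hRt]
  refine Measure.measure_pos_of_mem_nhds volume (x := ((p.Rt / 2 : ℝ) : ℂ)) ?_
  filter_upwards [hev1, hev2] with z h1 h2
  left
  have hrec : receiver p 0 0 - 0 = p.d := by simp [receiver, dir_zero]
  change ‖z - 0‖ ≤ p.Rt * √(gainT p (InnerProductGeometry.angle (z - 0) (receiver p 0 0 - 0)))
  rw [hrec, sub_zero, gainT, gain, if_pos]
  · exact h2.le
  · rw [abs_of_nonneg (InnerProductGeometry.angle_nonneg _ _)]
    exact h1.le

/-- Area of the union of the exclusion regions of the typical pair and of the pair `a`. -/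
noncomputable def unionArea (p : Params) (a : ℂ × ℝ) : ℝ :=
  volume.real (pairRegion p (0, 0) ∪ pairRegion p a)

theorem volume_union_ne_top {p : Params} (hd : 0 < p.d) (hRt : 0 < p.Rt)
    (hRr : 0 < p.Rr) (a b : ℂ × ℝ) : volume (pairRegion p a ∪ pairRegion p b) ≠ ∞ :=
  measure_union_ne_top (volume_pairRegion_ne_top hd hRt hRr a)
    (volume_pairRegion_ne_top hd hRt hRr b)

theorem areaO_le_unionArea {p : Params} (hd : 0 < p.d) (hRt : 0 < p.Rt)
    (hRr : 0 < p.Rr) (a : ℂ × ℝ) : areaO p ≤ unionArea p a :=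
  measureReal_mono subset_union_left (volume_union_ne_top hd hRt hRr _ _)

theorem measurable_unionArea (p : Params) : Measurable (unionArea p) := by
  have : MeasurableSet {q : (ℂ × ℝ) × ℂ | q.2 ∈ pairRegion p (0, 0) ∪ pairRegion p q.1} :=
    (measurable_snd (measurableSet_pairRegion p (0, 0))).union (measurableSet_mem_pairRegion p)
  exact (measurable_measure_prodMk_left this).ennreal_toReal

/-- Both regions have area `areaO p`, so if their union has no more, they agree almost everywhere
and have equal first moments. The first moment of the moved region is `u * areaO p + dir φ * m`,
which can be solved for `u`. -/
theorem eq_of_unionArea_eq {p : Params} (hd : 0 < p.d) (hRt : 0 < p.Rt) (hRr : 0 < p.Rr)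
    (hpos : 0 < areaO p) {u : ℂ} {φ : ℝ} (h : unionArea p (u, φ) = areaO p) :
    u = ((∫ z in pairRegion p (0, 0), z) - dir φ * ∫ z in pairRegion p (0, 0), z) / areaO p := by
  have hfin := volume_union_ne_top hd hRt hRr (0, 0) (u, φ)
  have hU : volume (pairRegion p (0, 0) ∪ pairRegion p (u, φ)) = volume (pairRegion p (0, 0)) := by
    rw [← ofReal_measureReal hfin, ← ofReal_measureReal (volume_pairRegion_ne_top hd hRt hRr _)]
    exact congrArg _ h
  have hae : pairRegion p (0, 0) =ᵐ[volume] pairRegion p (u, φ) := by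
    refine (ae_eq_of_subset_of_measure_ge subset_union_left hU.le
      (measurableSet_pairRegion p _).nullMeasurableSet hfin).trans
      (ae_eq_of_subset_of_measure_ge subset_union_right ?_
      (measurableSet_pairRegion p _).nullMeasurableSet hfin).symm
    rw [hU, measure_pairRegion p (u, φ)]
  set m := ∫ z in pairRegion p (0, 0), z with hm
  have h1 : ∫ z in pairRegion p (u, φ), z = u * areaO p + dir φ * m := by
    have h2 := (measurePreserving_isometry (rotation (Circle.exp φ)) u).setIntegral_preimage_emb
      (measurableEmbedding_isometry _ _) (fun z => z) (pairRegion p (u, φ))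
    have h3 := preimage_pairRegion_move p (u, φ) (0, 0)
    rw [move_zero] at h3
    change _ ⁻¹' pairRegion p (u, φ) = _ at h3
    rw [h3] at h2
    rw [← h2, integral_add, setIntegral_const]
    · simp only [rotation_dir]
      rw [integral_const_mul, Complex.real_smul, mul_comm]
      rfl
    · exact integrableOn_const (volume_pairRegion_ne_top hd hRt hRr _)
    · have : IntegrableOn (rotation (Circle.exp φ)) (Metric.closedBall 0 (p.Rt + p.Rr + p.d)) :=
        (rotation (Circle.exp φ)).continuous.continuousOn.integrableOn_compact
          (isCompact_closedBall _ _)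
      refine this.mono_set fun z hz => ?_
      rw [mem_closedBall_iff_norm]
      exact norm_sub_le_of_mem_pairRegion hd hRt hRr hz
  rw [← setIntegral_congr_set hae, ← hm] at h1
  have hA : (areaO p : ℂ) ≠ 0 := Complex.ofReal_ne_zero.2 hpos.ne'
  rw [eq_div_iff hA]
  linear_combination -h1

/-- By Fubini: for each orientation at most one position is exceptional. This permits neglecting the
degenerate value `V = areaO p` of `pFun`. -/
theorem ae_unionArea_ne {p : Params} (hd : 0 < p.d) (hRt : 0 < p.Rt) (hRr : 0 < p.Rr)
    (hpos : 0 < areaO p) : ∀ᵐ a ∂((volume : Measure ℂ).prod (volume : Measure ℝ)),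
      unionArea p a ≠ areaO p := by
  have hms : MeasurableSet {a : ℂ × ℝ | unionArea p a = areaO p} :=
    measurable_unionArea p (measurableSet_singleton _)
  rw [ae_iff]
  simp only [ne_eq, not_not]
  rw [Measure.prod_apply_symm hms, lintegral_eq_zero_iff (measurable_measure_prodMk_right hms)]
  refine Filter.Eventually.of_forall fun φ => ?_
  refine measure_mono_null (t := {((∫ z in pairRegion p (0, 0), z) -
    dir φ * ∫ z in pairRegion p (0, 0), z) / areaO p}) ?_ (measure_singleton _)
  intro u hu
  exact eq_of_unionArea_eq hd hRt hRr hpos hu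

end GHCP

namespace GHCP

/-! ### The hidden-node domain in polar coordinates -/

theorem halfWidth_nonneg {p : Params} (hd0 : 0 < p.d0) (hwl : 0 < p.wl) (s : ℝ) :
    0 ≤ halfWidth p s := by
  have := Real.pi_pos
  exact mul_nonneg (by positivity) (Real.arccos_nonneg _)

theorem halfWidth_eq_zero {p : Params} (hRt : 0 < p.Rt) {s : ℝ} (hs : p.Rt ≤ s) :
    halfWidth p s = 0 := by
  rw [halfWidth, Real.arccos_eq_zero.2 ((one_le_div hRt).2 hs), mul_zero]

/-- The bound is the first null of the beam, attained at `s = 0`. -/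
theorem halfWidth_le {p : Params} (hRt : 0 < p.Rt) (hd0 : 0 < p.d0) (hwl : 0 < p.wl)
    (hNt : 0 < p.Nt) {s : ℝ} (hs : 0 ≤ s) : halfWidth p s ≤ p.wl / (p.d0 * p.Nt) := by
  have hN : (0 : ℝ) < p.Nt := by exact_mod_cast hNt
  have hpi := Real.pi_pos
  have h1 : Real.arccos (s / p.Rt) ≤ Real.pi / 2 := Real.arccos_le_pi_div_two.2 (by positivity)
  calc halfWidth p s ≤ 2 * p.wl / (Real.pi * p.Nt * p.d0) * (Real.pi / 2) := by
        unfold halfWidth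
        gcongr
    _ = p.wl / (p.d0 * p.Nt) := by field_simp

/-- Inside the main lobe the cosine is nonnegative, so the root of its square is the cosine and
`arccos` inverts the inequality; outside, the gain vanishes while `s > 0`. The clause `s ≤ p.Rt` is
needed separately: beyond `Rt` the truncated `arccos` gives half-width 0, which `ψ = 0` still
satisfies. -/
theorem le_mul_sqrt_gainT_iff {p : Params} (hRt : 0 < p.Rt) (hd0 : 0 < p.d0) (hwl : 0 < p.wl)
    (hNt : 0 < p.Nt) {s : ℝ} (hs : 0 < s) (ψ : ℝ) :
    s ≤ p.Rt * √(gainT p |ψ|) ↔ s ≤ p.Rt ∧ |ψ| ≤ halfWidth p s := by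
  have hN : (0 : ℝ) < p.Nt := by exact_mod_cast hNt
  have hpi := Real.pi_pos
  set c := Real.pi * p.Nt * p.d0 / (2 * p.wl) with hc
  have hcpos : 0 < c := by positivity
  have hf : ∀ x, x ≤ halfWidth p s ↔ c * x ≤ Real.arccos (s / p.Rt) := by
    intro x
    have : halfWidth p s = Real.arccos (s / p.Rt) / c := by
      rw [halfWidth, hc]
      field_simp
    rw [this, le_div_iff₀ hcpos, mul_comm]
  by_cases hw : |ψ| ≤ p.wl / (p.d0 * p.Nt)
  · have hcw : c * |ψ| ≤ Real.pi / 2 := by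
      calc c * |ψ| ≤ c * (p.wl / (p.d0 * p.Nt)) := by gcongr
        _ = Real.pi / 2 := by
          rw [hc]
          field_simp
    have hc0 : 0 ≤ c * |ψ| := by positivity
    have hcos : 0 ≤ Real.cos (c * |ψ|) :=
      Real.cos_nonneg_of_neg_pi_div_two_le_of_le (by linarith) hcw
    rw [gainT, gain, if_pos (by rwa [abs_abs]), Real.sqrt_sq hcos, hf, mul_comm, ← div_le_iff₀ hRt]
    constructor
    · intro h
      have h1 := h.trans (Real.cos_le_one _)
      rw [div_le_one hRt] at h1
      refine ⟨h1, ?_⟩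
      rw [← Real.arccos_cos hc0 (by linarith)]
      exact Real.arccos_le_arccos h
    · rintro ⟨h1, h2⟩
      have h3 := Real.cos_le_cos_of_nonneg_of_le_pi hc0 (Real.arccos_le_pi _) h2
      rwa [Real.cos_arccos (by have := div_nonneg hs.le hRt.le; linarith)
        ((div_le_one hRt).2 h1)] at h3
  · rw [gainT, gain, if_neg (by rwa [abs_abs]), Real.sqrt_zero, mul_zero]
    refine ⟨fun h => absurd h (not_le.2 hs), fun h => ?_⟩
    exact absurd (h.2.trans (halfWidth_le hRt hd0 hwl hNt hs.le)) hw

theorem distY_sq (p : Params) (r β : ℝ) :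
    r ^ 2 + p.d ^ 2 - 2 * r * p.d * Real.cos β =
      (r - p.d * Real.cos β) ^ 2 + (p.d * Real.sin β) ^ 2 := by
  have := Real.sin_sq_add_cos_sq β
  linear_combination (-p.d ^ 2) * this

theorem distY_pos {p : Params} (hd : 0 < p.d) {r β : ℝ} (hβ : β ∈ Ioo 0 Real.pi) :
    0 < distY p r β := by
  rw [distY, distY_sq]
  have := Real.sin_pos_of_mem_Ioo hβ
  positivity

/-- The left side is the abscissa, along the ray of angle `β`, of the last point at distance `Rt`
from the typical receiver. If the ray misses the disc, the root is read as 0 and the conclusion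
persists. The sign of `r` is arbitrary. -/
theorem lt_distY {p : Params} (hRt : 0 < p.Rt) {r β : ℝ}
    (h : p.Rt * √(1 - (p.d * Real.sin β / p.Rt) ^ 2) + p.d * Real.cos β < r) :
    p.Rt < distY p r β := by
  rw [distY, Real.lt_sqrt hRt.le, distY_sq]
  have h1 : 1 - (p.d * Real.sin β / p.Rt) ^ 2 ≤ √(1 - (p.d * Real.sin β / p.Rt) ^ 2) ^ 2 := by
    rcases le_total 0 (1 - (p.d * Real.sin β / p.Rt) ^ 2) with h0 | h0
    · rw [Real.sq_sqrt h0]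
    · exact h0.trans (sq_nonneg _)
  have h2 : 0 ≤ p.Rt * √(1 - (p.d * Real.sin β / p.Rt) ^ 2) := by positivity
  have h3 : (p.Rt * √(1 - (p.d * Real.sin β / p.Rt) ^ 2)) ^ 2 < (r - p.d * Real.cos β) ^ 2 :=
    pow_lt_pow_left₀ (by linarith) h2 two_ne_zero
  have h4 : p.Rt ^ 2 * (1 - (p.d * Real.sin β / p.Rt) ^ 2) =
      p.Rt ^ 2 - (p.d * Real.sin β) ^ 2 := by
    field_simp
  rw [mul_pow] at h3
  have h5 := mul_le_mul_of_nonneg_left h1 (sq_nonneg p.Rt)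
  linarith

/-- From a transmitter in the open upper half-plane the typical receiver is seen in a downward
direction. This fixes the sign in front of `arccos`, and is why `β` is restricted to `(0, π)`. -/
theorem sub_polar {p : Params} (hd : 0 < p.d) {r β : ℝ} (hr : 0 < r) (hβ : β ∈ Ioo 0 Real.pi) :
    (p.d : ℂ) - r * dir β =
      (distY p r β : ℂ) * dir (-Real.arccos ((p.d - r * Real.cos β) / distY p r β)) := by
  have hs := distY_pos (r := r) hd hβ
  have hsin := Real.sin_pos_of_mem_Ioo hβ
  have hsq : distY p r β ^ 2 = r ^ 2 + p.d ^ 2 - 2 * r * p.d * Real.cos β := by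
    rw [distY, Real.sq_sqrt]
    rw [distY_sq]
    positivity
  have hsum : (p.d - r * Real.cos β) ^ 2 + (r * Real.sin β) ^ 2 = distY p r β ^ 2 := by
    rw [hsq]
    linear_combination r ^ 2 * Real.sin_sq_add_cos_sq β
  have habs : |(p.d - r * Real.cos β) / distY p r β| ≤ 1 := by
    rw [abs_div, abs_of_pos hs, div_le_one hs]
    exact abs_le_of_sq_le_sq (by nlinarith [sq_nonneg (r * Real.sin β)]) hs.le
  have h1 : 1 - ((p.d - r * Real.cos β) / distY p r β) ^ 2 =
      (r * Real.sin β / distY p r β) ^ 2 := by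
    field_simp
    linarith
  apply Complex.ext
  · rw [Complex.sub_re, Complex.re_ofReal_mul, Complex.re_ofReal_mul, re_dir, re_dir,
      Real.cos_neg, Real.cos_arccos (abs_le.1 habs).1 (abs_le.1 habs).2, Complex.ofReal_re]
    field_simp
  · rw [Complex.sub_im, Complex.im_ofReal_mul, Complex.im_ofReal_mul, im_dir, im_dir,
      Real.sin_neg, Real.sin_arccos, h1, Real.sqrt_sq (by positivity), Complex.ofReal_im]
    field_simp
    ring

theorem receiver_sub (p : Params) (u : ℂ) (φ : ℝ) : receiver p u φ - u = p.d * dir φ := by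
  rw [receiver, add_sub_cancel_left]

theorem mem_pairRegionT_polar_iff {p : Params} (hd : 0 < p.d) (hRt : 0 < p.Rt) (hd0 : 0 < p.d0)
    (hwl : 0 < p.wl) (hNt : 0 < p.Nt) {r β ψ : ℝ} (hr : 0 < r) (hβ : β ∈ Ioo 0 Real.pi)
    (hψ : |ψ| ≤ Real.pi) :
    (p.d : ℂ) ∈ pairRegionT p
      (r * dir β, ψ - Real.arccos ((p.d - r * Real.cos β) / distY p r β)) ↔
      distY p r β ≤ p.Rt ∧ |ψ| ≤ halfWidth p (distY p r β) := by
  have hs := distY_pos (r := r) hd hβ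
  rw [← le_mul_sqrt_gainT_iff hRt hd0 hwl hNt hs]
  simp only [pairRegionT, regionT, mem_ofPred_eq, receiver_sub]
  rw [sub_polar hd hr hβ, angle_smul_dir hs hd]
  rw [norm_mul, norm_dir, mul_one, Complex.norm_real, Real.norm_of_nonneg hs.le]
  rw [sub_neg_eq_add, sub_add_cancel, foldAngle_of_abs_le hψ]

/-! ### Periodic functions -/

/-- Half-open intervals of length `2π` are fundamental domains of the same group of translations. -/
theorem setLIntegral_Icc_eq_Ioc_of_periodic {G : ℝ → ℝ≥0∞}
    (hG : ∀ φ, G (φ + 2 * Real.pi) = G φ) (t : ℝ) :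
    ∫⁻ φ in Icc 0 (2 * Real.pi), G φ = ∫⁻ φ in Ioc t (t + 2 * Real.pi), G φ := by
  have hpos : 0 < 2 * Real.pi := by positivity
  rw [setLIntegral_congr Ioc_ae_eq_Icc.symm]
  have h0 := isAddFundamentalDomain_Ioc hpos 0
  have ht := isAddFundamentalDomain_Ioc hpos t
  have h1 : ∫⁻ φ in Ioc 0 (0 + 2 * Real.pi), G φ = ∫⁻ φ in Ioc t (t + 2 * Real.pi), G φ := by
    refine h0.setLIntegral_eq ht G ?_
    rintro ⟨g, hg⟩ φ
    obtain ⟨n, rfl⟩ := AddSubgroup.mem_zmultiples_iff.1 hg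
    have hp : Function.Periodic G (2 * Real.pi) := hG
    have := hp.zsmul n φ
    rw [add_comm] at this
    exact this
  rwa [zero_add] at h1

theorem setLIntegral_comp_neg (G : ℝ → ℝ≥0∞) (s : Set ℝ) :
    ∫⁻ x in (fun x => -x) ⁻¹' s, G (-x) = ∫⁻ x in s, G x :=
  (Measure.measurePreserving_neg volume).setLIntegral_comp_preimage_emb
    (Homeomorph.neg ℝ).measurableEmbedding G s

theorem setLIntegral_comp_sub (G : ℝ → ℝ≥0∞) (a : ℝ) (s : Set ℝ) :
    ∫⁻ x in (fun x => x - a) ⁻¹' s, G (x - a) = ∫⁻ x in s, G x :=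
  (measurePreserving_sub_right volume a).setLIntegral_comp_preimage_emb
    (Homeomorph.subRight a).measurableEmbedding G s

theorem setLIntegral_Icc_comp_neg_of_periodic {G : ℝ → ℝ≥0∞}
    (hG : ∀ φ, G (φ + 2 * Real.pi) = G φ) :
    ∫⁻ φ in Icc 0 (2 * Real.pi), G (-φ) = ∫⁻ φ in Icc 0 (2 * Real.pi), G φ := by
  have h := setLIntegral_comp_neg G (Icc (-(2 * Real.pi)) 0)
  have hpre : (fun x : ℝ => -x) ⁻¹' Icc (-(2 * Real.pi)) 0 = Icc 0 (2 * Real.pi) := by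
    ext x
    simp
  rw [hpre] at h
  rw [h, setLIntegral_Icc_eq_Ioc_of_periodic hG (-(2 * Real.pi)), neg_add_cancel,
    setLIntegral_congr Ioc_ae_eq_Icc]

theorem setLIntegral_Icc_comp_sub_of_periodic {G : ℝ → ℝ≥0∞}
    (hG : ∀ φ, G (φ + 2 * Real.pi) = G φ) (a t : ℝ) :
    ∫⁻ φ in Icc 0 (2 * Real.pi), G φ = ∫⁻ φ in Ioc t (t + 2 * Real.pi), G (φ - a) := by
  rw [setLIntegral_Icc_eq_Ioc_of_periodic hG (t - a), ← setLIntegral_comp_sub G a]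
  congr 2
  ext x
  simp only [mem_preimage, mem_Ioc]
  constructor <;> rintro ⟨h1, h2⟩ <;> constructor <;> linarith

/-! ### The triple integral as a Lebesgue integral -/

/-- Properties of the kernels, as functions of the position and the orientation of the second
pair, that make the passage to polar coordinates possible. -/
structure IsPairKernel (κ : ℂ → ℝ → ℝ) : Prop where
  measurable : Measurable (Function.uncurry κ)
  nonneg : ∀ u φ, 0 ≤ κ u φ
  le_two : ∀ u φ, κ u φ ≤ 2
  periodic : ∀ u φ, κ u (φ + 2 * Real.pi) = κ u φ
  reflect : ∀ u φ, κ ((starRingEnd ℂ) u) (-φ) = κ u φ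

open scoped Classical in
/-- The kernel on the event that the typical receiver is in the RTS exclusion region of the
second pair. -/
noncomputable def hiddenKernel (p : Params) (κ : ℂ → ℝ → ℝ) (u : ℂ) (φ : ℝ) : ℝ≥0∞ :=
  if (p.d : ℂ) ∈ pairRegionT p (u, φ) then ENNReal.ofReal (κ u φ) else 0

/-- Integral of the hidden kernel over the orientations. -/
noncomputable def hiddenMass (p : Params) (κ : ℂ → ℝ → ℝ) (u : ℂ) : ℝ≥0∞ :=
  ∫⁻ φ in Icc 0 (2 * Real.pi), hiddenKernel p κ u φ

variable {p : Params} {κ : ℂ → ℝ → ℝ}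

theorem measurable_hiddenKernel (hκ : IsPairKernel κ) :
    Measurable (Function.uncurry (hiddenKernel p κ)) := by
  classical
  have hm : MeasurableSet {q : ℂ × ℝ | (p.d : ℂ) ∈ pairRegionT p (q.1, q.2)} :=
    measurable_prodMk_right (y := (p.d : ℂ)) (measurableSet_mem_pairRegionT p)
  exact Measurable.ite hm hκ.measurable.ennreal_ofReal measurable_const

theorem measurable_hiddenMass (hκ : IsPairKernel κ) : Measurable (hiddenMass p κ) :=
  (measurable_hiddenKernel hκ).lintegral_prod_right'

theorem hiddenKernel_add_two_pi (hκ : IsPairKernel κ) (u : ℂ) (φ : ℝ) :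
    hiddenKernel p κ u (φ + 2 * Real.pi) = hiddenKernel p κ u φ := by
  rw [hiddenKernel, hiddenKernel, pairRegionT_add_two_pi, hκ.periodic]

theorem hiddenKernel_le_two (hκ : IsPairKernel κ) (u : ℂ) (φ : ℝ) : hiddenKernel p κ u φ ≤ 2 := by
  unfold hiddenKernel
  split_ifs
  · exact ENNReal.ofReal_le_ofNat.2 (hκ.le_two u φ)
  · exact zero_le

theorem hiddenMass_le (hκ : IsPairKernel κ) (u : ℂ) :
    hiddenMass p κ u ≤ 2 * ENNReal.ofReal (2 * Real.pi) := by
  calc hiddenMass p κ u ≤ ∫⁻ φ in Icc 0 (2 * Real.pi), 2 :=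
        lintegral_mono fun φ => hiddenKernel_le_two hκ u φ
    _ = 2 * ENNReal.ofReal (2 * Real.pi) := by simp

theorem hiddenMass_ne_top (hκ : IsPairKernel κ) (u : ℂ) : hiddenMass p κ u ≠ ∞ :=
  ne_top_of_le_ne_top (by finiteness) (hiddenMass_le hκ u)

theorem hiddenMass_conj (hκ : IsPairKernel κ) (u : ℂ) :
    hiddenMass p κ ((starRingEnd ℂ) u) = hiddenMass p κ u := by
  classical
  have h : ∀ φ, hiddenKernel p κ ((starRingEnd ℂ) u) φ = hiddenKernel p κ u (-φ) := by
    intro φ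
    have h1 := hκ.reflect u (-φ)
    rw [neg_neg] at h1
    have h2 := mem_pairRegionT_reflect p (u, -φ) p.d
    simp only [reflect, neg_neg, Complex.conj_ofReal] at h2
    rw [hiddenKernel, hiddenKernel, h1]
    exact if_congr h2 rfl rfl
  simp only [hiddenMass, h]
  exact setLIntegral_Icc_comp_neg_of_periodic (hiddenKernel_add_two_pi hκ u)

/-- Orientations are measured from the direction of the typical receiver, over the period `(-π, π]`.
By `hbeam` the angular window fits into this single period. -/
theorem hiddenMass_polar (hκ : IsPairKernel κ) (hd : 0 < p.d) (hRt : 0 < p.Rt) (hd0 : 0 < p.d0)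
    (hwl : 0 < p.wl) (hNt : 0 < p.Nt) (hbeam : p.wl / (p.d0 * p.Nt) ≤ Real.pi) {r β : ℝ}
    (hr : 0 < r) (hβ : β ∈ Ioo 0 Real.pi) :
    hiddenMass p κ (r * dir β) =
      ∫⁻ ψ in Ioc (-halfWidth p (distY p r β)) (halfWidth p (distY p r β)), ENNReal.ofReal
        (κ (r * dir β) (ψ - Real.arccos ((p.d - r * Real.cos β) / distY p r β))) := by
  classical
  set a := Real.arccos ((p.d - r * Real.cos β) / distY p r β) with ha
  set f := halfWidth p (distY p r β) with hf
  have hfle : f ≤ Real.pi := (halfWidth_le hRt hd0 hwl hNt (distY_pos hd hβ).le).trans hbeam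
  have hf0 : 0 ≤ f := halfWidth_nonneg hd0 hwl _
  rw [hiddenMass, setLIntegral_Icc_comp_sub_of_periodic (hiddenKernel_add_two_pi hκ _) a
    (-Real.pi), show -Real.pi + 2 * Real.pi = Real.pi by ring]
  rw [← lintegral_indicator measurableSet_Ioc, ← lintegral_indicator measurableSet_Ioc]
  refine lintegral_congr_ae ?_
  -- The beam is closed while the interval omits `-f`; the difference is a null set.
  have h1 : ∀ᵐ ψ : ℝ, ψ ≠ -f := by simp [ae_iff]
  have h2 : ∀ᵐ ψ : ℝ, ψ ≠ 0 := by simp [ae_iff]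
  filter_upwards [h1, h2] with ψ hψ hψ0
  by_cases hmem : ψ ∈ Ioc (-Real.pi) Real.pi
  · rw [indicator_of_mem hmem, hiddenKernel]
    have hiff := mem_pairRegionT_polar_iff hd hRt hd0 hwl hNt hr hβ
      (abs_le.2 ⟨hmem.1.le, hmem.2⟩)
    rw [← ha] at hiff
    have hiff' : ψ ∈ Ioc (-f) f ↔ distY p r β ≤ p.Rt ∧ |ψ| ≤ f := by
      constructor
      · intro h
        refine ⟨?_, abs_le.2 ⟨h.1.le, h.2⟩⟩
        by_contra hlt
        rw [not_le] at hlt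
        rw [hf, halfWidth_eq_zero hRt hlt.le] at h
        exact absurd h.2 (not_le.2 (by simpa using h.1))
      · rintro ⟨-, h⟩
        exact ⟨lt_of_le_of_ne (abs_le.1 h).1 hψ.symm, (abs_le.1 h).2⟩
    rw [indicator_apply]
    simp only [hiff, hiff']
    rfl
  · rw [indicator_of_notMem hmem, indicator_of_notMem]
    intro h
    exact hmem ⟨by linarith [h.1], h.2.trans hfle⟩

theorem hiddenMass_eq_zero (hRt : 0 < p.Rt) {u : ℂ}
    (h : p.Rt < ‖(p.d : ℂ) - u‖) : hiddenMass p κ u = 0 := by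
  rw [hiddenMass, ← lintegral_zero]
  refine lintegral_congr fun φ => if_neg fun hm => ?_
  exact absurd (norm_sub_le_of_mem_pairRegionT hRt hm) (not_le.2 h)

/-- Radial integral of the hidden mass. -/
noncomputable def radialMass (p : Params) (κ : ℂ → ℝ → ℝ) (β : ℝ) : ℝ≥0∞ :=
  ∫⁻ r in Ioi 0, ENNReal.ofReal r * hiddenMass p κ (r * dir β)

theorem measurable_polar_hiddenMass (hκ : IsPairKernel κ) :
    Measurable fun q : ℝ × ℝ => ENNReal.ofReal q.2 * hiddenMass p κ (q.2 * dir q.1) := by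
  refine (ENNReal.measurable_ofReal.comp measurable_snd).mul ((measurable_hiddenMass hκ).comp ?_)
  exact (Complex.measurable_ofReal.comp measurable_snd).mul (measurable_dir.comp measurable_fst)

theorem measurable_radialMass (hκ : IsPairKernel κ) : Measurable (radialMass p κ) :=
  (measurable_polar_hiddenMass hκ).lintegral_prod_right'

theorem radialMass_le (hκ : IsPairKernel κ) (hd : 0 < p.d) (hRt : 0 < p.Rt) (β : ℝ) :
    radialMass p κ β ≤ ENNReal.ofReal (p.Rt + p.d) * (2 * ENNReal.ofReal (2 * Real.pi)) *
      ENNReal.ofReal (p.Rt + p.d) := by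
  have h : ∀ r ∈ Ioi (0 : ℝ), ENNReal.ofReal r * hiddenMass p κ (r * dir β) ≤
      (Ioc 0 (p.Rt + p.d)).indicator
        (fun _ => ENNReal.ofReal (p.Rt + p.d) * (2 * ENNReal.ofReal (2 * Real.pi))) r := by
    intro r hr
    by_cases hr' : r ≤ p.Rt + p.d
    · rw [indicator_of_mem (show r ∈ Ioc 0 (p.Rt + p.d) from ⟨hr, hr'⟩)]
      exact mul_le_mul' (ENNReal.ofReal_le_ofReal hr') (hiddenMass_le hκ _)
    · rw [hiddenMass_eq_zero hRt, mul_zero]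
      · exact zero_le
      · have h1 := norm_sub_norm_le ((r : ℂ) * dir β) p.d
        rw [norm_mul, norm_dir, mul_one, Complex.norm_real, Complex.norm_real,
          Real.norm_of_nonneg (le_of_lt hr), Real.norm_of_nonneg hd.le, norm_sub_rev] at h1
        linarith
  calc radialMass p κ β ≤ ∫⁻ r in Ioi 0, (Ioc 0 (p.Rt + p.d)).indicator
        (fun _ => ENNReal.ofReal (p.Rt + p.d) * (2 * ENNReal.ofReal (2 * Real.pi))) r :=
        setLIntegral_mono' measurableSet_Ioi h
    _ ≤ ∫⁻ r, (Ioc 0 (p.Rt + p.d)).indicator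
        (fun _ => ENNReal.ofReal (p.Rt + p.d) * (2 * ENNReal.ofReal (2 * Real.pi))) r :=
        setLIntegral_le_lintegral _ _
    _ = _ := by
      rw [lintegral_indicator measurableSet_Ioc, setLIntegral_const, Real.volume_Ioc, sub_zero]

theorem radialMass_neg (hκ : IsPairKernel κ) (β : ℝ) :
    radialMass p κ (-β) = radialMass p κ β := by
  unfold radialMass
  refine lintegral_congr fun r => ?_
  rw [← hiddenMass_conj hκ (r * dir β), map_mul, Complex.conj_ofReal, conj_dir]

/-- Polar coordinates, followed by the symmetry `β ↦ -β`, which comes from reflecting the second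
pair in the axis of the typical one. -/
theorem lintegral_hiddenMass_eq (hκ : IsPairKernel κ) :
    ∫⁻ u, hiddenMass p κ u = 2 * ∫⁻ β in Ioo 0 Real.pi, radialMass p κ β := by
  rw [← Complex.lintegral_comp_polarCoord_symm, polarCoord_target, Measure.volume_eq_prod,
    ← Measure.prod_restrict]
  have h1 : ∀ q : ℝ × ℝ, ENNReal.ofReal q.1 • hiddenMass p κ (Complex.polarCoord.symm q) =
      ENNReal.ofReal q.1 * hiddenMass p κ (q.1 * dir q.2) := by
    intro q
    rw [Complex.polarCoord_symm_apply, dir_eq_cos_sin, smul_eq_mul]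
  have hm : Measurable fun q : ℝ × ℝ => ENNReal.ofReal q.1 * hiddenMass p κ (q.1 * dir q.2) :=
    (measurable_polar_hiddenMass hκ).comp measurable_swap
  rw [lintegral_congr h1, lintegral_prod_symm _ hm.aemeasurable]
  change ∫⁻ β in Ioo (-Real.pi) Real.pi, radialMass p κ β = _
  have hpi := Real.pi_pos
  have hU : Ioo (-Real.pi) Real.pi = Ioc (-Real.pi) 0 ∪ Ioo 0 Real.pi :=
    (Ioc_union_Ioo_eq_Ioo (by linarith) hpi).symm
  rw [hU, lintegral_union measurableSet_Ioo, two_mul]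
  · congr 1
    rw [setLIntegral_congr Ioo_ae_eq_Ioc.symm, ← setLIntegral_comp_neg]
    simp only [radialMass_neg hκ]
    congr 2
    ext x
    simp only [mem_preimage, mem_Ioo]
    constructor <;> rintro ⟨h1, h2⟩ <;> constructor <;> linarith
  · exact disjoint_left.2 fun x hx hx' => absurd hx'.1 (not_lt.2 hx.2)

/-! ### Iterated interval integrals of the kernel -/

section

variable {k : ℝ → ℝ → ℝ → ℝ}

theorem innerIntegral_eq (hκ : IsPairKernel κ)
    (hk : ∀ r β φ, 0 < r → k r β φ = κ (r * dir β) φ) (hd : 0 < p.d) (hRt : 0 < p.Rt)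
    (hd0 : 0 < p.d0) (hwl : 0 < p.wl) (hNt : 0 < p.Nt) (hbeam : p.wl / (p.d0 * p.Nt) ≤ Real.pi)
    {r β : ℝ} (hr : 0 < r) (hβ : β ∈ Ioo 0 Real.pi) :
    ∫ θ in (-halfWidth p (distY p r β))..(halfWidth p (distY p r β)),
      k r β (θ - Real.arccos ((p.d - r * Real.cos β) / distY p r β)) * r =
      (ENNReal.ofReal r * hiddenMass p κ (r * dir β)).toReal := by
  rw [intervalIntegral.integral_mul_const, ENNReal.toReal_mul, ENNReal.toReal_ofReal hr.le,
    mul_comm, hiddenMass_polar hκ hd hRt hd0 hwl hNt hbeam hr hβ]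
  congr 1
  have hf0 : 0 ≤ halfWidth p (distY p r β) := halfWidth_nonneg hd0 hwl _
  rw [intervalIntegral.integral_of_le (by linarith)]
  simp only [hk _ _ _ hr]
  refine integral_eq_lintegral_of_nonneg_ae (Filter.Eventually.of_forall fun θ => hκ.nonneg _ _) ?_
  refine Measurable.aestronglyMeasurable ?_
  have : Measurable fun θ : ℝ => ((r : ℂ) * dir β,
      θ - Real.arccos ((p.d - r * Real.cos β) / distY p r β)) := by fun_prop
  exact hκ.measurable.comp this

theorem radialIntegral_eq (hκ : IsPairKernel κ)
    (hk : ∀ r β φ, 0 < r → k r β φ = κ (r * dir β) φ) (hd : 0 < p.d) (hRt : 0 < p.Rt)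
    (hd0 : 0 < p.d0) (hwl : 0 < p.wl) (hNt : 0 < p.Nt) (hbeam : p.wl / (p.d0 * p.Nt) ≤ Real.pi)
    {β : ℝ} (hβ : β ∈ Ioo 0 Real.pi) :
    ∫ r in (0 : ℝ)..(p.Rt * √(1 - (p.d * Real.sin β / p.Rt) ^ 2) + p.d * Real.cos β),
      ∫ θ in (-halfWidth p (distY p r β))..(halfWidth p (distY p r β)),
        k r β (θ - Real.arccos ((p.d - r * Real.cos β) / distY p r β)) * r =
      (radialMass p κ β).toReal := by
  set U := p.Rt * √(1 - (p.d * Real.sin β / p.Rt) ^ 2) + p.d * Real.cos β with hU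
  have hzero : ∀ r, 0 < r → U < r → hiddenMass p κ (r * dir β) = 0 := by
    intro r hr hUr
    refine hiddenMass_eq_zero hRt ?_
    rw [sub_polar hd hr hβ, norm_mul, norm_dir, mul_one, Complex.norm_real,
      Real.norm_of_nonneg (distY_pos hd hβ).le]
    exact lt_distY hRt hUr
  have hsec : Measurable fun r : ℝ => ENNReal.ofReal r * hiddenMass p κ (r * dir β) :=
    (measurable_polar_hiddenMass hκ).comp measurable_prodMk_left
  rcases le_or_gt 0 U with h0 | h0
  · rw [intervalIntegral.integral_of_le h0, radialMass, ← Ioc_union_Ioi_eq_Ioi h0,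
      lintegral_union measurableSet_Ioi
        (disjoint_left.2 fun x hx hx' => absurd hx' (not_lt.2 hx.2)),
      setLIntegral_congr_fun (g := fun _ => 0) measurableSet_Ioi
        fun r hr => by
          dsimp only
          rw [hzero r (lt_of_le_of_lt h0 hr) hr, mul_zero],
      lintegral_zero, add_zero, ← integral_toReal hsec.aemeasurable]
    · refine setIntegral_congr_fun measurableSet_Ioc fun r hr => ?_
      exact innerIntegral_eq hκ hk hd hRt hd0 hwl hNt hbeam hr.1 hβ
    · exact Filter.Eventually.of_forall fun r =>
        ENNReal.mul_lt_top ENNReal.ofReal_lt_top (hiddenMass_ne_top hκ _).lt_top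
  -- A negative upper limit makes the interval integral run backwards over `(U, 0]`. There the
  -- distance to the receiver still exceeds `Rt`, so the angular window is degenerate and both sides
  -- vanish.
  · have hl : radialMass p κ β = 0 := by
      rw [radialMass, setLIntegral_congr_fun (g := fun _ => 0) measurableSet_Ioi
        fun r hr => by
          dsimp only
          rw [hzero r hr (h0.trans hr), mul_zero], lintegral_zero]
    rw [hl, ENNReal.toReal_zero, intervalIntegral.integral_of_ge h0.le, neg_eq_zero]
    refine setIntegral_eq_zero_of_forall_eq_zero fun r hr => ?_
    rw [halfWidth_eq_zero hRt (lt_distY hRt hr.1).le, neg_zero, intervalIntegral.integral_same]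

theorem lintegral_hiddenMass_toReal (hκ : IsPairKernel κ)
    (hk : ∀ r β φ, 0 < r → k r β φ = κ (r * dir β) φ) (hd : 0 < p.d) (hRt : 0 < p.Rt)
    (hd0 : 0 < p.d0) (hwl : 0 < p.wl) (hNt : 0 < p.Nt) (hbeam : p.wl / (p.d0 * p.Nt) ≤ Real.pi) :
    ∫⁻ u, hiddenMass p κ u ≠ ∞ ∧
      (∫⁻ u, hiddenMass p κ u).toReal = 2 * hiddenIntegral p k := by
  rw [lintegral_hiddenMass_eq hκ]
  have hlt : ∀ β, radialMass p κ β < ∞ := fun β =>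
    (radialMass_le hκ hd hRt β).trans_lt (by finiteness)
  constructor
  · refine ENNReal.mul_ne_top ENNReal.ofNat_ne_top (ne_of_lt ?_)
    refine (setLIntegral_mono (s := Ioo 0 Real.pi) measurable_const
      fun β _ => radialMass_le hκ hd hRt β).trans_lt ?_
    rw [setLIntegral_const, Real.volume_Ioo]
    finiteness
  · rw [ENNReal.toReal_mul, ENNReal.toReal_ofNat, hiddenIntegral,
      intervalIntegral.integral_of_le Real.pi_pos.le, integral_Ioc_eq_integral_Ioo,
      ← integral_toReal (measurable_radialMass hκ).aemeasurable
        (Filter.Eventually.of_forall hlt)]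
    congr 1
    refine setIntegral_congr_fun measurableSet_Ioo fun β hβ => ?_
    exact (radialIntegral_eq hκ hk hd hRt hd0 hwl hNt hbeam hβ).symm

end

end GHCP

namespace GHCP

/-! ### Retained points of a Poisson sample -/

section Retained

variable {Ω E : Type*} [MeasurableSpace Ω] [MeasurableSpace E] {μ : Measure Ω} {e : ℕ → Ω → E}
  {W : Set E} {ν : Measure E} [IsFiniteMeasure ν] {R : E → E → Prop}

/-- Indices of the points that are not blocked, in the sense of the relation `R`, by any other
point. -/
def retained (R : E → E → Prop) (e : ℕ → Ω → E) (ω : Ω) : Set ℕ :=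
  {i | ∀ k, k ≠ i → ¬R (e i ω) (e k ω)}

/-- The last hypothesis excludes edge effects: points outside `W` cannot block a point of `Q`, so
retention can be decided within `W`. -/
theorem IsPoissonOn.lintegral_retained (h : IsPoissonOn μ e W ν)
    (hR : MeasurableSet {q : E × E | R q.1 q.2}) {Q : Set E} (hQ : MeasurableSet Q) (hQW : Q ⊆ W)
    (hRW : ∀ x ∈ Q, ∀ z, R x z → z ∈ W) :
    ∫⁻ ω, ((retained R e ω ∩ {i | e i ω ∈ Q}).encard : ℝ≥0∞) ∂μ =
      ∫⁻ x in Q, ENNReal.ofReal (Real.exp (-ν.real {z | R x z})) ∂ν := by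
  classical
  have key := h.mecke hR (g := Q.indicator 1) (measurable_one.indicator hQ)
  calc _ = _ := ?_
    _ = _ := key
    _ = _ := ?_
  · refine lintegral_congr fun ω => ?_
    rw [← tsum_encard]
    refine tsum_congr fun i => ?_
    simp only [mem_inter_iff, mem_ofPred_eq, retained, indicator_apply, Pi.one_apply, ← ite_and]
    refine if_congr ?_ rfl rfl
    constructor
    · rintro ⟨h1, h2⟩
      exact ⟨⟨hQW h2, fun k hk _ => h1 k hk⟩, h2⟩
    · rintro ⟨⟨h1, h2⟩, h3⟩
      exact ⟨fun k hk hRk => h2 k hk (hRW _ h3 _ hRk) hRk, h3⟩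
  · rw [← lintegral_indicator hQ]
    refine lintegral_congr fun x => ?_
    by_cases hx : x ∈ Q <;> simp [hx]

-- Two points are both retained iff neither blocks the other and no third point blocks either. The
-- first condition goes into the integrand `g` of the Mecke formula, the second into its set `B`.
open scoped Classical in
theorem IsPoissonOn.lintegral_retained_pairs (h : IsPoissonOn μ e W ν)
    (hR : MeasurableSet {q : E × E | R q.1 q.2}) {D : Set (E × E)} (hD : MeasurableSet D)
    (hDW : ∀ x x', (x, x') ∈ D → x ∈ W ∧ x' ∈ W ∧ ∀ z, R x z ∨ R x' z → z ∈ W) :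
    ∫⁻ ω, ∑' i, ∑' j, (if i ≠ j ∧ i ∈ retained R e ω ∧ j ∈ retained R e ω ∧
        (e i ω, e j ω) ∈ D then 1 else 0) ∂μ =
      ∫⁻ x, ∫⁻ x', (if (x, x') ∈ D ∧ ¬R x x' ∧ ¬R x' x then
        ENNReal.ofReal (Real.exp (-ν.real {z | R x z ∨ R x' z})) else 0) ∂ν ∂ν := by
  have hB : MeasurableSet {q : E × E × E | R q.1 q.2.2 ∨ R q.2.1 q.2.2} := by
    have m1 : Measurable fun q : E × E × E => (q.1, q.2.2) := by fun_prop
    have m2 : Measurable fun q : E × E × E => (q.2.1, q.2.2) := by fun_prop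
    exact (m1 hR).union (m2 hR)
  have hg : Measurable (Function.uncurry fun x x' : E =>
      if (x, x') ∈ D ∧ ¬R x x' ∧ ¬R x' x then (1 : ℝ≥0∞) else 0) := by
    refine Measurable.ite ?_ measurable_const measurable_const
    have m2 : Measurable fun q : E × E => (q.2, q.1) := by fun_prop
    exact hD.inter (hR.compl.inter (m2 hR).compl)
  have key := h.mecke_pairs hB hg
  calc _ = _ := ?_
    _ = _ := key
    _ = _ := ?_
  · refine lintegral_congr fun ω => tsum_congr fun i => tsum_congr fun j => ?_
    rw [← ite_and]
    refine if_congr ?_ rfl rfl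
    simp only [retained, mem_ofPred_eq]
    constructor
    · rintro ⟨hij, hi, hj, hd⟩
      obtain ⟨h1, h2, -⟩ := hDW _ _ hd
      refine ⟨⟨hij, h1, h2, fun k hki hkj _ hk => ?_⟩, hd, hi j hij.symm, hj i hij⟩
      rcases hk with hk | hk
      · exact hi k hki hk
      · exact hj k hkj hk
    · rintro ⟨⟨hij, h1, h2, h3⟩, hd, hi, hj⟩
      obtain ⟨-, -, h4⟩ := hDW _ _ hd
      refine ⟨hij, fun k hk hRk => ?_, fun k hk hRk => ?_, hd⟩
      · by_cases hkj : k = j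
        · exact hi (hkj ▸ hRk)
        · exact h3 k hk hkj (h4 _ (Or.inl hRk)) (Or.inl hRk)
      · by_cases hki : k = i
        · exact hj (hki ▸ hRk)
        · exact h3 k hki hk (h4 _ (Or.inr hRk)) (Or.inr hRk)
  · refine lintegral_congr fun x => lintegral_congr fun x' => ?_
    rw [ite_mul, one_mul, zero_mul]
    rfl

/-- The expected number of coinciding couples is the mass of the diagonal under the square of a
diffuse measure. Simplicity is needed because configurations are sets and would not count a repeated
point twice. -/
theorem IsPoissonOn.ae_injOn [MeasurableSingletonClass E] [MeasurableEq E] [NullSingletonClass ν]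
    (h : IsPoissonOn μ e W ν) : ∀ᵐ ω ∂μ, InjOn (fun k => e k ω) {k | e k ω ∈ W} := by
  classical
  have hdiag : MeasurableSet {q : E × E | q.1 = q.2} := measurableSet_diagonal
  have key := h.mecke_pairs (B := ∅) MeasurableSet.empty
    (g := fun x x' => if x = x' then 1 else 0)
    (Measurable.ite hdiag measurable_const measurable_const)
  have hz : ∀ x, ∫⁻ x', (if x = x' then (1 : ℝ≥0∞) else 0) *
      ENNReal.ofReal (Real.exp (-ν.real {z | (x, x', z) ∈ (∅ : Set (E × E × E))})) ∂ν = 0 := by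
    intro x
    have : ∀ x', (if x = x' then (1 : ℝ≥0∞) else 0) *
        ENNReal.ofReal (Real.exp (-ν.real {z | (x, x', z) ∈ (∅ : Set (E × E × E))})) =
        ({x} : Set E).indicator 1 x' := by
      intro x'
      simp [indicator_apply, eq_comm]
    rw [lintegral_congr this, lintegral_indicator_one (measurableSet_singleton x),
      measure_singleton]
  rw [lintegral_congr hz, lintegral_zero] at key
  have hpair : ∀ i j, i ≠ j → ∀ᵐ ω ∂μ, ¬(e i ω ∈ W ∧ e j ω ∈ W ∧ e i ω = e j ω) := by
    intro i j hij
    rw [ae_iff]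
    simp only [not_not]
    have hms : MeasurableSet {ω | e i ω ∈ W ∧ e j ω ∈ W ∧ e i ω = e j ω} :=
      (h.measurable i h.measurableSet).inter ((h.measurable j h.measurableSet).inter
        (((h.measurable i).prodMk (h.measurable j)) hdiag))
    rw [← lintegral_indicator_one hms, ← nonpos_iff_eq_zero, ← key]
    refine lintegral_mono fun ω => ?_
    refine le_trans ?_ (ENNReal.le_tsum i)
    refine le_trans ?_ (ENNReal.le_tsum j)
    by_cases hω : ω ∈ {ω | e i ω ∈ W ∧ e j ω ∈ W ∧ e i ω = e j ω}
    · rw [indicator_of_mem hω, if_pos ⟨hij, hω.1, hω.2.1, fun _ _ _ _ => notMem_empty _⟩,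
        if_pos hω.2.2]
      rfl
    · rw [indicator_of_notMem hω]
      exact zero_le
  have hall : ∀ᵐ ω ∂μ, ∀ i j, i ≠ j → ¬(e i ω ∈ W ∧ e j ω ∈ W ∧ e i ω = e j ω) := by
    rw [ae_all_iff]
    intro i
    rw [ae_all_iff]
    intro j
    by_cases hij : i = j
    · simp [hij]
    · filter_upwards [hpair i j hij] with ω hω _ using hω
  filter_upwards [hall] with ω hω i hi j hj hij
  by_contra hne
  exact hω i j hne ⟨hi, hj, hij⟩

end Retained

/-! ### The kernels as functions of position and orientation -/

theorem le_mul_sqrt_iff {n R g : ℝ} (hn : 0 ≤ n) (hR : 0 ≤ R) (hg : 0 ≤ g) :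
    n ≤ R * √g ↔ n ^ 2 ≤ R ^ 2 * g := by
  rw [← Real.sqrt_sq hR, ← Real.sqrt_mul (sq_nonneg R), Real.le_sqrt hn, Real.sqrt_sq hR]
  positivity

section Kernels

variable {p : Params}

theorem gainT_nonneg (φ : ℝ) : 0 ≤ gainT p φ := gain_nonneg _ _ _ _

theorem gainR_nonneg (φ : ℝ) : 0 ≤ gainR p φ := gain_nonneg _ _ _ _

theorem norm_mul_dir {r : ℝ} (hr : 0 ≤ r) (β : ℝ) : ‖(r : ℂ) * dir β‖ = r := by
  rw [norm_mul, norm_dir, mul_one, Complex.norm_real, Real.norm_of_nonneg hr]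

theorem neg_mul_dir (r β : ℝ) : -((r : ℂ) * dir β) = r * dir (β + Real.pi) := by
  rw [dir_add, show dir Real.pi = -1 from Complex.exp_pi_mul_I]
  ring

theorem mem_S1_iff (hd : 0 < p.d) (hRt : 0 < p.Rt) {r : ℝ} (hr : 0 < r) (β φ : ℝ) :
    (r, β, φ) ∈ S1 p ↔ (0 : ℂ) ∈ regionT p (r * dir β) (receiver p (r * dir β) φ) := by
  simp only [S1, regionT, mem_ofPred_eq, receiver_sub, zero_sub]
  rw [neg_mul_dir, angle_smul_dir hr hd, norm_mul_dir hr.le,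
    le_mul_sqrt_iff hr.le hRt.le (gainT_nonneg _), sub_sub]

theorem mem_S3_iff (hd : 0 < p.d) (hRt : 0 < p.Rt) {r : ℝ} (hr : 0 < r) (β φ : ℝ) :
    (r, β, φ) ∈ S3 p ↔ (r : ℂ) * dir β ∈ regionT p 0 (receiver p 0 0) := by
  simp only [S3, regionT, mem_ofPred_eq, receiver_sub]
  rw [sub_zero, angle_smul_dir hr hd, norm_mul_dir hr.le,
    le_mul_sqrt_iff hr.le hRt.le (gainT_nonneg _), zero_sub, foldAngle, foldAngle,
    Real.cos_neg]

theorem norm_add_dir_sq (r s α β : ℝ) :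
    ‖(r : ℂ) * dir α + s * dir β‖ ^ 2 = r ^ 2 + 2 * r * s * Real.cos (α - β) + s ^ 2 := by
  rw [← Complex.normSq_eq_norm_sq, Complex.normSq_apply, Complex.add_re, Complex.add_im,
    Complex.re_ofReal_mul, Complex.re_ofReal_mul, Complex.im_ofReal_mul, Complex.im_ofReal_mul,
    re_dir, re_dir, im_dir, im_dir, Real.cos_sub]
  linear_combination r ^ 2 * Real.sin_sq_add_cos_sq α + s ^ 2 * Real.sin_sq_add_cos_sq β

/-- Source of the `arccos` in both `S2` and `S4`, after negating the two vectors issuing from the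
receiver; `S4` uses it with `-r` for `r`. -/
theorem angle_add_dir {s : ℝ} (hs : 0 < s) (r α β : ℝ) :
    InnerProductGeometry.angle ((r : ℂ) * dir α + s * dir β) (s * dir β) =
      Real.arccos ((r * Real.cos (β - α) + s) /
        √(r ^ 2 + 2 * r * s * Real.cos (α - β) + s ^ 2)) := by
  rw [← norm_add_dir_sq, Real.sqrt_sq (norm_nonneg _), InnerProductGeometry.angle,
    norm_mul_dir hs.le]
  have h : inner ℝ ((r : ℂ) * dir α + s * dir β) (s * dir β) =
      (r * Real.cos (β - α) + s) * s := by
    rw [← Complex.real_smul, ← Complex.real_smul, inner_add_left, real_inner_smul_left,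
      real_inner_smul_left, real_inner_smul_right, real_inner_smul_right, inner_dir, inner_dir,
      sub_self, Real.cos_zero]
    ring
  rw [h, mul_div_mul_right _ _ hs.ne']

theorem mem_S2_iff (hd : 0 < p.d) (hRr : 0 < p.Rr) (r β φ : ℝ) :
    (r, β, φ) ∈ S2 p ↔ (0 : ℂ) ∈ regionR p (r * dir β) (receiver p (r * dir β) φ) := by
  simp only [S2, regionR, mem_ofPred_eq, receiver, zero_sub, sub_add_cancel_left]
  rw [InnerProductGeometry.angle_neg_neg, angle_add_dir hd, norm_neg,
    le_mul_sqrt_iff (norm_nonneg _) hRr.le (gainR_nonneg _), norm_add_dir_sq]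

theorem mem_S4_iff (hd : 0 < p.d) (hRr : 0 < p.Rr) (r β φ : ℝ) :
    (r, β, φ) ∈ S4 p ↔ (r : ℂ) * dir β ∈ regionR p 0 (receiver p 0 0) := by
  simp only [S4, regionR, mem_ofPred_eq, receiver, zero_sub, zero_add]
  have h1 : (r : ℂ) * dir β - p.d * dir 0 = -(((-r : ℝ) : ℂ) * dir β + p.d * dir 0) := by
    push_cast
    ring
  rw [h1, InnerProductGeometry.angle_neg_neg, angle_add_dir hd, norm_neg,
    le_mul_sqrt_iff (norm_nonneg _) hRr.le (gainR_nonneg _), norm_add_dir_sq, sub_zero,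
    zero_sub, Real.cos_neg]
  have h2 : (-r) ^ 2 + 2 * -r * p.d * Real.cos β + p.d ^ 2 =
    r ^ 2 - 2 * r * p.d * Real.cos β + p.d ^ 2 := by ring
  have h3 : -r * Real.cos β + p.d = p.d - r * Real.cos β := by ring
  rw [h2, h3]

theorem mem_S1_union_S2_iff (hd : 0 < p.d) (hRt : 0 < p.Rt) (hRr : 0 < p.Rr) {r : ℝ} (hr : 0 < r)
    (β φ : ℝ) : (r, β, φ) ∈ S1 p ∪ S2 p ↔ 0 ∈ pairRegion p (r * dir β, φ) :=
  or_congr (mem_S1_iff hd hRt hr β φ) (mem_S2_iff hd hRr r β φ)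

theorem mem_S3_union_S4_iff (hd : 0 < p.d) (hRt : 0 < p.Rt) (hRr : 0 < p.Rr) {r : ℝ} (hr : 0 < r)
    (β φ : ℝ) : (r, β, φ) ∈ S3 p ∪ S4 p ↔ (r : ℂ) * dir β ∈ pairRegion p (0, 0) :=
  or_congr (mem_S3_iff hd hRt hr β φ) (mem_S4_iff hd hRr r β φ)

open scoped Classical in
/-- The Type I kernel as a function of the position and the orientation of the second pair. -/
noncomputable def pairKernelI (p : Params) (u : ℂ) (φ : ℝ) : ℝ :=
  if 0 ∈ pairRegion p (u, φ) ∨ u ∈ pairRegion p (0, 0) then 0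
  else Real.exp (-(p.lp * unionArea p (u, φ)))

open scoped Classical in
/-- The Type II kernel as a function of the position and the orientation of the second pair. -/
noncomputable def pairKernelII (p : Params) (u : ℂ) (φ : ℝ) : ℝ :=
  ((if 0 ∈ pairRegion p (u, φ) then 0 else 1) + (if u ∈ pairRegion p (0, 0) then 0 else 1)) *
    pFun p (unionArea p (u, φ))

theorem kernelI_eq (hd : 0 < p.d) (hRt : 0 < p.Rt) (hRr : 0 < p.Rr) (r β φ : ℝ) (hr : 0 < r) :
    kernelI p r β φ = pairKernelI p (r * dir β) φ := by
  classical
  rw [kernelI, pairKernelI]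
  refine if_congr ?_ rfl rfl
  exact or_congr (mem_S1_union_S2_iff hd hRt hRr hr β φ) (mem_S3_union_S4_iff hd hRt hRr hr β φ)

/-- The three cases of the kernel are the values 0, 2, 1 of a sum of two indicators, one for each
order of the time marks. -/
theorem kernelII_eq (hd : 0 < p.d) (hRt : 0 < p.Rt) (hRr : 0 < p.Rr) (r β φ : ℝ) (hr : 0 < r) :
    kernelII p r β φ = pairKernelII p (r * dir β) φ := by
  classical
  have h1 := mem_S1_union_S2_iff hd hRt hRr hr β φ
  have h2 := mem_S3_union_S4_iff hd hRt hRr hr β φ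
  have h3 : (r, β, φ) ∈ (S1 p)ᶜ ∩ (S2 p)ᶜ ∩ (S3 p)ᶜ ∩ (S4 p)ᶜ ↔
      0 ∉ pairRegion p (r * dir β, φ) ∧ (r : ℂ) * dir β ∉ pairRegion p (0, 0) := by
    rw [← h1, ← h2]
    simp only [mem_inter_iff, mem_compl_iff, mem_union, not_or, and_assoc]
  have h4 : areaUnion p r β φ = unionArea p (r * dir β, φ) := rfl
  have h5 : (r, β, φ) ∈ (S1 p ∪ S2 p) ∩ (S3 p ∪ S4 p) ↔
      0 ∈ pairRegion p (r * dir β, φ) ∧ (r : ℂ) * dir β ∈ pairRegion p (0, 0) := and_congr h1 h2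
  rw [kernelII, pairKernelII, if_congr h5 rfl (if_congr h3 rfl rfl), h4]
  by_cases ha : 0 ∈ pairRegion p (r * dir β, φ) <;>
  by_cases hb : (r : ℂ) * dir β ∈ pairRegion p (0, 0) <;> simp [ha, hb]
  norm_num

theorem unionArea_add_two_pi (u : ℂ) (φ : ℝ) :
    unionArea p (u, φ + 2 * Real.pi) = unionArea p (u, φ) := by
  rw [unionArea, pairRegion_add_two_pi, unionArea]

theorem unionArea_reflect (a : ℂ × ℝ) : unionArea p (reflect a) = unionArea p a := by
  have := measure_union_reflect p (0, 0) a
  rw [reflect_zero] at this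
  rw [unionArea, measureReal_def, this]
  rfl

theorem zero_mem_reflect (a : ℂ × ℝ) : 0 ∈ pairRegion p (reflect a) ↔ 0 ∈ pairRegion p a := by
  have := mem_pairRegion_reflect p a 0
  rwa [map_zero] at this

theorem conj_mem_pairRegion_zero (u : ℂ) :
    (starRingEnd ℂ) u ∈ pairRegion p (0, 0) ↔ u ∈ pairRegion p (0, 0) := by
  have := mem_pairRegion_reflect p (0, 0) u
  rwa [reflect_zero] at this

theorem measurableSet_zero_mem (p : Params) : MeasurableSet {q : ℂ × ℝ | 0 ∈ pairRegion p q} :=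
  measurable_prodMk_right (y := (0 : ℂ)) (measurableSet_mem_pairRegion p)

theorem measurable_pFun (p : Params) : Measurable (pFun p) := by
  unfold pFun
  fun_prop

theorem isPairKernel_pairKernelI (hlp : 0 < p.lp) : IsPairKernel (pairKernelI p) where
  measurable := by
    refine Measurable.ite ?_ measurable_const ?_
    · exact (measurableSet_zero_mem p).union (measurable_fst (measurableSet_pairRegion p (0, 0)))
    · exact Real.measurable_exp.comp ((measurable_unionArea p).const_mul _).neg
  nonneg u φ := by
    unfold pairKernelI
    split_ifs <;> positivity
  le_two u φ := by
    unfold pairKernelI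
    split_ifs
    · norm_num
    · refine (Real.exp_le_one_iff.2 ?_).trans one_le_two
      have : 0 ≤ unionArea p (u, φ) := measureReal_nonneg
      have := mul_nonneg hlp.le this
      linarith
  periodic u φ := by
    rw [pairKernelI, pairRegion_add_two_pi, unionArea_add_two_pi, pairKernelI]
  reflect u φ := by
    classical
    rw [pairKernelI, pairKernelI]
    have h1 := zero_mem_reflect (p := p) (u, φ)
    have h2 := unionArea_reflect (p := p) (u, φ)
    rw [reflect] at h1 h2
    rw [h2]
    exact if_congr (or_congr h1 (conj_mem_pairRegion_zero u)) rfl rfl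

/-! ### The function `pFun` as an integral over the time marks -/

/-- Integral, over the ordered pairs of time marks, of the probability that no mark of the other
points is too small. -/
noncomputable def markIntegral (a b : ℝ) : ℝ≥0∞ :=
  ∫⁻ t in Icc (0 : ℝ) 1, ∫⁻ s in Icc (0 : ℝ) 1,
    (if s < t then ENNReal.ofReal (Real.exp (-(s * a + t * b))) else 0)

theorem lintegral_exp_neg {a t : ℝ} (ha : 0 < a) (ht : 0 ≤ t) :
    ∫⁻ s in Icc 0 t, ENNReal.ofReal (Real.exp (-(s * a))) =
      ENNReal.ofReal ((1 - Real.exp (-(t * a))) / a) := by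
  rw [← ofReal_integral_eq_lintegral_ofReal, integral_Icc_eq_integral_Ioc,
    ← intervalIntegral.integral_of_le ht]
  · congr 1
    have hder : ∀ s ∈ uIcc 0 t, HasDerivAt (fun s => -Real.exp (-(s * a)) / a)
        (Real.exp (-(s * a))) s := by
      intro s _
      have h1 : HasDerivAt (fun s : ℝ => -(s * a)) (-(1 * a)) s :=
        ((hasDerivAt_id s).mul_const a).neg
      refine ((h1.exp.neg).div_const a).congr_deriv ?_
      rw [one_mul, mul_neg, neg_neg, mul_div_cancel_right₀ _ ha.ne']
    rw [intervalIntegral.integral_eq_sub_of_hasDerivAt hder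
      (Continuous.intervalIntegrable (by fun_prop) _ _)]
    simp
    ring
  · exact Continuous.integrableOn_Icc (by fun_prop)
  · exact Filter.Eventually.of_forall fun s => (Real.exp_pos _).le

theorem markIntegral_eq {a b : ℝ} (ha : 0 < a) (hb : 0 < b) :
    markIntegral a b = ENNReal.ofReal
      (((1 - Real.exp (-b)) / b - (1 - Real.exp (-(a + b))) / (a + b)) / a) := by
  have hin : ∀ t ∈ Icc (0 : ℝ) 1, ∫⁻ s in Icc (0 : ℝ) 1,
      (if s < t then ENNReal.ofReal (Real.exp (-(s * a + t * b))) else 0) =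
      ENNReal.ofReal ((Real.exp (-(t * b)) - Real.exp (-(t * (a + b)))) / a) := by
    intro t ht
    have h1 : ∀ s, (Icc (0 : ℝ) 1).indicator
        (fun s => if s < t then ENNReal.ofReal (Real.exp (-(s * a + t * b))) else 0) s =
        (Ico 0 t).indicator (fun s => ENNReal.ofReal (Real.exp (-(t * b))) *
          ENNReal.ofReal (Real.exp (-(s * a)))) s := by
      intro s
      simp only [indicator_apply, ← ite_and]
      rw [← ENNReal.ofReal_mul (Real.exp_pos _).le, ← Real.exp_add]
      refine if_congr ?_ (by ring_nf) rfl
      simp only [mem_Icc, mem_Ico]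
      constructor
      · rintro ⟨⟨h1, h2⟩, h3⟩
        exact ⟨h1, h3⟩
      · rintro ⟨h1, h3⟩
        exact ⟨⟨h1, h3.le.trans ht.2⟩, h3⟩
    rw [← lintegral_indicator measurableSet_Icc, lintegral_congr h1,
      lintegral_indicator measurableSet_Ico, lintegral_const_mul _ (by fun_prop),
      setLIntegral_congr Ico_ae_eq_Icc, lintegral_exp_neg ha ht.1,
      ← ENNReal.ofReal_mul (Real.exp_pos _).le]
    congr 1
    rw [mul_add, neg_add, Real.exp_add]
    ring
  have hab : 0 < a + b := by positivity
  rw [markIntegral, setLIntegral_congr_fun measurableSet_Icc hin,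
    ← ofReal_integral_eq_lintegral_ofReal, integral_Icc_eq_integral_Ioc,
    ← intervalIntegral.integral_of_le zero_le_one]
  · congr 1
    have hder : ∀ t ∈ uIcc (0 : ℝ) 1, HasDerivAt
        (fun t => (-Real.exp (-(t * b)) / b - -Real.exp (-(t * (a + b))) / (a + b)) / a)
        ((Real.exp (-(t * b)) - Real.exp (-(t * (a + b)))) / a) t := by
      intro t _
      have h1 : ∀ c : ℝ, 0 < c → HasDerivAt (fun t : ℝ => -Real.exp (-(t * c)) / c)
          (Real.exp (-(t * c))) t := by
        intro c hc
        have h1 : HasDerivAt (fun s : ℝ => -(s * c)) (-(1 * c)) t :=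
          ((hasDerivAt_id t).mul_const c).neg
        refine ((h1.exp.neg).div_const c).congr_deriv ?_
        rw [one_mul, mul_neg, neg_neg, mul_div_cancel_right₀ _ hc.ne']
      exact ((h1 b hb).sub (h1 (a + b) hab)).div_const a
    rw [intervalIntegral.integral_eq_sub_of_hasDerivAt hder
      (Continuous.intervalIntegrable (by fun_prop) _ _)]
    simp
    ring
  · exact Continuous.integrableOn_Icc (by fun_prop)
  · refine (ae_restrict_iff' measurableSet_Icc).2 (Filter.Eventually.of_forall fun t ht => ?_)
    refine div_nonneg (sub_nonneg.2 (Real.exp_le_exp.2 ?_)) ha.le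
    have := mul_nonneg ht.1 ha.le
    linarith

theorem markIntegral_le_one {a b : ℝ} (ha : 0 ≤ a) (hb : 0 ≤ b) : markIntegral a b ≤ 1 := by
  calc markIntegral a b ≤ ∫⁻ _ in Icc (0 : ℝ) 1, ∫⁻ _ in Icc (0 : ℝ) 1, 1 := by
        refine setLIntegral_mono measurable_const fun t ht =>
          setLIntegral_mono measurable_const fun s hs => ?_
        split_ifs
        · refine ENNReal.ofReal_le_one.2 (Real.exp_le_one_iff.2 ?_)
          have := mul_nonneg hs.1 ha
          have := mul_nonneg ht.1 hb
          linarith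
        · exact zero_le_one
    _ = 1 := by simp

/-- The strict inequality matters: at `V = areaO p` the division by zero makes `pFun` equal to 0,
whereas the integral is positive. -/
theorem markIntegral_eq_pFun (hlp : 0 < p.lp) (hpos : 0 < areaO p) {V : ℝ} (hV : areaO p < V) :
    markIntegral (p.lp * (V - areaO p)) (p.lp * areaO p) = ENNReal.ofReal (pFun p V) := by
  have h1 : 0 < V - areaO p := sub_pos.2 hV
  have h2 : 0 < V := hpos.trans hV
  rw [markIntegral_eq (by positivity) (by positivity)]
  congr 1
  have h3 : p.lp * (V - areaO p) + p.lp * areaO p = p.lp * V := by ring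
  rw [h3, pFun]
  field_simp
  ring

/-- The upper bound comes from the interpretation as an integral of probabilities, the lower one
from convexity. At equality `pFun` is 0 by convention. -/
theorem pFun_bounds (hlp : 0 < p.lp) (hpos : 0 < areaO p) {V : ℝ} (hV : areaO p ≤ V) :
    0 ≤ pFun p V ∧ pFun p V ≤ 1 := by
  rcases hV.eq_or_lt with h | h
  · simp [pFun, ← h]
  · have h1 : 0 < V - areaO p := sub_pos.2 h
    have h2 : 0 < V := hpos.trans h
    constructor
    · have h3 : Real.exp (-(p.lp * V)) ≥ 1 - p.lp * V := Real.one_sub_le_exp_neg _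
      have hconv : V * Real.exp (-(p.lp * areaO p)) ≤
          areaO p * Real.exp (-(p.lp * V)) + (V - areaO p) := by
        -- The weights place `-(p.lp * areaO p)` on the segment from `-(p.lp * V)` to `0`.
        have hc := convexOn_exp.2 (mem_univ (-(p.lp * V))) (mem_univ 0)
          (div_nonneg hpos.le h2.le) (div_nonneg h1.le h2.le) (by field_simp; ring)
        have he : (areaO p / V) • (-(p.lp * V)) + ((V - areaO p) / V) • (0 : ℝ) =
            -(p.lp * areaO p) := by
          simp only [smul_eq_mul]
          field_simp
          ring
        rw [he, Real.exp_zero, smul_eq_mul, smul_eq_mul] at hc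
        calc V * Real.exp (-(p.lp * areaO p)) ≤ V * (areaO p / V * Real.exp (-(p.lp * V)) +
              (V - areaO p) / V * 1) := by gcongr
          _ = _ := by field_simp
      refine div_nonneg (by linarith) (by positivity)
    · have h3 := markIntegral_eq_pFun hlp hpos h
      have h4 := markIntegral_le_one (a := p.lp * (V - areaO p)) (b := p.lp * areaO p)
        (by positivity) (by positivity)
      rw [h3] at h4
      exact ENNReal.ofReal_le_one.1 h4

theorem isPairKernel_pairKernelII (hlp : 0 < p.lp) (hd : 0 < p.d) (hRt : 0 < p.Rt)
    (hRr : 0 < p.Rr) (hpos : 0 < areaO p) : IsPairKernel (pairKernelII p) where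
  measurable := by
    refine Measurable.mul (Measurable.add ?_ ?_)
      ((measurable_pFun p).comp (measurable_unionArea p))
    · exact Measurable.ite (measurableSet_zero_mem p) measurable_const measurable_const
    · exact Measurable.ite (measurable_fst (measurableSet_pairRegion p (0, 0))) measurable_const
        measurable_const
  nonneg u φ := by
    have := (pFun_bounds hlp hpos (areaO_le_unionArea hd hRt hRr (u, φ))).1
    refine mul_nonneg (add_nonneg ?_ ?_) this <;> split_ifs <;> norm_num
  le_two u φ := by
    have h1 := (pFun_bounds hlp hpos (areaO_le_unionArea hd hRt hRr (u, φ))).1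
    have h2 := (pFun_bounds hlp hpos (areaO_le_unionArea hd hRt hRr (u, φ))).2
    unfold pairKernelII
    split_ifs <;> linarith
  periodic u φ := by
    rw [pairKernelII, pairRegion_add_two_pi, unionArea_add_two_pi, pairKernelII]
  reflect u φ := by
    classical
    rw [pairKernelII, pairKernelII]
    have h1 := zero_mem_reflect (p := p) (u, φ)
    have h2 := unionArea_reflect (p := p) (u, φ)
    rw [reflect] at h1 h2
    rw [h2, if_congr h1 rfl rfl, if_congr (conj_mem_pairRegion_zero u) rfl rfl]

end Kernels

end GHCP

namespace GHCP

/-! ### The observation window and the intensity measures -/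

/-- A ball that contains everything that matters for the pairs with transmitter in the unit
square. -/
def window (p : Params) : Set ℂ := Metric.closedBall 0 (2 + 2 * (p.Rt + p.Rr + p.d))

/-- Intensity measure of the potential transmitters in the window. -/
noncomputable def spaceMeasure (p : Params) : Measure ℂ :=
  ENNReal.ofReal p.lp • volume.restrict (window p)

/-- Law of the orientations. -/
noncomputable def angleLaw : Measure ℝ :=
  (ENNReal.ofReal (2 * Real.pi))⁻¹ • volume.restrict (Icc 0 (2 * Real.pi))

/-- Law of the time marks. -/
noncomputable def markLaw : Measure ℝ := volume.restrict (Icc 0 1)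

/-- Intensity measure of the pairs (transmitter, orientation) in the window. -/
noncomputable def pairMeasure (p : Params) : Measure (ℂ × ℝ) := (spaceMeasure p).prod angleLaw

theorem cond_Icc_eq_angleLaw : (volume : Measure ℝ)[|Icc 0 (2 * Real.pi)] = angleLaw := by
  rw [ProbabilityTheory.cond, Real.volume_Icc, sub_zero, angleLaw]

theorem cond_Icc_eq_markLaw : (volume : Measure ℝ)[|Icc 0 1] = markLaw := by
  rw [ProbabilityTheory.cond, Real.volume_Icc, sub_zero, ENNReal.ofReal_one, inv_one, one_smul,
    markLaw]

instance isProbabilityMeasure_angleLaw : IsProbabilityMeasure angleLaw := by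
  refine ⟨?_⟩
  rw [angleLaw, Measure.smul_apply, Measure.restrict_apply_univ, Real.volume_Icc, sub_zero,
    smul_eq_mul, ENNReal.inv_mul_cancel]
  · simp [Real.pi_pos]
  · exact ENNReal.ofReal_ne_top

instance isProbabilityMeasure_markLaw : IsProbabilityMeasure markLaw := by
  refine ⟨?_⟩
  rw [markLaw, Measure.restrict_apply_univ, Real.volume_Icc, sub_zero, ENNReal.ofReal_one]

variable {p : Params}

theorem measurableSet_window : MeasurableSet (window p) := Metric.isClosed_closedBall.measurableSet

theorem volume_window_ne_top : volume (window p) ≠ ∞ :=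
  (measure_closedBall_lt_top (μ := volume)).ne

instance isFiniteMeasure_spaceMeasure : IsFiniteMeasure (spaceMeasure p) := by
  have : IsFiniteMeasure (volume.restrict (window p)) :=
    ⟨by simpa using volume_window_ne_top.lt_top⟩
  unfold spaceMeasure
  exact Measure.smul_finite _ ENNReal.ofReal_ne_top

instance isFiniteMeasure_pairMeasure : IsFiniteMeasure (pairMeasure p) := by
  unfold pairMeasure
  infer_instance

instance nullSingletonClass_spaceMeasure : NullSingletonClass (spaceMeasure p) := by
  refine ⟨fun x => ?_⟩
  rw [spaceMeasure, Measure.smul_apply, smul_eq_mul, measure_singleton, mul_zero]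

theorem pairMeasure_fst {R : Set ℂ} (hR : MeasurableSet R) (hRW : R ⊆ window p) :
    pairMeasure p {a | a.1 ∈ R} = ENNReal.ofReal p.lp * volume R := by
  have : {a : ℂ × ℝ | a.1 ∈ R} = R ×ˢ univ := by
    ext a
    simp
  rw [this, pairMeasure, Measure.prod_prod, measure_univ, mul_one, spaceMeasure,
    Measure.smul_apply, smul_eq_mul, Measure.restrict_apply hR, inter_eq_left.2 hRW]

theorem pairMeasure_real_fst (hlp : 0 < p.lp) {R : Set ℂ} (hR : MeasurableSet R)
    (hRW : R ⊆ window p) : (pairMeasure p).real {a | a.1 ∈ R} = p.lp * volume.real R := by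
  rw [measureReal_def, pairMeasure_fst hR hRW, ENNReal.toReal_mul, ENNReal.toReal_ofReal hlp.le,
    measureReal_def]

theorem markLaw_real_Iio {s : ℝ} (hs : s ∈ Icc (0 : ℝ) 1) : markLaw.real (Iio s) = s := by
  have : Iio s ∩ Icc 0 1 = Ico 0 s := by
    ext x
    simp only [mem_inter_iff, mem_Iio, mem_Icc, mem_Ico]
    constructor
    · rintro ⟨h1, h2, h3⟩
      exact ⟨h2, h1⟩
    · rintro ⟨h1, h2⟩
      exact ⟨h2, h1, h2.le.trans hs.2⟩
  rw [markLaw, measureReal_def, Measure.restrict_apply measurableSet_Iio, this, Real.volume_Ico,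
    sub_zero, ENNReal.toReal_ofReal hs.1]

theorem measurableSet_unitSquare : MeasurableSet unitSquare :=
  (Complex.measurable_re measurableSet_Ico).inter (Complex.measurable_im measurableSet_Ico)

theorem volume_unitSquare : volume unitSquare = 1 := by
  have h := Complex.volume_preserving_equiv_real_prod.measure_preimage
    ((measurableSet_Ico (a := (0 : ℝ)) (b := 1)).prod
      (measurableSet_Ico (a := (0 : ℝ)) (b := 1))).nullMeasurableSet
  rw [Measure.volume_eq_prod, Measure.prod_prod, Real.volume_Ico] at h
  have hset : Complex.measurableEquivRealProd ⁻¹' Ico (0 : ℝ) 1 ×ˢ Ico (0 : ℝ) 1 = unitSquare := rfl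
  rw [hset] at h
  simpa using h

theorem norm_le_of_mem_unitSquare {z : ℂ} (hz : z ∈ unitSquare) : ‖z‖ ≤ 2 := by
  obtain ⟨⟨h1, h2⟩, h3, h4⟩ := hz
  have := Complex.norm_le_abs_re_add_abs_im z
  rw [abs_of_nonneg h1, abs_of_nonneg h3] at this
  linarith

theorem unitSquare_subset_window (hd : 0 < p.d) (hRt : 0 < p.Rt) (hRr : 0 < p.Rr) :
    unitSquare ⊆ window p := by
  intro z hz
  have := norm_le_of_mem_unitSquare hz
  rw [window, mem_closedBall_zero_iff]
  linarith

theorem pairRegion_subset_window (hd : 0 < p.d) (hRt : 0 < p.Rt) (hRr : 0 < p.Rr) {b : ℂ × ℝ}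
    (hb : b.1 ∈ unitSquare) :
    pairRegion p b ⊆ window p := by
  intro z hz
  have h1 := norm_le_of_mem_unitSquare hb
  have h2 := norm_sub_le_of_mem_pairRegion hd hRt hRr hz
  have h3 := norm_le_norm_add_norm_sub' z b.1
  rw [window, mem_closedBall_zero_iff]
  linarith

theorem norm_le_of_receiver_mem (hd : 0 < p.d) (hRt : 0 < p.Rt) {a b : ℂ × ℝ}
    (hb : b.1 ∈ unitSquare) (hab : receiver p b.1 b.2 ∈ pairRegionT p a) :
    ‖a.1‖ ≤ 2 + (p.Rt + p.d) := by
  have h1 := norm_le_of_mem_unitSquare hb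
  have h2 := norm_sub_le_of_mem_pairRegionT hRt hab
  have h3 := norm_receiver_sub hd b
  have h4 := norm_le_norm_add_norm_sub' (receiver p b.1 b.2) b.1
  have h5 := norm_le_norm_add_norm_sub (receiver p b.1 b.2) a.1
  linarith

theorem mem_window_of_receiver_mem (hd : 0 < p.d) (hRt : 0 < p.Rt) (hRr : 0 < p.Rr)
    {a b : ℂ × ℝ} (hb : b.1 ∈ unitSquare)
    (hab : receiver p b.1 b.2 ∈ pairRegionT p a) : a.1 ∈ window p := by
  have := norm_le_of_receiver_mem hd hRt hb hab
  rw [window, mem_closedBall_zero_iff]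
  linarith

/-- Two steps of length at most `Rt + Rr + d`, from the first transmitter to the second and on to a
point of its region, explain the factor 2 in the radius of `window`. -/
theorem pairRegion_subset_window_of_receiver_mem (hd : 0 < p.d) (hRt : 0 < p.Rt) (hRr : 0 < p.Rr)
    {a b : ℂ × ℝ} (hb : b.1 ∈ unitSquare)
    (hab : receiver p b.1 b.2 ∈ pairRegionT p a) : pairRegion p a ⊆ window p := by
  intro z hz
  have h1 := norm_le_of_receiver_mem hd hRt hb hab
  have h2 := norm_sub_le_of_mem_pairRegion hd hRt hRr hz
  have h3 := norm_le_norm_add_norm_sub' z a.1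
  rw [window, mem_closedBall_zero_iff]
  linarith

/-! ### Averaging over rigid motions -/

theorem lintegral_pairMeasure {G : ℂ × ℝ → ℝ≥0∞} (hG : Measurable G)
    (hsupp : ∀ a, a.1 ∉ window p → G a = 0) :
    ∫⁻ a, G a ∂pairMeasure p = ENNReal.ofReal p.lp * ((ENNReal.ofReal (2 * Real.pi))⁻¹ *
      ∫⁻ u, ∫⁻ φ in Icc 0 (2 * Real.pi), G (u, φ)) := by
  have hm : Measurable fun u => ∫⁻ φ in Icc 0 (2 * Real.pi), G (u, φ) := hG.lintegral_prod_right'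
  have h0 : ∫⁻ u in window p, ∫⁻ φ in Icc 0 (2 * Real.pi), G (u, φ) =
      ∫⁻ u, ∫⁻ φ in Icc 0 (2 * Real.pi), G (u, φ) := by
    rw [← lintegral_indicator measurableSet_window]
    refine lintegral_congr fun u => ?_
    by_cases hu : u ∈ window p
    · rw [indicator_of_mem hu]
    · rw [indicator_of_notMem hu]
      simp [hsupp (u, _) hu]
  rw [pairMeasure, lintegral_prod _ hG.aemeasurable, spaceMeasure, lintegral_smul_measure,
    smul_eq_mul]
  congr 1
  simp only [angleLaw, lintegral_smul_measure, smul_eq_mul]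
  rw [lintegral_const_mul _ hm, h0]

/-- For fixed `b` the substitution `a = move b a'` preserves Lebesgue measure in the position, and
by periodicity the uniform law of the orientation. So the inner integral does not depend on `b`, and
the outer one only contributes the mass `lp` of the unit square. -/
theorem lintegral_move_invariant {H : ℂ × ℝ → ℂ × ℝ → ℝ≥0∞} (hH : Measurable (Function.uncurry H))
    (hmove : ∀ b a, H b (move b a) = H (0, 0) a)
    (hper : ∀ u φ, H (0, 0) (u, φ + 2 * Real.pi) = H (0, 0) (u, φ))
    (hsupp : ∀ b a, b.1 ∈ unitSquare → a.1 ∉ window p → H b a = 0)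
    (hQW : unitSquare ⊆ window p) :
    ∫⁻ b in {b | b.1 ∈ unitSquare}, ∫⁻ a, H b a ∂pairMeasure p ∂pairMeasure p =
      ENNReal.ofReal p.lp ^ 2 * ((ENNReal.ofReal (2 * Real.pi))⁻¹ *
        ∫⁻ u, ∫⁻ φ in Icc 0 (2 * Real.pi), H (0, 0) (u, φ)) := by
  have hQ : MeasurableSet {b : ℂ × ℝ | b.1 ∈ unitSquare} := measurable_fst measurableSet_unitSquare
  have key : ∀ b ∈ {b : ℂ × ℝ | b.1 ∈ unitSquare}, ∫⁻ a, H b a ∂pairMeasure p =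
      ENNReal.ofReal p.lp * ((ENNReal.ofReal (2 * Real.pi))⁻¹ *
        ∫⁻ u, ∫⁻ φ in Icc 0 (2 * Real.pi), H (0, 0) (u, φ)) := by
    intro b hb
    have hHb : Measurable (H b) := hH.comp measurable_prodMk_left
    rw [lintegral_pairMeasure hHb fun a ha => hsupp b a hb ha]
    congr 2
    have hmp := measurePreserving_isometry (rotation (Circle.exp b.2)) b.1
    have h1 : ∀ u, ∫⁻ φ in Icc 0 (2 * Real.pi), H b (b.1 + rotation (Circle.exp b.2) u, φ) =
        ∫⁻ φ in Icc 0 (2 * Real.pi), H (0, 0) (u, φ) := by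
      intro u
      have h2 : ∀ φ, H b (b.1 + rotation (Circle.exp b.2) u, φ) = H (0, 0) (u, φ - b.2) := by
        intro φ
        rw [← hmove b (u, φ - b.2), move, rotation_dir, add_sub_cancel]
      simp only [h2]
      rw [setLIntegral_Icc_comp_sub_of_periodic (G := fun φ => H (0, 0) (u, φ)) (hper u) b.2 0,
        zero_add, setLIntegral_congr Ioc_ae_eq_Icc]
    have hm : Measurable fun v => ∫⁻ φ in Icc 0 (2 * Real.pi), H b (v, φ) :=
      hHb.lintegral_prod_right'
    rw [← hmp.lintegral_comp hm, lintegral_congr h1]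
  rw [setLIntegral_congr_fun hQ key, setLIntegral_const,
    pairMeasure_fst measurableSet_unitSquare hQW, volume_unitSquare]
  ring

/-! ### Hidden nodes seen from a retained pair -/

section Seen

variable {Ω : Type*} {y : ℕ → Ω → ℂ} {θ : ℕ → Ω → ℝ}

-- Since `move b` undoes the relative coordinates, hidden nodes can be counted by their indices.
-- Injectivity on the window suffices, because every transmitter that covers the receiver lies
-- there.
open scoped Classical in
theorem hiddenNodes_seenFrom (hd : 0 < p.d) (hRt : 0 < p.Rt) (hRr : 0 < p.Rr) {A : Ω → Set ℕ}
    {ω : Ω} (hinj : InjOn (fun k => y k ω) {k | y k ω ∈ window p}) {i : ℕ}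
    (hi : y i ω ∈ unitSquare) :
    hiddenNodes p (seenFrom y θ A i ω) = ∑' j, (if j ∈ A ω ∧ j ≠ i ∧
      receiver p (y i ω) (θ i ω) ∈ pairRegionT p (y j ω, θ j ω) then 1 else 0) := by
  set b : ℂ × ℝ := (y i ω, θ i ω) with hb
  set rel : ℕ → ℂ × ℝ := fun j => (dir (-θ i ω) * (y j ω - y i ω), θ j ω - θ i ω) with hrel
  have hmove : ∀ j, move b (rel j) = (y j ω, θ j ω) := by
    intro j
    simp only [move, hb, hrel]
    rw [← mul_assoc, mul_comm (dir _) (dir _), dir_neg_mul, one_mul]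
    simp
  have hmem : ∀ j, (p.d : ℂ) ∈ pairRegionT p (rel j) ↔
      receiver p (y i ω) (θ i ω) ∈ pairRegionT p (y j ω, θ j ω) := by
    intro j
    rw [← hmove j, ← mem_pairRegionT_move p b (rel j) p.d, receiver, mul_comm (p.d : ℂ)]
  have hset : {q ∈ seenFrom y θ A i ω | (p.d : ℂ) ∈ regionT p q.1 (receiver p q.1 q.2)} =
      rel '' {j | j ∈ A ω ∧ j ≠ i ∧
        receiver p (y i ω) (θ i ω) ∈ pairRegionT p (y j ω, θ j ω)} := by
    ext q
    constructor
    · rintro ⟨⟨j, ⟨hj, hji⟩, rfl⟩, hq⟩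
      exact ⟨j, ⟨hj, hji, (hmem j).1 hq⟩, rfl⟩
    · rintro ⟨j, ⟨hj, hji, hq⟩, rfl⟩
      exact ⟨⟨j, ⟨hj, hji⟩, rfl⟩, (hmem j).2 hq⟩
  have hinj' : InjOn rel {j | j ∈ A ω ∧ j ≠ i ∧
      receiver p (y i ω) (θ i ω) ∈ pairRegionT p (y j ω, θ j ω)} := by
    intro j hj k hk hjk
    have hw : ∀ j, receiver p (y i ω) (θ i ω) ∈ pairRegionT p (y j ω, θ j ω) →
        y j ω ∈ window p :=
      fun j hj => mem_window_of_receiver_mem (a := (y j ω, θ j ω)) (b := b) hd hRt hRr hi hj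
    refine hinj (hw j hj.2.2) (hw k hk.2.2) ?_
    have := congrArg (fun q => (move b q).1) hjk
    simpa only [hmove] using this
  rw [hiddenNodes, hset, hinj'.encard_image, ← tsum_encard]
  refine tsum_congr fun j => ?_
  simp only [mem_ofPred_eq]
  congr

open scoped Classical in
theorem tsum_hiddenNodes_seenFrom (hd : 0 < p.d) (hRt : 0 < p.Rt) (hRr : 0 < p.Rr)
    {A : Ω → Set ℕ} {ω : Ω} (hinj : InjOn (fun k => y k ω) {k | y k ω ∈ window p}) :
    ∑' i, (if i ∈ A ω ∧ y i ω ∈ unitSquare then hiddenNodes p (seenFrom y θ A i ω) else 0) =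
      ∑' i, ∑' j, (if i ≠ j ∧ i ∈ A ω ∧ j ∈ A ω ∧ (y i ω ∈ unitSquare ∧
        receiver p (y i ω) (θ i ω) ∈ pairRegionT p (y j ω, θ j ω)) then 1 else 0) := by
  refine tsum_congr fun i => ?_
  by_cases hi : i ∈ A ω ∧ y i ω ∈ unitSquare
  · rw [if_pos hi, hiddenNodes_seenFrom hd hRt hRr hinj hi.2]
    refine tsum_congr fun j => if_congr ?_ rfl rfl
    have := hi.1
    have := hi.2
    rw [ne_comm]
    tauto
  · rw [if_neg hi, eq_comm, ENNReal.tsum_eq_zero]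
    intro j
    exact if_neg fun h => hi ⟨h.2.1, h.2.2.2.1⟩

end Seen

/-! ### Assembling the Palm expectation -/

/-- The common end of both types: the density `1 / (2π)` of the orientation and the factor 2 from
the reflection combine to `1 / π`. -/
theorem palmExpectation_eq {Ω : Type*} [MeasurableSpace Ω] {μ : Measure Ω} {y : ℕ → Ω → ℂ}
    {θ : ℕ → Ω → ℝ} {A : Ω → Set ℕ} {κ : ℂ → ℝ → ℝ} {k : ℝ → ℝ → ℝ → ℝ} (hκ : IsPairKernel κ)
    (hk : ∀ r β φ, 0 < r → k r β φ = κ (r * dir β) φ) (hd : 0 < p.d) (hRt : 0 < p.Rt)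
    (hd0 : 0 < p.d0) (hwl : 0 < p.wl) (hNt : 0 < p.Nt) (hlp : 0 < p.lp)
    (hbeam : p.wl / (p.d0 * p.Nt) ≤ Real.pi) {lb : ℝ} (hlb : 0 < lb)
    (hint : intensity μ y A = ENNReal.ofReal lb)
    (hnum : (open scoped Classical in ∫⁻ ω, ∑' i, (if i ∈ A ω ∧ y i ω ∈ unitSquare then
      hiddenNodes p (seenFrom y θ A i ω) else 0) ∂μ) = ENNReal.ofReal p.lp ^ 2 *
        ((ENNReal.ofReal (2 * Real.pi))⁻¹ * ∫⁻ u, hiddenMass p κ u)) :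
    palmExpectation μ y θ A (hiddenNodes p) ≠ ∞ ∧
      (palmExpectation μ y θ A (hiddenNodes p)).toReal =
        p.lp ^ 2 / (Real.pi * lb) * hiddenIntegral p k := by
  obtain ⟨hfin, hval⟩ := lintegral_hiddenMass_toReal hκ hk hd hRt hd0 hwl hNt hbeam
  have hpi := Real.pi_pos
  have h : palmExpectation μ y θ A (hiddenNodes p) = ENNReal.ofReal p.lp ^ 2 *
      ((ENNReal.ofReal (2 * Real.pi))⁻¹ * ∫⁻ u, hiddenMass p κ u) / ENNReal.ofReal lb := by
    rw [palmExpectation, hint, ← hnum]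
  rw [h]
  constructor
  · refine ENNReal.div_ne_top (ENNReal.mul_ne_top (by finiteness)
      (ENNReal.mul_ne_top (ENNReal.inv_ne_top.2 ?_) hfin)) ?_
    · simpa using hpi
    · simpa using hlb
  · rw [ENNReal.toReal_div, ENNReal.toReal_mul, ENNReal.toReal_mul, hval, ENNReal.toReal_pow,
      ENNReal.toReal_inv, ENNReal.toReal_ofReal hlp.le, ENNReal.toReal_ofReal hlb.le,
      ENNReal.toReal_ofReal (by positivity)]
    field_simp

end GHCP

namespace GHCP

variable {p : Params}

/-! ### Functions of two pairs -/

/-- Area of the union of the exclusion regions of two pairs. -/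
noncomputable def areaPair (p : Params) (b a : ℂ × ℝ) : ℝ :=
  volume.real (pairRegion p b ∪ pairRegion p a)

theorem areaPair_move (b a : ℂ × ℝ) : areaPair p b (move b a) = areaPair p (0, 0) a := by
  have h := measure_union_move p b (0, 0) a
  rw [move_zero] at h
  rw [areaPair, measureReal_def, h]
  rfl

theorem measurableSet_mem_pairRegion_fst (p : Params) :
    MeasurableSet {q : (ℂ × ℝ) × (ℂ × ℝ) | q.2.1 ∈ pairRegion p q.1} := by
  have : Measurable fun q : (ℂ × ℝ) × (ℂ × ℝ) => (q.1, q.2.1) := by fun_prop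
  exact this (measurableSet_mem_pairRegion p)

theorem measurableSet_receiver_mem (p : Params) :
    MeasurableSet {q : (ℂ × ℝ) × (ℂ × ℝ) | receiver p q.1.1 q.1.2 ∈ pairRegionT p q.2} := by
  have : Measurable fun q : (ℂ × ℝ) × (ℂ × ℝ) => (q.2, receiver p q.1.1 q.1.2) :=
    measurable_snd.prodMk ((measurable_receiver p).comp measurable_fst)
  exact this (measurableSet_mem_pairRegionT p)

theorem measurable_areaPair (p : Params) : Measurable (Function.uncurry (areaPair p)) := by
  have h : MeasurableSet {q : ((ℂ × ℝ) × (ℂ × ℝ)) × ℂ |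
      q.2 ∈ pairRegion p q.1.1 ∪ pairRegion p q.1.2} := by
    have m1 : Measurable fun q : ((ℂ × ℝ) × (ℂ × ℝ)) × ℂ => (q.1.1, q.2) := by fun_prop
    have m2 : Measurable fun q : ((ℂ × ℝ) × (ℂ × ℝ)) × ℂ => (q.1.2, q.2) := by fun_prop
    exact (m1 (measurableSet_mem_pairRegion p)).union (m2 (measurableSet_mem_pairRegion p))
  exact (measurable_measure_prodMk_left h).ennreal_toReal

theorem receiver_mem_move (b a : ℂ × ℝ) :
    receiver p b.1 b.2 ∈ pairRegionT p (move b a) ↔ (p.d : ℂ) ∈ pairRegionT p a := by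
  rw [← mem_pairRegionT_move p b a p.d, receiver, mul_comm (p.d : ℂ)]

theorem fst_mem_pairRegion_move (b a : ℂ × ℝ) :
    b.1 ∈ pairRegion p (move b a) ↔ 0 ∈ pairRegion p a := by
  rw [← mem_pairRegion_move p b a 0, mul_zero, add_zero]

theorem move_fst_mem_pairRegion (b a : ℂ × ℝ) :
    (move b a).1 ∈ pairRegion p b ↔ a.1 ∈ pairRegion p (0, 0) := by
  have := mem_pairRegion_move p b (0, 0) a.1
  rwa [move_zero] at this

theorem isPoissonOn_pairs {Ω : Type*} [MeasurableSpace Ω] {μ : Measure Ω} [IsProbabilityMeasure μ]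
    {y : ℕ → Ω → ℂ} {θ : ℕ → Ω → ℝ} (h : IsMarkedPPP μ p.lp y θ) (hlp : 0 < p.lp) :
    IsPoissonOn μ (fun k ω => (y k ω, θ k ω)) (window p ×ˢ univ) (pairMeasure p) := by
  have h1 : IsPoissonOn μ y (window p) (spaceMeasure p) :=
    h.ppp.isPoissonOn hlp.le measurableSet_window volume_window_ne_top
  exact h1.marked h.measurable (fun k => (h.uniform k).trans cond_Icc_eq_angleLaw) h.iindep h.indep

theorem ae_injOn_window {Ω : Type*} [MeasurableSpace Ω] {μ : Measure Ω} [IsProbabilityMeasure μ]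
    {y : ℕ → Ω → ℂ} (h : IsPPP μ p.lp y) (hlp : 0 < p.lp) :
    ∀ᵐ ω ∂μ, InjOn (fun k => y k ω) {k | y k ω ∈ window p} := by
  have h1 : IsPoissonOn μ y (window p) (spaceMeasure p) :=
    h.isPoissonOn hlp.le measurableSet_window volume_window_ne_top
  exact h1.ae_injOn

/-! ### Type I thinning -/

section TypeI

/-- The transmitter of the second pair is in the exclusion region of the first. -/
def BlocksI (p : Params) (b a : ℂ × ℝ) : Prop := a.1 ∈ pairRegion p b

theorem activeI_eq_retained {Ω : Type*} (y : ℕ → Ω → ℂ) (θ : ℕ → Ω → ℝ) :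
    activeI p y θ = retained (BlocksI p) fun k ω => (y k ω, θ k ω) := by
  funext ω
  ext i
  simp only [activeI, retained, mem_ofPred_eq, encard_eq_zero, eq_empty_iff_forall_notMem, not_and]
  rfl

open scoped Classical in
/-- Density of the pairs of retained pairs such that the receiver of the first is in the RTS
exclusion region of the second. -/
noncomputable def densityI (p : Params) (b a : ℂ × ℝ) : ℝ≥0∞ :=
  if receiver p b.1 b.2 ∈ pairRegionT p a ∧ a.1 ∉ pairRegion p b ∧ b.1 ∉ pairRegion p a then
    ENNReal.ofReal (Real.exp (-(p.lp * areaPair p b a))) else 0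

theorem measurable_densityI (p : Params) : Measurable (Function.uncurry (densityI p)) := by
  refine Measurable.ite ?_ ?_ measurable_const
  · exact (measurableSet_receiver_mem p).inter ((measurableSet_mem_pairRegion_fst p).compl.inter
      (measurable_swap (measurableSet_mem_pairRegion_fst p)).compl)
  · exact (Real.measurable_exp.comp ((measurable_areaPair p).const_mul _).neg).ennreal_ofReal

theorem densityI_move (b a : ℂ × ℝ) : densityI p b (move b a) = densityI p (0, 0) a := by
  classical
  rw [densityI, densityI, areaPair_move]
  refine if_congr ?_ rfl rfl
  rw [receiver_mem_move, move_fst_mem_pairRegion, fst_mem_pairRegion_move]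
  simp [receiver, dir_zero]

theorem densityI_zero (u : ℂ) (φ : ℝ) :
    densityI p (0, 0) (u, φ) = hiddenKernel p (pairKernelI p) u φ := by
  have h1 : receiver p 0 0 = p.d := by simp [receiver, dir_zero]
  rw [densityI, hiddenKernel, pairKernelI]
  by_cases h2 : (p.d : ℂ) ∈ pairRegionT p (u, φ) <;>
  by_cases h3 : 0 ∈ pairRegion p (u, φ) <;>
  by_cases h4 : u ∈ pairRegion p (0, 0) <;> simp [h1, h2, h3, h4]
  rfl

theorem lintegral_densityI (hd : 0 < p.d) (hRt : 0 < p.Rt) (hRr : 0 < p.Rr) (hlp : 0 < p.lp) :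
    ∫⁻ b in {b | b.1 ∈ unitSquare}, ∫⁻ a, densityI p b a ∂pairMeasure p ∂pairMeasure p =
      ENNReal.ofReal p.lp ^ 2 * ((ENNReal.ofReal (2 * Real.pi))⁻¹ *
        ∫⁻ u, hiddenMass p (pairKernelI p) u) := by
  rw [lintegral_move_invariant (measurable_densityI p) densityI_move ?_ ?_
    (unitSquare_subset_window hd hRt hRr)]
  · simp only [densityI_zero]
    rfl
  · intro u φ
    rw [densityI_zero, densityI_zero, hiddenKernel_add_two_pi (isPairKernel_pairKernelI hlp)]
  · intro b a hb ha
    exact if_neg fun h => ha (mem_window_of_receiver_mem hd hRt hRr hb h.1)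

variable {Ω : Type*} [MeasurableSpace Ω] {μ : Measure Ω} [IsProbabilityMeasure μ]
  {y : ℕ → Ω → ℂ} {θ : ℕ → Ω → ℝ}

theorem intensity_activeI (h : IsMarkedPPP μ p.lp y θ) (hd : 0 < p.d) (hRt : 0 < p.Rt)
    (hRr : 0 < p.Rr) (hlp : 0 < p.lp) :
    intensity μ y (activeI p y θ) =
      ENNReal.ofReal (p.lp * Real.exp (-(p.lp * areaO p))) := by
  have hQ : MeasurableSet {b : ℂ × ℝ | b.1 ∈ unitSquare} := measurable_fst measurableSet_unitSquare
  have hQW := unitSquare_subset_window hd hRt hRr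
  have key := (isPoissonOn_pairs h hlp).lintegral_retained (R := BlocksI p)
    (measurableSet_mem_pairRegion_fst p) hQ (fun b hb => ⟨hQW hb, mem_univ _⟩)
    fun b hb a ha => ⟨pairRegion_subset_window hd hRt hRr hb ha, mem_univ _⟩
  rw [intensity, activeI_eq_retained]
  refine key.trans ?_
  have h1 : ∀ b ∈ {b : ℂ × ℝ | b.1 ∈ unitSquare},
      ENNReal.ofReal (Real.exp (-(pairMeasure p).real {a | BlocksI p b a})) =
        ENNReal.ofReal (Real.exp (-(p.lp * areaO p))) := by
    intro b hb
    have h2 : (pairMeasure p).real {a | BlocksI p b a} = p.lp * areaO p := by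
      rw [← measureReal_pairRegion p b]
      exact pairMeasure_real_fst hlp (measurableSet_pairRegion p b)
        (pairRegion_subset_window hd hRt hRr hb)
    rw [h2]
  rw [setLIntegral_congr_fun hQ h1, setLIntegral_const,
    pairMeasure_fst measurableSet_unitSquare hQW, volume_unitSquare, mul_one,
    ENNReal.ofReal_mul hlp.le, mul_comm]

-- The two-point Mecke formula turns the numerator into the integral of `densityI`: the points that
-- block one of the two pairs have mass `lp` times the area of the union of the regions.
open scoped Classical in
theorem palm_numerator_activeI (h : IsMarkedPPP μ p.lp y θ) (hd : 0 < p.d) (hRt : 0 < p.Rt)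
    (hRr : 0 < p.Rr) (hlp : 0 < p.lp) :
    ∫⁻ ω, ∑' i, (if i ∈ activeI p y θ ω ∧ y i ω ∈ unitSquare then
      hiddenNodes p (seenFrom y θ (activeI p y θ) i ω) else 0) ∂μ = ENNReal.ofReal p.lp ^ 2 *
        ((ENNReal.ofReal (2 * Real.pi))⁻¹ * ∫⁻ u, hiddenMass p (pairKernelI p) u) := by
  have hQ : MeasurableSet {b : ℂ × ℝ | b.1 ∈ unitSquare} := measurable_fst measurableSet_unitSquare
  have hQW := unitSquare_subset_window hd hRt hRr
  have hD : MeasurableSet {q : (ℂ × ℝ) × (ℂ × ℝ) | q.1.1 ∈ unitSquare ∧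
      receiver p q.1.1 q.1.2 ∈ pairRegionT p q.2} :=
    (measurable_fst hQ).inter (measurableSet_receiver_mem p)
  have key := (isPoissonOn_pairs h hlp).lintegral_retained_pairs (R := BlocksI p)
    (measurableSet_mem_pairRegion_fst p) hD (by
      rintro b a ⟨hb, hab⟩
      refine ⟨⟨hQW hb, mem_univ _⟩, ⟨mem_window_of_receiver_mem hd hRt hRr hb hab, mem_univ _⟩, ?_⟩
      rintro z (hz | hz)
      · exact ⟨pairRegion_subset_window hd hRt hRr hb hz, mem_univ _⟩
      · exact ⟨pairRegion_subset_window_of_receiver_mem hd hRt hRr hb hab hz, mem_univ _⟩)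
  rw [← lintegral_densityI hd hRt hRr hlp]
  calc _ = _ := ?_
    _ = _ := key
    _ = _ := ?_
  · refine lintegral_congr_ae ?_
    filter_upwards [ae_injOn_window h.ppp hlp] with ω hω
    rw [tsum_hiddenNodes_seenFrom hd hRt hRr hω, activeI_eq_retained]
    refine tsum_congr fun i => tsum_congr fun j => ?_
    congr
  · rw [← lintegral_indicator hQ]
    refine lintegral_congr fun b => ?_
    by_cases hb : b ∈ {b : ℂ × ℝ | b.1 ∈ unitSquare}
    · rw [indicator_of_mem hb]
      refine lintegral_congr fun a => ?_
      have hb' : b.1 ∈ unitSquare := hb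
      simp only [mem_ofPred_eq, hb', true_and, densityI, BlocksI]
      by_cases hab : receiver p b.1 b.2 ∈ pairRegionT p a
      · have h2 : (pairMeasure p).real {z | z.1 ∈ pairRegion p b ∨ z.1 ∈ pairRegion p a} =
            p.lp * areaPair p b a :=
          pairMeasure_real_fst hlp
            ((measurableSet_pairRegion p b).union (measurableSet_pairRegion p a))
            (union_subset (pairRegion_subset_window hd hRt hRr hb)
              (pairRegion_subset_window_of_receiver_mem hd hRt hRr hb hab))
        rw [h2]
      · simp [hab]
    · rw [indicator_of_notMem hb]
      have hb' : b.1 ∉ unitSquare := hb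
      simp [hb']

end TypeI

/-! ### Type II thinning -/

section TypeII

/-- The transmitter of the second pair is in the exclusion region of the first and has a smaller
time mark. -/
def BlocksII (p : Params) (x z : (ℂ × ℝ) × ℝ) : Prop := z.1.1 ∈ pairRegion p x.1 ∧ z.2 < x.2

theorem activeII_eq_retained {Ω : Type*} (y : ℕ → Ω → ℂ) (θ t : ℕ → Ω → ℝ) :
    activeII p y θ t = retained (BlocksII p) fun k ω => ((y k ω, θ k ω), t k ω) := by
  funext ω
  ext i
  simp only [activeII, retained, mem_ofPred_eq, encard_eq_zero, eq_empty_iff_forall_notMem,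
    not_and, BlocksII]
  rfl

theorem measurableSet_blocksII (p : Params) :
    MeasurableSet {q : ((ℂ × ℝ) × ℝ) × ((ℂ × ℝ) × ℝ) | BlocksII p q.1 q.2} := by
  have m : Measurable fun q : ((ℂ × ℝ) × ℝ) × ((ℂ × ℝ) × ℝ) => (q.1.1, q.2.1) := by fun_prop
  exact (m (measurableSet_mem_pairRegion_fst p)).inter
    (measurableSet_lt measurable_snd.snd measurable_fst.snd)

/-- Intensity of the points that block one of two pairs, the first of which has the smaller time
mark. -/
theorem measureReal_blocking (hlp : 0 < p.lp) {R R' : Set ℂ} (hR : MeasurableSet R)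
    (hR' : MeasurableSet R') (hRW : R ⊆ window p) (hRW' : R' ⊆ window p) {s t : ℝ}
    (hs : s ∈ Icc (0 : ℝ) 1) (ht : t ∈ Icc (0 : ℝ) 1) (hst : s ≤ t) :
    ((pairMeasure p).prod markLaw).real
      {z | (z.1.1 ∈ R ∧ z.2 < s) ∨ (z.1.1 ∈ R' ∧ z.2 < t)} =
      s * (p.lp * (volume.real (R ∪ R') - volume.real R')) + t * (p.lp * volume.real R') := by
  -- As `s ≤ t`, the part of `R` inside `R'` is already accounted for at level `t`; this leaves two
  -- disjoint products.
  have hset : {z : (ℂ × ℝ) × ℝ | (z.1.1 ∈ R ∧ z.2 < s) ∨ (z.1.1 ∈ R' ∧ z.2 < t)} =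
      ({a : ℂ × ℝ | a.1 ∈ R \ R'} ×ˢ Iio s) ∪ ({a : ℂ × ℝ | a.1 ∈ R'} ×ˢ Iio t) := by
    ext z
    simp only [mem_ofPred_eq, mem_union, mem_prod, mem_sdiff, mem_Iio]
    constructor
    · rintro (⟨h1, h2⟩ | h)
      · by_cases h3 : z.1.1 ∈ R'
        · exact Or.inr ⟨h3, h2.trans_le hst⟩
        · exact Or.inl ⟨⟨h1, h3⟩, h2⟩
      · exact Or.inr h
    · rintro (⟨⟨h1, -⟩, h2⟩ | h)
      · exact Or.inl ⟨h1, h2⟩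
      · exact Or.inr h
  have hdisj : Disjoint ({a : ℂ × ℝ | a.1 ∈ R \ R'} ×ˢ Iio s) ({a : ℂ × ℝ | a.1 ∈ R'} ×ˢ Iio t) :=
    disjoint_left.2 fun z hz hz' => hz.1.2 hz'.1
  have hfin : volume (R ∪ R') ≠ ∞ :=
    measure_ne_top_of_subset (union_subset hRW hRW') volume_window_ne_top
  have hdiff : volume.real (R \ R') = volume.real (R ∪ R') - volume.real R' := by
    have h1 : R \ R' = (R ∪ R') \ R' := by simp
    rw [h1, measureReal_sdiff subset_union_right hR' hfin]
  rw [hset, measureReal_union hdisj ((measurable_fst hR').prod measurableSet_Iio),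
    measureReal_prod_prod, measureReal_prod_prod, markLaw_real_Iio hs, markLaw_real_Iio ht,
    pairMeasure_real_fst hlp (hR.diff hR') (sdiff_subset.trans hRW),
    pairMeasure_real_fst hlp hR' hRW', hdiff]
  ring

theorem measurable_markIntegral_left (b : ℝ) : Measurable fun a => markIntegral a b := by
  unfold markIntegral
  have h : Measurable fun q : (ℝ × ℝ) × ℝ => if q.2 < q.1.2 then
      ENNReal.ofReal (Real.exp (-(q.2 * q.1.1 + q.1.2 * b))) else 0 := by
    refine Measurable.ite (measurableSet_lt (by fun_prop) (by fun_prop)) ?_ measurable_const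
    fun_prop
  have h1 : Measurable fun q : ℝ × ℝ => ∫⁻ s in Icc (0 : ℝ) 1, (if s < q.2 then
      ENNReal.ofReal (Real.exp (-(s * q.1 + q.2 * b))) else 0) := h.lintegral_prod_right'
  exact h1.lintegral_prod_right'

open scoped Classical in
/-- Density of the pairs of retained pairs such that the receiver of the first is in the RTS
exclusion region of the second. -/
noncomputable def densityII (p : Params) (b a : ℂ × ℝ) : ℝ≥0∞ :=
  if receiver p b.1 b.2 ∈ pairRegionT p a then
    ((if b.1 ∈ pairRegion p a then 0 else 1) + (if a.1 ∈ pairRegion p b then 0 else 1)) *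
      markIntegral (p.lp * (areaPair p b a - areaO p)) (p.lp * areaO p) else 0

theorem measurable_densityII (p : Params) : Measurable (Function.uncurry (densityII p)) := by
  refine Measurable.ite (measurableSet_receiver_mem p) ?_ measurable_const
  refine Measurable.mul (Measurable.add ?_ ?_) ?_
  · exact Measurable.ite (measurable_swap (measurableSet_mem_pairRegion_fst p)) measurable_const
      measurable_const
  · exact Measurable.ite (measurableSet_mem_pairRegion_fst p) measurable_const measurable_const
  · exact (measurable_markIntegral_left _).comp
      (((measurable_areaPair p).sub_const _).const_mul _)

theorem densityII_move (b a : ℂ × ℝ) : densityII p b (move b a) = densityII p (0, 0) a := by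
  classical
  have h : receiver p 0 0 = p.d := by simp [receiver, dir_zero]
  rw [densityII, densityII, areaPair_move]
  simp only [receiver_mem_move, move_fst_mem_pairRegion, fst_mem_pairRegion_move, h]

theorem densityII_zero (hd : 0 < p.d) (hRt : 0 < p.Rt) (hRr : 0 < p.Rr) (hlp : 0 < p.lp)
    (hpos : 0 < areaO p) {u : ℂ} {φ : ℝ} (hne : unionArea p (u, φ) ≠ areaO p) :
    densityII p (0, 0) (u, φ) = hiddenKernel p (pairKernelII p) u φ := by
  have h1 : receiver p 0 0 = p.d := by simp [receiver, dir_zero]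
  have h2 : areaO p < unionArea p (u, φ) :=
    lt_of_le_of_ne (areaO_le_unionArea hd hRt hRr (u, φ)) hne.symm
  have h3 : areaPair p (0, 0) (u, φ) = unionArea p (u, φ) := rfl
  rw [densityII, hiddenKernel, pairKernelII, h3, markIntegral_eq_pFun hlp hpos h2, h1,
    ENNReal.ofReal_mul (by split_ifs <;> norm_num)]
  by_cases h4 : 0 ∈ pairRegion p (u, φ) <;>
  by_cases h5 : u ∈ pairRegion p (0, 0) <;> simp [h4, h5]
  norm_num

theorem densityII_add_two_pi (u : ℂ) (φ : ℝ) :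
    densityII p (0, 0) (u, φ + 2 * Real.pi) = densityII p (0, 0) (u, φ) := by
  rw [densityII, densityII, areaPair, areaPair, pairRegion_add_two_pi, pairRegionT_add_two_pi]

/-- Unlike in Type I, the density agrees with the kernel only off the degenerate set where the union
has area `areaO p`, so the integrals are compared almost everywhere. -/
theorem lintegral_densityII (hd : 0 < p.d) (hRt : 0 < p.Rt) (hRr : 0 < p.Rr) (hlp : 0 < p.lp)
    (hpos : 0 < areaO p) :
    ∫⁻ b in {b | b.1 ∈ unitSquare}, ∫⁻ a, densityII p b a ∂pairMeasure p ∂pairMeasure p =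
      ENNReal.ofReal p.lp ^ 2 * ((ENNReal.ofReal (2 * Real.pi))⁻¹ *
        ∫⁻ u, hiddenMass p (pairKernelII p) u) := by
  rw [lintegral_move_invariant (measurable_densityII p) densityII_move densityII_add_two_pi ?_
    (unitSquare_subset_window hd hRt hRr)]
  · have hm1 : Measurable fun a : ℂ × ℝ => densityII p (0, 0) a :=
      (measurable_densityII p).of_uncurry_left
    have hm2 : Measurable fun a : ℂ × ℝ => hiddenKernel p (pairKernelII p) a.1 a.2 :=
      measurable_hiddenKernel (isPairKernel_pairKernelII hlp hd hRt hRr hpos)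
    have h1 : ∫⁻ a, densityII p (0, 0) a ∂(volume : Measure ℂ).prod
          ((volume : Measure ℝ).restrict (Icc 0 (2 * Real.pi))) =
        ∫⁻ u, ∫⁻ φ in Icc 0 (2 * Real.pi), densityII p (0, 0) (u, φ) :=
      lintegral_prod _ hm1.aemeasurable
    have h2 : ∫⁻ a, hiddenKernel p (pairKernelII p) a.1 a.2 ∂(volume : Measure ℂ).prod
          ((volume : Measure ℝ).restrict (Icc 0 (2 * Real.pi))) =
        ∫⁻ u, hiddenMass p (pairKernelII p) u :=
      lintegral_prod _ hm2.aemeasurable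
    rw [← h1, ← h2]
    refine congrArg (fun I => ENNReal.ofReal p.lp ^ 2 * ((ENNReal.ofReal (2 * Real.pi))⁻¹ * I)) ?_
    refine lintegral_congr_ae ?_
    have hprod : (volume : Measure ℂ).prod (volume.restrict (Icc 0 (2 * Real.pi))) =
        ((volume : Measure ℂ).prod volume).restrict (univ ×ˢ Icc 0 (2 * Real.pi)) := by
      rw [← Measure.prod_restrict, Measure.restrict_univ]
    rw [hprod]
    filter_upwards [ae_restrict_of_ae (ae_unionArea_ne hd hRt hRr hpos)] with a ha
    exact densityII_zero hd hRt hRr hlp hpos ha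
  · intro b a hb ha
    exact if_neg fun h => ha (mem_window_of_receiver_mem hd hRt hRr hb h)

-- For each order of the two marks only the earlier transmitter can block the later pair, which
-- leaves one indicator per order. Both orders give the same `markIntegral`, because the two regions
-- have equal area; ties are null.
open scoped Classical in
theorem lintegral_marks_eq (hlp : 0 < p.lp) (hd : 0 < p.d) (hRt : 0 < p.Rt) (hRr : 0 < p.Rr)
    {b a : ℂ × ℝ} (hb : b.1 ∈ unitSquare) (hab : receiver p b.1 b.2 ∈ pairRegionT p a) :
    ∫⁻ s, ∫⁻ t, (if ¬BlocksII p (b, s) (a, t) ∧ ¬BlocksII p (a, t) (b, s) then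
        ENNReal.ofReal (Real.exp (-((pairMeasure p).prod markLaw).real
          {z | BlocksII p (b, s) z ∨ BlocksII p (a, t) z})) else 0) ∂markLaw ∂markLaw =
      densityII p b a := by
  set A := p.lp * (areaPair p b a - areaO p) with hA
  set B := p.lp * areaO p with hB
  set E : ℝ → ℝ → ℝ≥0∞ := fun t s =>
    if s < t then ENNReal.ofReal (Real.exp (-(s * A + t * B))) else 0 with hE
  have hEm : Measurable (Function.uncurry E) := by
    refine Measurable.ite (measurableSet_lt measurable_snd measurable_fst) ?_ measurable_const
    fun_prop
  have hEm1 : ∀ t, Measurable (E t) := fun t => hEm.comp measurable_prodMk_left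
  have hEm2 : ∀ s, Measurable fun t => E t s := fun s => hEm.comp measurable_prodMk_right
  have hE1 : ∫⁻ t, ∫⁻ s, E t s ∂markLaw ∂markLaw = markIntegral A B := rfl
  have hE2 : ∫⁻ s, ∫⁻ t, E t s ∂markLaw ∂markLaw = markIntegral A B := by
    rw [← hE1]
    exact (lintegral_lintegral_swap hEm.aemeasurable).symm
  set c₁ : ℝ≥0∞ := if b.1 ∈ pairRegion p a then 0 else 1 with hc₁
  set c₂ : ℝ≥0∞ := if a.1 ∈ pairRegion p b then 0 else 1 with hc₂
  have hbW := pairRegion_subset_window hd hRt hRr hb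
  have haW := pairRegion_subset_window_of_receiver_mem hd hRt hRr hb hab
  have hbm := measurableSet_pairRegion p b
  have ham := measurableSet_pairRegion p a
  have hmem : ∀ᵐ s ∂markLaw, s ∈ Icc (0 : ℝ) 1 := ae_restrict_mem measurableSet_Icc
  have hpt : ∀ᵐ s ∂markLaw, ∀ᵐ t ∂markLaw,
      (if ¬BlocksII p (b, s) (a, t) ∧ ¬BlocksII p (a, t) (b, s) then
        ENNReal.ofReal (Real.exp (-((pairMeasure p).prod markLaw).real
          {z | BlocksII p (b, s) z ∨ BlocksII p (a, t) z})) else 0) =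
        c₁ * E t s + c₂ * E s t := by
    filter_upwards [hmem] with s hs
    have hne : ∀ᵐ t ∂markLaw, t ≠ s := ae_restrict_of_ae (by simp [ae_iff])
    filter_upwards [hmem, hne] with t ht hts
    -- If `t < s`, the pair `a` is the earlier one and `b` plays the role of `R'` in
    -- `measureReal_blocking`; if `s < t`, the roles are exchanged.
    rcases lt_or_gt_of_ne hts with h | h
    · have h1 : ((pairMeasure p).prod markLaw).real
          {z | BlocksII p (b, s) z ∨ BlocksII p (a, t) z} = t * A + s * B := by
        have h2 := measureReal_blocking hlp ham hbm haW hbW ht hs h.le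
        rw [measureReal_pairRegion, union_comm] at h2
        refine Eq.trans ?_ h2
        congr 1
        ext z
        exact or_comm
      have h3 : E t s = 0 := if_neg h.not_gt
      have h4 : E s t = ENNReal.ofReal (Real.exp (-(t * A + s * B))) := if_pos h
      rw [h1, h3, h4, mul_zero, zero_add, hc₂]
      simp only [BlocksII, h, h.not_gt, and_true, and_false, not_false_eq_true]
      by_cases h5 : a.1 ∈ pairRegion p b <;> simp [h5]
    · have h1 : ((pairMeasure p).prod markLaw).real
          {z | BlocksII p (b, s) z ∨ BlocksII p (a, t) z} = s * A + t * B := by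
        have h2 := measureReal_blocking hlp hbm ham hbW haW hs ht h.le
        rwa [measureReal_pairRegion] at h2
      have h3 : E s t = 0 := if_neg h.not_gt
      have h4 : E t s = ENNReal.ofReal (Real.exp (-(s * A + t * B))) := if_pos h
      rw [h1, h3, h4, mul_zero, add_zero, hc₁]
      simp only [BlocksII, h, h.not_gt, and_true, and_false, not_false_eq_true, true_and]
      by_cases h5 : b.1 ∈ pairRegion p a <;> simp [h5]
  have hstep : ∀ s, ∫⁻ t, (c₁ * E t s + c₂ * E s t) ∂markLaw =
      c₁ * ∫⁻ t, E t s ∂markLaw + c₂ * ∫⁻ t, E s t ∂markLaw := by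
    intro s
    rw [lintegral_add_left ((hEm2 s).const_mul _), lintegral_const_mul _ (hEm2 s),
      lintegral_const_mul _ (hEm1 s)]
  have hl1 : Measurable fun s => ∫⁻ t, E t s ∂markLaw := hEm.lintegral_prod_left'
  have hl2 : Measurable fun s => ∫⁻ t, E s t ∂markLaw := hEm.lintegral_prod_right'
  rw [lintegral_congr_ae (hpt.mono fun s hs => lintegral_congr_ae hs), lintegral_congr hstep,
    lintegral_add_left (hl1.const_mul _), lintegral_const_mul _ hl1, lintegral_const_mul _ hl2,
    hE1, hE2, ← add_mul, densityII, if_pos hab]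

variable {Ω : Type*} [MeasurableSpace Ω] {μ : Measure Ω} [IsProbabilityMeasure μ]
  {y : ℕ → Ω → ℂ} {θ t : ℕ → Ω → ℝ}

theorem isPoissonOn_timed_pairs (h : IsMarkedPPP μ p.lp y θ) (ht : IsTimeMarks μ y θ t)
    (hlp : 0 < p.lp) :
    IsPoissonOn μ (fun k ω => ((y k ω, θ k ω), t k ω)) ((window p ×ˢ univ) ×ˢ univ)
      ((pairMeasure p).prod markLaw) :=
  (isPoissonOn_pairs h hlp).marked ht.measurable
    (fun k => (ht.uniform k).trans cond_Icc_eq_markLaw) ht.iindep ht.indep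

/-- A pair with mark `s` competes only with marks below `s`, a thinning of the process to intensity
`s * lp`, so it survives with probability `exp (-s * lp * areaO p)`; this is averaged over `s` in
`[0, 1]`. -/
theorem intensity_activeII (h : IsMarkedPPP μ p.lp y θ) (ht : IsTimeMarks μ y θ t) (hd : 0 < p.d)
    (hRt : 0 < p.Rt) (hRr : 0 < p.Rr) (hlp : 0 < p.lp) (hpos : 0 < areaO p) :
    intensity μ y (activeII p y θ t) =
      ENNReal.ofReal (1 / areaO p * (1 - Real.exp (-(p.lp * areaO p)))) := by
  have hQ : MeasurableSet {b : ℂ × ℝ | b.1 ∈ unitSquare} := measurable_fst measurableSet_unitSquare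
  have hQ' : MeasurableSet {x : (ℂ × ℝ) × ℝ | x.1.1 ∈ unitSquare} := measurable_fst hQ
  have hQW := unitSquare_subset_window hd hRt hRr
  have key := (isPoissonOn_timed_pairs h ht hlp).lintegral_retained (R := BlocksII p)
    (measurableSet_blocksII p) hQ' (fun x hx => ⟨⟨hQW hx, mem_univ _⟩, mem_univ _⟩)
    fun x hx z hz => ⟨⟨pairRegion_subset_window hd hRt hRr hx hz.1, mem_univ _⟩, mem_univ _⟩
  rw [intensity, activeII_eq_retained]
  refine key.trans ?_
  have hset : {x : (ℂ × ℝ) × ℝ | x.1.1 ∈ unitSquare} = {b | b.1 ∈ unitSquare} ×ˢ univ := by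
    ext x
    simp
  have hprod : ((pairMeasure p).prod markLaw).restrict {x | x.1.1 ∈ unitSquare} =
      ((pairMeasure p).restrict {b | b.1 ∈ unitSquare}).prod markLaw := by
    rw [hset, ← Measure.prod_restrict, Measure.restrict_univ]
  have h1 : ∀ᵐ x ∂((pairMeasure p).restrict {b | b.1 ∈ unitSquare}).prod markLaw,
      ENNReal.ofReal (Real.exp (-((pairMeasure p).prod markLaw).real {z | BlocksII p x z})) =
        ENNReal.ofReal (Real.exp (-(x.2 * (p.lp * areaO p)))) := by
    have hq : ∀ᵐ x ∂((pairMeasure p).restrict {b | b.1 ∈ unitSquare}).prod markLaw,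
        x ∈ {b : ℂ × ℝ | b.1 ∈ unitSquare} ×ˢ Icc (0 : ℝ) 1 := by
      rw [markLaw, Measure.prod_restrict]
      exact ae_restrict_mem (hQ.prod measurableSet_Icc)
    filter_upwards [hq] with x hx
    have hW := pairRegion_subset_window hd hRt hRr hx.1
    have h2 := measureReal_blocking hlp (measurableSet_pairRegion p x.1)
      (measurableSet_pairRegion p x.1) hW hW hx.2 hx.2 le_rfl
    simp only [or_self, union_self, sub_self, mul_zero, zero_add, measureReal_pairRegion] at h2
    have h3 : {z | BlocksII p x z} =
      {z : (ℂ × ℝ) × ℝ | z.1.1 ∈ pairRegion p x.1 ∧ z.2 < x.2} := rfl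
    rw [h3, h2]
  have hm : Measurable fun s : ℝ => ENNReal.ofReal (Real.exp (-(s * (p.lp * areaO p)))) := by
    fun_prop
  have hc : 0 < p.lp * areaO p := mul_pos hlp hpos
  rw [hprod, lintegral_congr_ae h1, lintegral_prod
    (fun x : (ℂ × ℝ) × ℝ => ENNReal.ofReal (Real.exp (-(x.2 * (p.lp * areaO p)))))
    (hm.comp measurable_snd).aemeasurable]
  dsimp only
  rw [setLIntegral_const, pairMeasure_fst measurableSet_unitSquare hQW, volume_unitSquare, mul_one,
    markLaw, lintegral_exp_neg hc zero_le_one, mul_comm, ← ENNReal.ofReal_mul hlp.le]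
  congr 1
  field_simp

open scoped Classical in
theorem palm_numerator_activeII (h : IsMarkedPPP μ p.lp y θ) (ht : IsTimeMarks μ y θ t)
    (hd : 0 < p.d) (hRt : 0 < p.Rt) (hRr : 0 < p.Rr) (hlp : 0 < p.lp) (hpos : 0 < areaO p) :
    ∫⁻ ω, ∑' i, (if i ∈ activeII p y θ t ω ∧ y i ω ∈ unitSquare then
      hiddenNodes p (seenFrom y θ (activeII p y θ t) i ω) else 0) ∂μ = ENNReal.ofReal p.lp ^ 2 *
        ((ENNReal.ofReal (2 * Real.pi))⁻¹ * ∫⁻ u, hiddenMass p (pairKernelII p) u) := by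
  have hQ : MeasurableSet {b : ℂ × ℝ | b.1 ∈ unitSquare} := measurable_fst measurableSet_unitSquare
  have hQW := unitSquare_subset_window hd hRt hRr
  set D : Set (((ℂ × ℝ) × ℝ) × ((ℂ × ℝ) × ℝ)) := {q | q.1.1.1 ∈ unitSquare ∧
      receiver p q.1.1.1 q.1.1.2 ∈ pairRegionT p q.2.1} with hDdef
  have hD : MeasurableSet D := by
    have m : Measurable fun q : ((ℂ × ℝ) × ℝ) × ((ℂ × ℝ) × ℝ) => (q.1.1, q.2.1) := by fun_prop
    exact m ((measurable_fst hQ).inter (measurableSet_receiver_mem p))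
  have key := (isPoissonOn_timed_pairs h ht hlp).lintegral_retained_pairs (R := BlocksII p)
    (measurableSet_blocksII p) hD (by
      rintro x x' ⟨hb, hab⟩
      refine ⟨⟨⟨hQW hb, mem_univ _⟩, mem_univ _⟩,
        ⟨⟨mem_window_of_receiver_mem hd hRt hRr hb hab, mem_univ _⟩, mem_univ _⟩, ?_⟩
      rintro z (hz | hz)
      · exact ⟨⟨pairRegion_subset_window hd hRt hRr hb hz.1, mem_univ _⟩, mem_univ _⟩
      · exact ⟨⟨pairRegion_subset_window_of_receiver_mem hd hRt hRr hb hab hz.1, mem_univ _⟩,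
          mem_univ _⟩)
  rw [← lintegral_densityII hd hRt hRr hlp hpos]
  set ν := (pairMeasure p).prod markLaw with hν
  set K : (ℂ × ℝ) × ℝ → (ℂ × ℝ) × ℝ → ℝ≥0∞ := fun x x' =>
    if (x, x') ∈ D ∧ ¬BlocksII p x x' ∧ ¬BlocksII p x' x then
      ENNReal.ofReal (Real.exp (-ν.real {z | BlocksII p x z ∨ BlocksII p x' z})) else 0 with hK
  have hKm : Measurable (Function.uncurry K) := by
    have hbad : MeasurableSet {q : (((ℂ × ℝ) × ℝ) × ((ℂ × ℝ) × ℝ)) × ((ℂ × ℝ) × ℝ) |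
        BlocksII p q.1.1 q.2 ∨ BlocksII p q.1.2 q.2} := by
      have m1 : Measurable fun q : (((ℂ × ℝ) × ℝ) × ((ℂ × ℝ) × ℝ)) × ((ℂ × ℝ) × ℝ) =>
        (q.1.1, q.2) := by fun_prop
      have m2 : Measurable fun q : (((ℂ × ℝ) × ℝ) × ((ℂ × ℝ) × ℝ)) × ((ℂ × ℝ) × ℝ) =>
        (q.1.2, q.2) := by fun_prop
      exact (m1 (measurableSet_blocksII p)).union (m2 (measurableSet_blocksII p))
    refine Measurable.ite ?_ ?_ measurable_const
    · exact hD.inter ((measurableSet_blocksII p).compl.inter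
        (measurable_swap (measurableSet_blocksII p)).compl)
    · exact (Real.measurable_exp.comp
        (measurable_measure_prodMk_left hbad).ennreal_toReal.neg).ennreal_ofReal
  calc _ = _ := ?_
    _ = _ := key
    _ = _ := ?_
  · refine lintegral_congr_ae ?_
    filter_upwards [ae_injOn_window h.ppp hlp] with ω hω
    rw [tsum_hiddenNodes_seenFrom hd hRt hRr hω, activeII_eq_retained]
    refine tsum_congr fun i => tsum_congr fun j => ?_
    simp only [hDdef, mem_ofPred_eq]
  · have hKeq : ∀ x x', (if (x, x') ∈ D ∧ ¬BlocksII p x x' ∧ ¬BlocksII p x' x then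
        ENNReal.ofReal (Real.exp (-ν.real {z | BlocksII p x z ∨ BlocksII p x' z})) else 0) =
          K x x' := fun _ _ => rfl
    refine (lintegral_congr fun x => lintegral_congr fun x' => ?_ :
      _ = ∫⁻ x, ∫⁻ x', K x x' ∂ν ∂ν).trans ?_
    · rw [← hKeq]
      congr
    have hKx : ∀ x, Measurable (K x) := fun x => hKm.comp measurable_prodMk_left
    have h1 : ∀ x, ∫⁻ x', K x x' ∂ν = ∫⁻ a, ∫⁻ τ, K x (a, τ) ∂markLaw ∂pairMeasure p :=
      fun x => lintegral_prod _ (hKx x).aemeasurable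
    have h2 : Measurable fun x => ∫⁻ x', K x x' ∂ν := hKm.lintegral_prod_right'
    rw [hν, lintegral_prod _ h2.aemeasurable, ← lintegral_indicator hQ]
    refine lintegral_congr fun b => ?_
    simp only [h1]
    have h3 : Measurable fun q : ℝ × (ℂ × ℝ) => ∫⁻ τ, K (b, q.1) (q.2, τ) ∂markLaw := by
      have m : Measurable fun q : (ℝ × (ℂ × ℝ)) × ℝ => ((b, q.1.1), (q.1.2, q.2)) := by fun_prop
      exact (hKm.comp m).lintegral_prod_right'
    -- The first mark is moved inside the integral over the second pair, so that both marks are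
    -- integrated innermost and `lintegral_marks_eq` applies.
    rw [lintegral_lintegral_swap h3.aemeasurable]
    by_cases hb : b ∈ {b : ℂ × ℝ | b.1 ∈ unitSquare}
    · rw [indicator_of_mem hb]
      refine lintegral_congr fun a => ?_
      by_cases hab : receiver p b.1 b.2 ∈ pairRegionT p a
      · rw [← lintegral_marks_eq hlp hd hRt hRr hb hab]
        refine lintegral_congr fun s => lintegral_congr fun τ => ?_
        have hmem : ((b, s), (a, τ)) ∈ D := ⟨hb, hab⟩
        simp only [hK, hmem, true_and]
        congr
      · have hmem : ∀ s τ, ((b, s), (a, τ)) ∉ D := fun s τ h => hab h.2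
        simp [hK, hmem, densityII, hab]
    · rw [indicator_of_notMem hb]
      have hmem : ∀ s a τ, ((b, s), (a, τ)) ∉ D := fun s a τ h => hb h.1
      simp [hK, hmem]

end TypeII

end GHCP

/-! ### The formulas for both types of thinning -/

theorem theorem3 {Ω : Type*} [MeasurableSpace Ω] (μ : MeasureTheory.Measure Ω)
    [MeasureTheory.IsProbabilityMeasure μ] (p : GHCP.Params)
    (hd : 0 < p.d) (hRt : 0 < p.Rt) (hRr : 0 < p.Rr) (hd0 : 0 < p.d0) (hwl : 0 < p.wl)
    (hNt : 0 < p.Nt) (hNr : 0 < p.Nr) (hlp : 0 < p.lp)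
    (hbeam : p.wl / (p.d0 * p.Nt) ≤ Real.pi)
    (y : ℕ → Ω → ℂ) (θ : ℕ → Ω → ℝ) (hΦ : GHCP.IsMarkedPPP μ p.lp y θ) :
    (∃ lb : ℝ, lb = p.lp * Real.exp (-(p.lp * GHCP.areaO p)) ∧
      GHCP.intensity μ y (GHCP.activeI p y θ) = ENNReal.ofReal lb ∧
      GHCP.palmExpectation μ y θ (GHCP.activeI p y θ) (GHCP.hiddenNodes p) ≠ ⊤ ∧
      (GHCP.palmExpectation μ y θ (GHCP.activeI p y θ) (GHCP.hiddenNodes p)).toReal =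
        p.lp ^ 2 / (Real.pi * lb) * GHCP.hiddenIntegral p (GHCP.kernelI p)) ∧
    (∀ t : ℕ → Ω → ℝ, GHCP.IsTimeMarks μ y θ t →
      ∃ lb : ℝ, lb = 1 / GHCP.areaO p * (1 - Real.exp (-(p.lp * GHCP.areaO p))) ∧
        GHCP.intensity μ y (GHCP.activeII p y θ t) = ENNReal.ofReal lb ∧
        GHCP.palmExpectation μ y θ (GHCP.activeII p y θ t) (GHCP.hiddenNodes p) ≠ ⊤ ∧
        (GHCP.palmExpectation μ y θ (GHCP.activeII p y θ t) (GHCP.hiddenNodes p)).toReal =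
          p.lp ^ 2 / (Real.pi * lb) * GHCP.hiddenIntegral p (GHCP.kernelII p)) := by
  have hpos := GHCP.areaO_pos hd hRt hRr hd0 hwl hNt
  refine ⟨⟨_, rfl, GHCP.intensity_activeI hΦ hd hRt hRr hlp, ?_⟩, fun t ht =>
    ⟨_, rfl, GHCP.intensity_activeII hΦ ht hd hRt hRr hlp hpos, ?_⟩⟩
  · exact GHCP.palmExpectation_eq (GHCP.isPairKernel_pairKernelI hlp)
      (GHCP.kernelI_eq hd hRt hRr) hd hRt hd0 hwl hNt hlp hbeam (mul_pos hlp (Real.exp_pos _))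
      (GHCP.intensity_activeI hΦ hd hRt hRr hlp)
      (GHCP.palm_numerator_activeI hΦ hd hRt hRr hlp)
  · refine GHCP.palmExpectation_eq (GHCP.isPairKernel_pairKernelII hlp hd hRt hRr hpos)
      (GHCP.kernelII_eq hd hRt hRr) hd hRt hd0 hwl hNt hlp hbeam ?_
      (GHCP.intensity_activeII hΦ ht hd hRt hRr hlp hpos)
      (GHCP.palm_numerator_activeII hΦ ht hd hRt hRr hlp hpos)
    have h1 : Real.exp (-(p.lp * GHCP.areaO p)) < 1 :=
      Real.exp_lt_one_iff.2 (neg_neg_of_pos (mul_pos hlp hpos))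
    exact mul_pos (one_div_pos.2 hpos) (sub_pos.2 h1)
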